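/- **Setting.** Let $Q$ be a finite-dimensional, Hausdorff, second countable smooth manifold, $M=T^1_kQ=TQ\oplus_Q\cdots\oplus_QTQ$ ($k$ copies), with projection $\pi:M\to Q$ and points $(q;v_1,\dots,v_k)$. Let $J^\alpha$ be the vertical endomorphisms, $\Delta$ the Liouville field, $\mathcal L\in C^\infty(M)$, $\theta^\alpha=d\mathcal L\circ J^\alpha$, $\omega^\alpha=-d\theta^\alpha$, $\mathcal E=\Delta(\mathcal L)-\mathcal L$, and $\Omega(\mathbf Y)=\sum_\alpha i(Y_\alpha)\omega^\alpha$ for $\mathbf Y=(Y_1,\dots,Y_k)$. A $k$-vector field $\mathbf Y$ on $M$ *solves the Lagrangian equation* at $x$ if $\Omega(\mathbf Y)=d\mathcal E$ at $x$, and is a *SOPDE* at $x=(q;v)$ if $T_x\pi(Y_\alpha)=v_\alpha$ for all $\alpha$. Assume $\mathcal L$ is almost-regular: its Legendre transformation (fibre derivative) $M\to(T^1_k)^*Q$ has closed submanifold as image, is a submersion onto its image, and has connected submanifolds as fibres. Put $$\mathfrak X^\perp=\{Z\in\mathfrak X(M): \Omega(\mathbf Y)(Z)=0\ \text{for all }k\text{-vector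 fields }\mathbf Y\},\qquad \mathfrak M=\{Z\in\mathfrak X(M):\Omega(\mathbf V)(Z)=0\ \text{for all }\pi\text{-vertical }\mathbf V\},$$ and assume that the corresponding pointwise distributions $\bigcap_\alpha\ker\omega^\alpha_x$ and $\{z\in T_xM:\omega^\alpha_x(u,z)=0\ \forall\alpha,\ \forall u\in\ker T_x\pi\}$ have locally constant rank. Let $\operatorname{Ker}^V\omega^\alpha$ be the vertical vector fields $V$ with $i(V)\omega^\alpha=0$, and $\operatorname{Ker}^V\Omega$ the vertical $k$-vector fields $\mathbf V$ with $\Omega(\mathbf V)=0$. Let $P_1=\{x\in M: d\mathcal E_x\in\operatorname{Im}\Omega_x\}$, assumed to be a closed submanifold of $M$. Let $\mathbf X$ be a smooth $k$-vector field solving the Lagrangian equation on $P_1$, and let $S_1$ be the set of $x\in P_1$ for which there is $\mathbf Y_x\in\ker\Omega_x$ with $\sum_\alpha J^\alpha(X_\alpha+Y_\alpha)_x=\Delta_x$; it is assumed to be a closed submanifold. Let $\mathbf\Gamma_0$ be any smooth SOPDE on $M$. The *dynamical constraints* are $\zeta^{(Z)}=d\mathcal E(Z)$, $Z\in\mathfrak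 X^\perp$; the *SOPDE (non-dynamical) constraints* are $\eta^{(Z)}=\Omega(\mathbf\Gamma_0-\mathbf X)(Z)$, $Z\in\mathfrak M\setminus\mathfrak X^\perp$. A set $\mathcal Z\subseteq\mathfrak M\setminus\mathfrak X^\perp$ is called a *complete independent system* if (a) for all $x\in S_1$ and $Z\in\mathfrak M$, $Z_x=Z'_x+u+Z_{0,x}$ for some $Z'\in\operatorname{span}_{\mathbb R}\mathcal Z$, $u\in\ker T_x\pi$, $Z_0\in\mathfrak X^\perp$ (the functions $\eta$ defined by vertical fields and by elements of $\mathfrak X^\perp$ vanish on $P_1$); (b) the constraints are independent of those defining $P_1$: if $x\in S_1$, $Z\in\operatorname{span}_{\mathbb R}\mathcal Z$ and $d\eta^{(Z)}_x$ vanishes on $T_xP_1$, then $d\eta^{(Z)}_x=0$. **Lemma.** Let $\mathbf\Gamma$ be a smooth $k$-vector field on $M$ which on $S_1$ is a SOPDE and solves the Lagrangian equation. Then: 1. Complete independent systems exist. 2. If $\mathbf X$ satisfies the fibre components of the Lagrangian equation everywhere, i.e. $\Omega(\mathbf X)(u)=d\mathcal E(u)$ for every vertical vector $u$ at every point of $M$,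 then $\mathfrak M\setminus\mathfrak X^\perp$ itself is a complete independent system. 3. For every complete independent system $\mathcal Z$ there are global smooth vector fields $V_\alpha\in\operatorname{Ker}^V\omega^\alpha$ ($1\le\alpha\le k$) such that $\Gamma_\alpha(\eta^{(Z)})=-V_\alpha(\eta^{(Z)})$ on $S_1$ for all $Z\in\mathcal Z$ and all $\alpha$. 4. Tangency on the SOPDE constraints gives no new constraints: for every complete independent system $\mathcal Z$, the set of all $x\in S_1$ for which some $\mathbf V\in\operatorname{Ker}^V\Omega$ satisfies $(\Gamma_\alpha+V_\alpha)(\zeta^{(Z)})(x)=0$ for all $\alpha$ and $Z\in\mathfrak X^\perp$, and $(\Gamma_\alpha+V_\alpha)(\eta^{(Z)})(x)=0$ for all $\alpha$ and $Z\in\mathcal Z$, equals the set of all $x\in S_1$ for which some $\mathbf V\in\operatorname{Ker}^V\Omega$ satisfies the first group of equations. 5. Likewise, with all SOPDE constraints at once: if for $x\in S_1$ there is $\mathbf V\in\operatorname{Ker}^V\Omega$ with $(\Gamma_\alpha+V_\alpha)_x\in T_xP_1$ for all $\alpha$, then $\mathbf V\in\operatorname{Ker}^V\Omega$ can be chosen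 such that in addition $(\Gamma_\alpha+V_\alpha)(\eta^{(Z)})(x)=0$ for all $\alpha$ and all $Z\in\mathfrak M\setminus\mathfrak X^\perp$. -/

import Mathlib

open Bundle Set Filter
open scoped Manifold Topology ContDiff

noncomputable section

/-! ### The `k`-tangent bundle

`Q` is a smooth manifold modelled on a normed space `E`. Its `k`-tangent bundle is the Whitney sum
of `k` copies of the tangent bundle: the fibre over `q` consists of the `k`-tuples of tangent
vectors at `q`, and the transition maps are those of the tangent bundle, componentwise. -/

section KTangent

variable (E : Type*) [NormedAddCommGroup E] [NormedSpace ℝ E] (k : ℕ)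
variable {Q : Type*} [TopologicalSpace Q] [ChartedSpace E Q]

/-- The fibre of the `k`-tangent bundle: `k`-tuples of tangent vectors at `q`. -/
def KTangentSpace (q : Q) : Type _ := Fin k → TangentSpace 𝓘(ℝ, E) q

instance (q : Q) : TopologicalSpace (KTangentSpace E k q) :=
  inferInstanceAs (TopologicalSpace (Fin k → E))

instance (q : Q) : AddCommGroup (KTangentSpace E k q) :=
  inferInstanceAs (AddCommGroup (Fin k → E))

instance (q : Q) : Module ℝ (KTangentSpace E k q) :=
  inferInstanceAs (Module ℝ (Fin k → E))

instance (q : Q) : IsTopologicalAddGroup (KTangentSpace E k q) :=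
  inferInstanceAs (IsTopologicalAddGroup (Fin k → E))

instance (q : Q) : ContinuousSMul ℝ (KTangentSpace E k q) :=
  inferInstanceAs (ContinuousSMul ℝ (Fin k → E))

variable {E} in
/-- The linear map `(v₁, …, v_k) ↦ (c v₁, …, c v_k)`. -/
def kMap (c : E →L[ℝ] E) : (Fin k → E) →L[ℝ] (Fin k → E) :=
  ContinuousLinearMap.piMap fun _ => c

variable {E} in
theorem kMap_eq_sum (c : E →L[ℝ] E) :
    kMap k c = ∑ α : Fin k, (ContinuousLinearMap.single ℝ (fun _ : Fin k => E) α).comp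
      (c.comp (ContinuousLinearMap.proj (R := ℝ) (φ := fun _ : Fin k => E) α)) := by
  ext v β
  simp [kMap, Finset.sum_apply, Pi.single_apply]

theorem contDiff_kMap : ContDiff ℝ ∞ (kMap k : (E →L[ℝ] E) → _) := by
  have h : (kMap k : (E →L[ℝ] E) → _) = fun c => ∑ α : Fin k,
      (ContinuousLinearMap.single ℝ (fun _ : Fin k => E) α).comp
      (c.comp (ContinuousLinearMap.proj (R := ℝ) (φ := fun _ : Fin k => E) α)) :=
    funext (kMap_eq_sum k)
  rw [h]
  exact ContDiff.sum fun α _ => contDiff_const.clm_comp (contDiff_id.clm_comp contDiff_const)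

variable (Q) [IsManifold 𝓘(ℝ, E) ∞ Q]

/-- The vector bundle core of the `k`-tangent bundle. -/
def kTangentCore : VectorBundleCore ℝ Q (Fin k → E) (atlas E Q) where
  baseSet i := i.1.source
  isOpen_baseSet i := i.1.open_source
  indexAt := achart E
  mem_baseSet_at := mem_chart_source E
  coordChange i j x := kMap k ((tangentBundleCore 𝓘(ℝ, E) Q).coordChange i j x)
  coordChange_self i x hx v := by
    funext α
    exact (tangentBundleCore 𝓘(ℝ, E) Q).coordChange_self i x hx (v α)
  continuousOn_coordChange i j :=
    (contDiff_kMap E k).continuous.comp_continuousOn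
      ((tangentBundleCore 𝓘(ℝ, E) Q).continuousOn_coordChange i j)
  coordChange_comp i j l x hx v := by
    funext α
    exact (tangentBundleCore 𝓘(ℝ, E) Q).coordChange_comp i j l x hx (v α)

instance : (kTangentCore E k Q).IsContMDiff 𝓘(ℝ, E) ∞ where
  contMDiffOn_coordChange i j := by
    have : IsManifold 𝓘(ℝ, E) (∞ + 1) Q := inferInstanceAs (IsManifold 𝓘(ℝ, E) ∞ Q)
    have := tangentBundleCore.isContMDiff (I := 𝓘(ℝ, E)) (M := Q) (n := ∞)
    exact (contDiff_kMap E k).contMDiff.comp_contMDiffOn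
      ((tangentBundleCore 𝓘(ℝ, E) Q).contMDiffOn_coordChange 𝓘(ℝ, E) (n := ∞) i j)

/-- The `k`-tangent bundle `T¹ₖQ`; its points are `⟨q, v⟩` with `v α ∈ T_q Q` for `α : Fin k`. -/
abbrev KTangent : Type _ := TotalSpace (Fin k → E) (KTangentSpace E k : Q → Type _)

instance : TopologicalSpace (KTangent E k Q) :=
  inferInstanceAs (TopologicalSpace (kTangentCore E k Q).TotalSpace)

instance : FiberBundle (Fin k → E) (KTangentSpace E k : Q → Type _) :=
  inferInstanceAs (FiberBundle (Fin k → E) (kTangentCore E k Q).Fiber)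

instance : VectorBundle ℝ (Fin k → E) (KTangentSpace E k : Q → Type _) :=
  inferInstanceAs (VectorBundle ℝ (Fin k → E) (kTangentCore E k Q).Fiber)

instance : ContMDiffVectorBundle ∞ (Fin k → E) (KTangentSpace E k : Q → Type _) 𝓘(ℝ, E) :=
  inferInstanceAs (ContMDiffVectorBundle ∞ (Fin k → E) (kTangentCore E k Q).Fiber 𝓘(ℝ, E))

/-- The model of `T¹ₖQ` as a manifold. -/
abbrev kModel : ModelWithCorners ℝ (E × (Fin k → E)) (ModelProd E (Fin k → E)) :=
  𝓘(ℝ, E).prod 𝓘(ℝ, Fin k → E)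

/-- The fibre over `q` of the `k`-cotangent bundle `T*Q ⊕ ⋯ ⊕ T*Q`, as the dual space of
`T_qQ ⊕ ⋯ ⊕ T_qQ`: the covectors `(p¹, …, pᵏ)` are the linear form `v ↦ ∑ α, p^α (v α)`. -/
abbrev KCotangentSpace (q : Q) : Type _ := KTangentSpace E k q →L[ℝ] Bundle.Trivial Q ℝ q

/-- The `k`-cotangent bundle `(T¹ₖ)*Q`. -/
abbrev KCotangent : Type _ :=
  TotalSpace ((Fin k → E) →L[ℝ] ℝ) (KCotangentSpace E k Q)

/-- The model of `(T¹ₖ)*Q` as a manifold. -/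
abbrev kCoModel : ModelWithCorners ℝ (E × ((Fin k → E) →L[ℝ] ℝ))
    (ModelProd E ((Fin k → E) →L[ℝ] ℝ)) :=
  𝓘(ℝ, E).prod 𝓘(ℝ, (Fin k → E) →L[ℝ] ℝ)

end KTangent

/-! ### Vector fields, forms and submanifolds -/

section Manifolds

variable {H : Type*} [NormedAddCommGroup H] [NormedSpace ℝ H] {H' : Type*} [TopologicalSpace H']
  (I : ModelWithCorners ℝ H H') {M : Type*} [TopologicalSpace M] [ChartedSpace H' M]

/-- The differential of a real function at a point, as a covector. -/
def dAt (f : M → ℝ) (x : M) : TangentSpace I x →L[ℝ] ℝ := mfderiv I 𝓘(ℝ, ℝ) f x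

/-- The vector field `Z` on `M` is smooth. -/
def IsSmoothVF [IsManifold I 1 M] (Z : (x : M) → TangentSpace I x) : Prop :=
  ContMDiff I I.tangent ∞ fun x => (⟨x, Z x⟩ : TangentBundle I M)

/-- The coordinate expression, in the preferred chart at `x`, of the 1-form `θ`. -/
def localForm (θ : (x : M) → TangentSpace I x →L[ℝ] ℝ) (x : M) (y : H) : H →L[ℝ] ℝ :=
  (θ ((extChartAt I x).symm y)).comp (mfderiv 𝓘(ℝ, H) I (extChartAt I x).symm y)

/-- The exterior derivative of a 1-form on a manifold without boundary, computed in the preferred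
chart at the given point: `dθ(u, w) = D_u θ(w) - D_w θ(u)`. -/
def extDerivOneForm (θ : (x : M) → TangentSpace I x →L[ℝ] ℝ) (x : M) :
    TangentSpace I x →ₗ[ℝ] TangentSpace I x →ₗ[ℝ] ℝ :=
  let D : H →L[ℝ] H →L[ℝ] ℝ := fderiv ℝ (localForm I θ x) (extChartAt I x x)
  let c : TangentSpace I x →L[ℝ] H := mfderiv I 𝓘(ℝ, H) (extChartAt I x) x
  LinearMap.mk₂ ℝ (fun u w => D (c u) (c w) - D (c w) (c u))
    (fun u u' w => by simp only [map_add, add_apply]; ring)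
    (fun r u w => by simp only [map_smul, smul_apply, smul_eq_mul]; ring)
    (fun u w w' => by simp only [map_add, add_apply]; ring)
    (fun r u w => by simp only [map_smul, smul_apply, smul_eq_mul]; ring)

/-- `S` is an embedded smooth submanifold: around each of its points there is a chart of `M` in
which `S` is a piece of a linear subspace. -/
def IsEmbeddedSubmanifold (S : Set M) : Prop :=
  ∀ x ∈ S, ∃ φ ∈ IsManifold.maximalAtlas I ∞ M, x ∈ φ.source ∧
    ∃ W : Submodule ℝ H, ∀ y ∈ φ.source, y ∈ S ↔ φ.extend I y ∈ W

/-- `S` is a closed submanifold: closed as a subset, and an embedded submanifold. -/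
def IsClosedSubmanifold (S : Set M) : Prop := IsClosed S ∧ IsEmbeddedSubmanifold I S

/-- The vector `u` at `x` is tangent to `S`: it is the velocity of a smooth curve in `S`. -/
def IsTangentTo (S : Set M) (x : M) (u : TangentSpace I x) : Prop :=
  ∃ γ : ℝ → M, ContMDiffAt 𝓘(ℝ, ℝ) I ∞ γ 0 ∧ (∀ᶠ t in 𝓝 (0 : ℝ), γ t ∈ S) ∧
    (⟨γ 0, mfderiv 𝓘(ℝ, ℝ) I γ 0 (1 : ℝ)⟩ : TangentBundle I M) = ⟨x, u⟩

end Manifolds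

/-! ### The Lagrangian formalism on the `k`-tangent bundle -/

section Lagrangian

variable {E : Type*} [NormedAddCommGroup E] [NormedSpace ℝ E] {k : ℕ}
variable {Q : Type*} [TopologicalSpace Q] [ChartedSpace E Q] [IsManifold 𝓘(ℝ, E) ∞ Q]

/-- The tangent space of `T¹ₖQ` at a point. -/
abbrev TK (x : KTangent E k Q) : Type _ := TangentSpace (kModel E k) x

variable (E k Q) in
/-- Vector fields on `T¹ₖQ`, without regularity. -/
abbrev VF : Type _ := (x : KTangent E k Q) → TK x

variable (E k Q) in
/-- `k`-vector fields on `T¹ₖQ`, without regularity. -/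
abbrev KVF : Type _ := Fin k → VF E k Q

/-- The `k`-vector field `Y` is smooth. -/
def IsSmoothKVF (Y : KVF E k Q) : Prop := ∀ α, IsSmoothVF (kModel E k) (Y α)

/-- The derivative at `x` of the projection `π : T¹ₖQ → Q`. -/
def dProj (x : KTangent E k Q) : TK x →L[ℝ] TangentSpace 𝓘(ℝ, E) x.1 :=
  mfderiv (kModel E k) 𝓘(ℝ, E) (fun y : KTangent E k Q => y.1) x

/-- The vertical subspace at `x`. -/
def vert (x : KTangent E k Q) : Submodule ℝ (TK x) := LinearMap.ker (dProj x).toLinearMap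

/-- The vertical lift of `w = (w₁, …, w_k)` to `x = (q; v)`: the derivative at `v` of the inclusion
of the fibre over `q`, in the direction `w`, i.e. the velocity at `t = 0` of `t ↦ (q; v + t w)`. -/
def vertLift (x : KTangent E k Q) : KTangentSpace E k x.1 →L[ℝ] TK x :=
  mfderiv 𝓘(ℝ, Fin k → E) (kModel E k)
    (fun w : Fin k → E => (⟨x.1, w⟩ : KTangent E k Q)) x.2

/-- The vertical `α`-lift of `u ∈ T_qQ`: the velocity of `t ↦ (q; v₁, …, v_α + t u, …, v_k)`. -/
def vertLiftAt (α : Fin k) (x : KTangent E k Q) : TangentSpace 𝓘(ℝ, E) x.1 →L[ℝ] TK x :=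
  (vertLift x).comp (ContinuousLinearMap.single ℝ (fun _ : Fin k => E) α)

/-- The vertical endomorphism `J^α`. -/
def vertEndo (α : Fin k) (x : KTangent E k Q) : TK x →L[ℝ] TK x :=
  (vertLiftAt α x).comp (dProj x)

/-- The Liouville vector field `Δ`. -/
def liouville (x : KTangent E k Q) : TK x := ∑ α, vertLiftAt α x (x.2 α)

variable (L : KTangent E k Q → ℝ)

/-- The Cartan 1-forms `θ^α = dL ∘ J^α`. -/
def cartanOne (α : Fin k) (x : KTangent E k Q) : TK x →L[ℝ] ℝ :=
  (dAt (kModel E k) L x).comp (vertEndo α x)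

/-- The Cartan 2-forms `ω^α = - dθ^α`. -/
def cartanTwo (α : Fin k) (x : KTangent E k Q) : TK x →ₗ[ℝ] TK x →ₗ[ℝ] ℝ :=
  - extDerivOneForm (kModel E k) (cartanOne L α) x

/-- The Lagrangian energy `Δ(L) - L`. -/
def energy (x : KTangent E k Q) : ℝ := dAt (kModel E k) L x (liouville x) - L x

/-- `Ω(Y) = ∑ α, i(Y_α) ω^α` for a `k`-vector `Y` at the point `x`. -/
def Om (x : KTangent E k Q) (Y : Fin k → TK x) : TK x →ₗ[ℝ] ℝ := ∑ α, cartanTwo L α x (Y α)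

/-- The `k`-vector `Y` at `x` solves the Lagrangian equation `∑ α, i(Y_α) ω^α = d(energy)`. -/
def IsLagrangianAt (x : KTangent E k Q) (Y : Fin k → TK x) : Prop :=
  Om L x Y = (dAt (kModel E k) (energy L) x).toLinearMap

/-- The `k`-vector `Y` at `x = (q; v)` satisfies the second-order condition `T_xπ(Y_α) = v_α`. -/
def IsSopdeAt (x : KTangent E k Q) (Y : Fin k → TK x) : Prop := ∀ α, dProj x (Y α) = x.2 α

/-- The Legendre transformation: the fibre derivative of `L`, `FL(q; v)(w) = d/dt L(q; v + t w)` at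
`t = 0`. -/
def legendre (x : KTangent E k Q) : KCotangent E k Q :=
  ⟨x.1, (dAt (kModel E k) L x).comp (vertLift x)⟩

/-- Almost-regularity: the image of the Legendre transformation `FL` is a closed submanifold, `FL`
is a submersion onto its image, and its fibres are connected submanifolds. -/
structure IsAlmostRegular : Prop where
  image_closed : IsClosedSubmanifold (kCoModel E k) (range (legendre L))
  submersion : ∀ (x : KTangent E k Q) (u : TangentSpace (kCoModel E k) (legendre L x)),
    IsTangentTo (kCoModel E k) (range (legendre L)) (legendre L x) u →
      ∃ w : TK x, mfderiv (kModel E k) (kCoModel E k) (legendre L) x w = u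
  fibre_connected : ∀ p ∈ range (legendre L), IsConnected (legendre L ⁻¹' {p})
  fibre_submanifold : ∀ p ∈ range (legendre L),
    IsEmbeddedSubmanifold (kModel E k) (legendre L ⁻¹' {p})

/-- The annihilator `𝔖^⊥` of a set of `k`-vector fields: the smooth vector fields `Z` with
`Ω(Y)(Z) = 0` for all `Y ∈ 𝔖`. -/
def annih (𝔖 : Set (KVF E k Q)) : Set (VF E k Q) :=
  {Z | IsSmoothVF (kModel E k) Z ∧ ∀ Y ∈ 𝔖, ∀ x, Om L x (fun α => Y α x) (Z x) = 0}

variable (E k Q) in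
/-- The vertical `k`-vector fields. -/
def verticalKVF : Set (KVF E k Q) := {V | IsSmoothKVF V ∧ ∀ α x, V α x ∈ vert x}

/-- `[𝔛ᵏ(T¹ₖQ)]^⊥`. -/
def XPerp : Set (VF E k Q) := annih L {Y | IsSmoothKVF Y}

/-- `𝔐 = [𝔛ᵏⱽ(T¹ₖQ)]^⊥`. -/
def MPerp : Set (VF E k Q) := annih L (verticalKVF E k Q)

/-- The vertical `k`-vector fields in the kernel of `Ω`. -/
def kerVertOm : Set (KVF E k Q) :=
  {V | V ∈ verticalKVF E k Q ∧ ∀ x, Om L x (fun α => V α x) = 0}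

/-- The characteristic subspace `⋂ α, Ker ω^α` at `x`. -/
def kerAll (x : KTangent E k Q) : Submodule ℝ (TK x) := ⨅ α, LinearMap.ker (cartanTwo L α x)

/-- The subspace at `x` corresponding to `𝔐`: the vectors that are `ω^α`-orthogonal to all vertical
vectors, for every `α`. -/
def MAt (x : KTangent E k Q) : Submodule ℝ (TK x) :=
  ⨅ α, ⨅ u ∈ vert x, LinearMap.ker (cartanTwo L α x u)

/-- `P₁`: the points at which the Lagrangian equation has a solution. -/
def P1 : Set (KTangent E k Q) := {x | ∃ Y : Fin k → TK x, IsLagrangianAt L x Y}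

/-- `S₁`: the points of `P₁` at which the solution `X` can be corrected by an element of `Ker Ω` to
satisfy the second-order condition. -/
def S1 (X : KVF E k Q) : Set (KTangent E k Q) :=
  {x | x ∈ P1 L ∧ ∃ Y : Fin k → TK x, Om L x Y = 0 ∧
    ∑ α, vertEndo α x (X α x + Y α) = liouville x}

/-- The dynamical constraint functions `ζ^(Z) = i(Z) d(energy)`. -/
def zeta (Z : VF E k Q) (x : KTangent E k Q) : ℝ := dAt (kModel E k) (energy L) x (Z x)

/-- The SOPDE (non-dynamical) constraint functions `η^(Z) = i(Z) Ω(Γ₀ - X)`. -/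
def eta (Γ₀ X : KVF E k Q) (Z : VF E k Q) (x : KTangent E k Q) : ℝ :=
  Om L x (fun α => Γ₀ α x - X α x) (Z x)

/-- A complete and independent system of labels for the SOPDE constraints. Completeness: along
`S₁`, the fields in `𝔐` are obtained from the span of `𝒵` by adding vertical fields and elements of
`[𝔛ᵏ]^⊥` (whose functions `η` vanish on `P₁`). Independence (from the dynamical constraints, which
define `P₁`): a combination of the `η` whose differential at a point of `S₁` vanishes on the tangent
space of `P₁` has zero differential there. -/
structure IsConstraintSystem (Γ₀ X : KVF E k Q) (𝒵 : Set (VF E k Q)) : Prop where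
  subset : 𝒵 ⊆ MPerp L \ XPerp L
  complete : ∀ x ∈ S1 L X, ∀ Z ∈ MPerp L, ∃ Z' ∈ Submodule.span ℝ 𝒵, ∃ u ∈ vert x,
    ∃ Z₀ ∈ XPerp L, Z x = Z' x + u + Z₀ x
  independent : ∀ x ∈ S1 L X, ∀ Z ∈ Submodule.span ℝ 𝒵,
    (∀ u : TK x, IsTangentTo (kModel E k) (P1 L) x u →
      dAt (kModel E k) (eta L Γ₀ X Z) x u = 0) → dAt (kModel E k) (eta L Γ₀ X Z) x = 0

end Lagrangian

end

/-! Write N for the common kernel of the forms ω^α (`kerAll`), K for its vertical part `vert ⊓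
kerAll`, B for `vert ⊔ kerAll`, and M for `MAt`; then B ⊆ M. In a bundle chart ω^α(u, w) = D²l(w,
J^α u) − D²l(u, J^α w), so K is the kernel of the tangent map of the Legendre transformation.
Almost-regularity therefore gives K locally constant rank, and B inherits this from K and N.
Constant rank yields smooth projections onto K, N, B and M, so vectors in them extend to global
sections and conditions on fields can be tested pointwise. Two facts about K carry the proof.

K is tangent to P₁ (`isTangentTo_P1`). By duality, P₁ is the zero set of the restriction of dℰ to N.
A local section of K annihilates ℰ, and its bracket with a section of N stays in N. Hence along its
integral curves dℰ restricted to N satisfies a linear homogeneous differential equation; if it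
vanishes at the start, it vanishes throughout.

The differentials of the SOPDE constraints pair K with M/B without degeneracy on the side of M/B
(`exists_dAt_eta`, `exists_pairing`). At a point x with a second-order solution of the Lagrangian
equation, Γ₀ may be replaced by a second-order field with that solution as its value at x: the
change is vertical, and fields in 𝔐 do not see it. Then Ω(Γ₀ − X) vanishes at x, so dη^(Z)(u) is a
bilinear expression b(u, Z_x). For v in K, tangency to P₁ removes the contribution of X, and b(v, z)
becomes the derivative of the Euler-Lagrange form of a second-order field, which is ∑ ω^α((v_α, 0),
z). If this vanishes for all v in K, the symmetry of the fibre Hessian gives z ∈ B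
(`exists_vert_add_kerL`). Conversely, labels in B give functions that vanish on P₁, so b(u, ·) kills
B when u is tangent to P₁.

Every functional on M that kills B is thus represented by a vector of K. For a complete independent
system one solves a linear system whose matrix is invertible near a given point of S₁; independence
carries the solution from a finite basis to the whole system, and a partition of unity makes it
global. Adding such fields does not disturb the dynamical constraints, because they are tangent to
P₁. With all SOPDE constraints at once, tangency of Γ + V to P₁ makes b(Γ_α + V_α, ·) kill B, so it
can be cancelled at the given point by a vector of K. -/

open Bundle Set Filter
open scoped Manifold Topology ContDiff

noncomputable section

/-! ### Smooth local projections onto distributions of constant rank -/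

section Projections

variable {V : Type*} [NormedAddCommGroup V] [NormedSpace ℝ V]
  {F : Type*} [NormedAddCommGroup F] [NormedSpace ℝ F]

/-- Near `p₀` there is a smooth family of linear projections onto the subspaces `D p`. -/
def HasLocProj (D : V → Submodule ℝ V) (p₀ : V) : Prop :=
  ∃ U : Set V, IsOpen U ∧ p₀ ∈ U ∧ ∃ P : V → V →L[ℝ] V, ContDiffOn ℝ ∞ P U ∧
    (∀ p ∈ U, ∀ h, P p h ∈ D p) ∧ ∀ p ∈ U, ∀ h ∈ D p, P p h = h

theorem hasLocProj_const (S : Submodule ℝ V) (P : V →L[ℝ] V) (h1 : ∀ h, P h ∈ S)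
    (h2 : ∀ h ∈ S, P h = h) (p₀ : V) : HasLocProj (fun _ => S) p₀ :=
  ⟨univ, isOpen_univ, mem_univ _, fun _ => P, contDiffOn_const, fun _ _ => h1, fun _ _ => h2⟩

/-- A right inverse of V → range A, extended linearly to F. It supplies projections onto kernels (1
− BA) and linear choices of preimages. -/
theorem exists_generalized_inverse (A : V →L[ℝ] F) :
    ∃ B : F →ₗ[ℝ] V, ∀ h, A (B (A h)) = A h := by
  obtain ⟨g, hg⟩ := (A.toLinearMap.rangeRestrict).exists_rightInverse_of_surjective
    (LinearMap.range_rangeRestrict _)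
  obtain ⟨B, hB⟩ := g.exists_extend
  refine ⟨B, fun h => ?_⟩
  have h1 := LinearMap.congr_fun hB (A.toLinearMap.rangeRestrict h)
  have h2 := congrArg Subtype.val (LinearMap.congr_fun hg (A.toLinearMap.rangeRestrict h))
  simp only [LinearMap.comp_apply, Submodule.subtype_apply, LinearMap.id_apply] at h1 h2
  change B (A h) = _ at h1
  rw [h1]
  exact h2

theorem exists_isOpen_isUnit [FiniteDimensional ℝ V] {U : Set V} (hU : IsOpen U) {p₀ : V} (hp₀ : p₀ ∈ U)
    {Φ : V → V →L[ℝ] V} (hΦ : ContDiffOn ℝ ∞ Φ U) (h0 : IsUnit (Φ p₀)) :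
    ∃ U' ⊆ U, IsOpen U' ∧ p₀ ∈ U' ∧ (∀ p ∈ U', IsUnit (Φ p)) ∧
      ContDiffOn ℝ ∞ (fun p => Ring.inverse (Φ p)) U' := by
  refine ⟨U ∩ Φ ⁻¹' {a | IsUnit a}, inter_subset_left,
    hΦ.continuousOn.isOpen_inter_preimage hU Units.isOpen, ⟨hp₀, h0⟩, fun p hp => hp.2, ?_⟩
  rintro p ⟨hp, u, hu⟩
  have := (contDiffAt_ringInverse ℝ (n := ∞) u)
  rw [hu] at this
  exact (this.comp_contDiffWithinAt p (hΦ p hp)).mono inter_subset_left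

/-- A family of subspaces of locally constant rank which a smooth family of automorphisms, starting
at the identity, maps into a fixed subspace. -/
theorem hasLocProj_of_map_le [FiniteDimensional ℝ V] {D : V → Submodule ℝ V} {p₀ : V} {U : Set V} (hU : IsOpen U)
    (hp₀ : p₀ ∈ U) {Ψ : V → V →L[ℝ] V} (hΨ : ContDiffOn ℝ ∞ Ψ U) (hΨ0 : Ψ p₀ = 1)
    (ρ : V →L[ℝ] V) (hr : ∀ h, ρ h ∈ D p₀) (hr' : ∀ h ∈ D p₀, ρ h = h)
    (hmap : ∀ p ∈ U, ∀ h ∈ D p, Ψ p h ∈ D p₀)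
    (hrank : ∀ p ∈ U, Module.finrank ℝ (D p) = Module.finrank ℝ (D p₀)) : HasLocProj D p₀ := by
  obtain ⟨U', hU'U, hU', hp', hu, hinv⟩ := exists_isOpen_isUnit hU hp₀ hΨ (by simp [hΨ0])
  -- Conjugating the projection ρ by Ψ p gives a projection onto the preimage of D p₀ under Ψ p.
  -- This preimage is D p, since equal ranks turn Ψ p (D p) ⊆ D p₀ into an equality.
  refine ⟨U', hU', hp', fun p => Ring.inverse (Ψ p) * ρ * Ψ p, ?_, ?_, ?_⟩
  · exact (hinv.mul contDiffOn_const).mul (hΨ.mono hU'U)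
  · intro p hp h
    have hl : Function.LeftInverse ⇑(Ring.inverse (Ψ p)) ⇑(Ψ p) := fun z => by
      change (Ring.inverse (Ψ p) * Ψ p) z = z
      rw [Ring.inverse_mul_cancel _ (hu p hp)]; rfl
    have heq : (D p).map (Ψ p).toLinearMap = D p₀ := by
      apply Submodule.eq_of_le_of_finrank_eq
      · rintro _ ⟨z, hz, rfl⟩; exact hmap p (hU'U hp) z hz
      · rw [← (Submodule.equivMapOfInjective _ hl.injective _).finrank_eq]
        exact hrank p (hU'U hp)
    have h1 : ρ (Ψ p h) ∈ (D p).map (Ψ p).toLinearMap := heq ▸ hr _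
    obtain ⟨z, hz, hz'⟩ := h1
    change Ring.inverse (Ψ p) (ρ (Ψ p h)) ∈ D p
    rw [← hz']
    change Ring.inverse (Ψ p) (Ψ p z) ∈ D p
    rwa [hl]
  · intro p hp h hh
    change Ring.inverse (Ψ p) (ρ (Ψ p h)) = h
    rw [hr' _ (hmap p (hU'U hp) h hh)]
    change (Ring.inverse (Ψ p) * Ψ p) h = h
    rw [Ring.inverse_mul_cancel _ (hu p hp)]; rfl

/-- The kernels of a smooth family of linear maps of locally constant rank. -/
theorem hasLocProj_ker [FiniteDimensional ℝ V] [FiniteDimensional ℝ F]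
    {A : V → V →L[ℝ] F} {U : Set V} (hU : IsOpen U) {p₀ : V} (hp₀ : p₀ ∈ U)
    (hA : ContDiffOn ℝ ∞ A U)
    (hrank : ∀ᶠ p in 𝓝 p₀, Module.finrank ℝ (LinearMap.ker (A p).toLinearMap) =
      Module.finrank ℝ (LinearMap.ker (A p₀).toLinearMap)) :
    HasLocProj (fun p => LinearMap.ker (A p).toLinearMap) p₀ := by
  obtain ⟨B, hB⟩ := exists_generalized_inverse (A p₀)
  let B' : F →L[ℝ] V := LinearMap.toContinuousLinearMap B
  -- Since A p₀ B A p₀ = A p₀, this projects onto ker A p₀. The family ρ + B A p is the identity at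
  -- p₀ and agrees with ρ on ker A p, hence maps it into ker A p₀.
  let ρ : V →L[ℝ] V := 1 - B'.comp (A p₀)
  obtain ⟨U', hU', hU'o, hp'⟩ := mem_nhds_iff.1 hrank
  refine hasLocProj_of_map_le (hU.inter hU'o) ⟨hp₀, hp'⟩ (Ψ := fun p => ρ + B'.comp (A p)) ?_ ?_
    ρ ?_ ?_ ?_ (fun p hp => hU' hp.2)
  · exact contDiffOn_const.add
      ((contDiffOn_const (c := B')).clm_comp (hA.mono inter_subset_left))
  · simp [ρ]
  · intro h
    simp only [LinearMap.mem_ker]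
    change A p₀ (h - B (A p₀ h)) = 0
    rw [map_sub, hB, sub_self]
  · intro h hh
    have : A p₀ h = 0 := hh
    change h - B (A p₀ h) = h
    simp [this]
  · intro p hp h hh
    have h1 : A p h = 0 := hh
    change A p₀ (h - B (A p₀ h) + B (A p h)) = 0
    simp [h1, hB]

/-- The sum of two such families, if it has locally constant rank. -/
theorem HasLocProj.sup [FiniteDimensional ℝ V] {D₁ D₂ : V → Submodule ℝ V} {p₀ : V} (h₁ : HasLocProj D₁ p₀)
    (h₂ : HasLocProj D₂ p₀)
    (hrank : ∀ᶠ p in 𝓝 p₀, Module.finrank ℝ (D₁ p ⊔ D₂ p : Submodule ℝ V) =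
      Module.finrank ℝ (D₁ p₀ ⊔ D₂ p₀ : Submodule ℝ V)) :
    HasLocProj (fun p => D₁ p ⊔ D₂ p) p₀ := by
  obtain ⟨U₁, hU₁, hp₁, P₁, hP₁, hP₁D, hP₁i⟩ := h₁
  obtain ⟨U₂, hU₂, hp₂, P₂, hP₂, hP₂D, hP₂i⟩ := h₂
  obtain ⟨U', hU', hU'o, hp'⟩ := mem_nhds_iff.1 hrank
  set S : Submodule ℝ V := D₁ p₀ ⊔ D₂ p₀ with hS
  -- The sum need not be direct, so a linear choice of decompositions h = a h + b h on S is fixed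
  -- once and for all.
  obtain ⟨g, hg⟩ : ∃ g : V →ₗ[ℝ] (D₁ p₀ × D₂ p₀), ∀ h ∈ S, ((g h).1 : V) + ((g h).2 : V) = h := by
    let c : (D₁ p₀ × D₂ p₀) →ₗ[ℝ] V := (D₁ p₀).subtype.coprod (D₂ p₀).subtype
    obtain ⟨B, hB⟩ := exists_generalized_inverse (LinearMap.toContinuousLinearMap c)
    refine ⟨B, fun h hh => ?_⟩
    obtain ⟨y, hy, z, hz, rfl⟩ := Submodule.mem_sup.1 hh
    exact hB (⟨y, hy⟩, ⟨z, hz⟩)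
  let a : V →L[ℝ] V := LinearMap.toContinuousLinearMap
    ((D₁ p₀).subtype ∘ₗ LinearMap.fst ℝ _ _ ∘ₗ g)
  let b : V →L[ℝ] V := LinearMap.toContinuousLinearMap
    ((D₂ p₀).subtype ∘ₗ LinearMap.snd ℝ _ _ ∘ₗ g)
  have ha : ∀ h, a h ∈ D₁ p₀ := fun h => (g h).1.2
  have hb : ∀ h, b h ∈ D₂ p₀ := fun h => (g h).2.2
  have hab : ∀ h ∈ S, a h + b h = h := hg
  have habS : ∀ h, a h + b h ∈ S := fun h =>
    S.add_mem (le_sup_left (a := D₁ p₀) (ha h)) (le_sup_right (b := D₂ p₀) (hb h))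
  -- Each summand of h ∈ S is pushed into the nearby subspace. Thus Φ p carries S into D₁ p ⊔ D₂ p,
  -- onto it by the rank hypothesis, and its inverse is the straightening family.
  let Φ : V → V →L[ℝ] V := fun p => (P₁ p).comp a + (P₂ p).comp b + (1 - (a + b))
  have hΦ : ContDiffOn ℝ ∞ Φ (U₁ ∩ U₂) :=
    (((hP₁.mono inter_subset_left).clm_comp contDiffOn_const).add
      ((hP₂.mono inter_subset_right).clm_comp contDiffOn_const)).add contDiffOn_const
  have hΦ0 : Φ p₀ = 1 := by
    ext h
    change P₁ p₀ (a h) + P₂ p₀ (b h) + (h - (a h + b h)) = h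
    rw [hP₁i p₀ hp₁ _ (ha h), hP₂i p₀ hp₂ _ (hb h)]
    abel
  have hΦD : ∀ p ∈ U₁ ∩ U₂, ∀ h ∈ S, Φ p h ∈ D₁ p ⊔ D₂ p := by
    intro p hp h hh
    change P₁ p (a h) + P₂ p (b h) + (h - (a h + b h)) ∈ _
    rw [hab h hh, sub_self, add_zero]
    exact Submodule.add_mem_sup (hP₁D p hp.1 _) (hP₂D p hp.2 _)
  obtain ⟨W, hWU, hW, hpW, hu, hinv⟩ := exists_isOpen_isUnit (hU₁.inter hU₂) ⟨hp₁, hp₂⟩ hΦ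
    (by simp [hΦ0])
  refine hasLocProj_of_map_le (hW.inter hU'o) ⟨hpW, hp'⟩ (Ψ := fun p => Ring.inverse (Φ p))
    (hinv.mono inter_subset_left) (by simp [hΦ0]) (a + b) habS hab ?_ (fun p hp => hU' hp.2)
  intro p hp h hh
  have hl : Function.LeftInverse ⇑(Ring.inverse (Φ p)) ⇑(Φ p) := fun z => by
    change (Ring.inverse (Φ p) * Φ p) z = z
    rw [Ring.inverse_mul_cancel _ (hu p hp.1)]; rfl
  have heq : S.map (Φ p).toLinearMap = D₁ p ⊔ D₂ p := by
    apply Submodule.eq_of_le_of_finrank_eq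
    · rintro _ ⟨z, hz, rfl⟩; exact hΦD p (hWU hp.1) z hz
    · rw [← (Submodule.equivMapOfInjective _ hl.injective _).finrank_eq]
      exact (hU' hp.2).symm
  rw [← heq] at hh
  obtain ⟨z, hz, rfl⟩ := hh
  change Ring.inverse (Φ p) (Φ p z) ∈ S
  rwa [hl]

end Projections

/-! ### Integral curves and propagation of zeros along them -/

section Flow

variable {V : Type*} [NormedAddCommGroup V] [NormedSpace ℝ V]

theorem exists_contDiffAt_integralCurve [CompleteSpace V] {U : Set V} (hU : IsOpen U) {p₀ : V}
    (hp₀ : p₀ ∈ U) {X : V → V} (hX : ContDiffOn ℝ ∞ X U) :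
    ∃ c : ℝ → V, c 0 = p₀ ∧ ContDiffAt ℝ ∞ c 0 ∧
      ∀ᶠ t in 𝓝 (0 : ℝ), c t ∈ U ∧ HasDerivAt c (X (c t)) t := by
  have h1 : ContDiffAt ℝ 1 X p₀ :=
    ((hX.contDiffAt (hU.mem_nhds hp₀)).of_le (by exact_mod_cast le_top))
  obtain ⟨c, hc0, ε, hε, hc⟩ :=
    ContDiffAt.exists_forall_mem_closedBall_exists_eq_forall_mem_Ioo_hasDerivAt₀ h1 0
  have hev : ∀ᶠ t in 𝓝 (0 : ℝ), HasDerivAt c (X (c t)) t := by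
    filter_upwards [Ioo_mem_nhds (show 0 - ε < 0 by linarith) (show 0 < 0 + ε by linarith)]
      with t ht using hc t ht
  have hcU : ∀ᶠ t in 𝓝 (0 : ℝ), c t ∈ U :=
    hev.self_of_nhds.continuousAt.eventually (by rw [hc0]; exact hU.mem_nhds hp₀)
  have hboth := hcU.and hev
  refine ⟨c, hc0, ?_, hboth⟩
  obtain ⟨δ, hδ, hδs⟩ := Metric.eventually_nhds_iff.1 hboth
  have hI : ∀ t ∈ Icc (-(δ / 2)) (δ / 2), c t ∈ U ∧ HasDerivAt c (X (c t)) t := fun t ht =>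
    hδs (by rw [Real.dist_eq, sub_zero, abs_lt]; constructor <;> linarith [ht.1, ht.2])
  -- The existence theorem yields only a differentiable curve; smoothness is bootstrapped from the
  -- equation on a compact interval where the curve stays in U.
  have := ODE.contDiffOn_enat_Icc_of_hasDerivWithinAt (n := ⊤) (f := fun _ => X) (u := U)
    (tmin := -(δ / 2)) (tmax := δ / 2) (α := c)
    (hX.comp contDiff_snd.contDiffOn fun z hz => hz.2)
    (fun t ht => (hI t ht).2.hasDerivWithinAt) (fun t ht => (hI t ht).1)
  exact this.contDiffAt (Icc_mem_nhds (by linarith) (by linarith))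

theorem symm_fderiv_fderiv {W : Type*} [NormedAddCommGroup W] [NormedSpace ℝ W] {f : V → W} {p : V}
    (hf : ContDiffAt ℝ ∞ f p) (a b : V) :
    fderiv ℝ (fderiv ℝ f) p a b = fderiv ℝ (fderiv ℝ f) p b a :=
  (hf.isSymmSndFDerivAt (by simpa using (ENat.LEInfty.out : (2 : WithTop ℕ∞) ≤ ∞))) a b

theorem ContDiffOn.fderiv_infty {W : Type*} [NormedAddCommGroup W] [NormedSpace ℝ W] {f : V → W}
    {U : Set V} (hU : IsOpen U) (hf : ContDiffOn ℝ ∞ f U) : ContDiffOn ℝ ∞ (fderiv ℝ f) U :=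
  ((contDiffOn_infty_iff_fderiv_of_isOpen hU).1 hf).2

theorem ContDiffOn.hasFDerivAt_infty {W : Type*} [NormedAddCommGroup W] [NormedSpace ℝ W]
    {f : V → W} {U : Set V} (hU : IsOpen U) (hf : ContDiffOn ℝ ∞ f U) {p : V} (hp : p ∈ U) :
    HasFDerivAt f (fderiv ℝ f p) p :=
  ((hf.contDiffAt (hU.mem_nhds hp)).differentiableAt (by simp)).hasFDerivAt

/-- If `X` is a vector field annihilated by `de` whose bracket preserves the distribution `D`, then
the zeros of the restriction of `de` to `D` are preserved along the integral curves of `X`. -/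
theorem exists_curve_of_bracket [FiniteDimensional ℝ V] {U : Set V} (hU : IsOpen U) {p₀ : V}
    (hp₀ : p₀ ∈ U) {e : V → ℝ} (he : ContDiffOn ℝ ∞ e U) {X : V → V} (hX : ContDiffOn ℝ ∞ X U)
    {D : V → Submodule ℝ V} {P : V → V →L[ℝ] V} (hP : ContDiffOn ℝ ∞ P U)
    (hPD : ∀ p ∈ U, ∀ h ∈ D p, P p h = h)
    (heX : ∀ p ∈ U, fderiv ℝ e p (X p) = 0)
    (hbr : ∀ p ∈ U, ∀ h, fderiv ℝ P p (X p) h - fderiv ℝ X p (P p h) ∈ D p)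
    (h0 : ∀ h, fderiv ℝ e p₀ (P p₀ h) = 0) :
    ∃ c : ℝ → V, c 0 = p₀ ∧ ContDiffAt ℝ ∞ c 0 ∧ HasDerivAt c (X p₀) 0 ∧
      ∀ᶠ t in 𝓝 (0 : ℝ), c t ∈ U ∧ ∀ h ∈ D (c t), fderiv ℝ e (c t) h = 0 := by
  have : CompleteSpace V := FiniteDimensional.complete ℝ V
  obtain ⟨c, hc0, hcs, hc⟩ := exists_contDiffAt_integralCurve hU hp₀ hX
  have hde := he.fderiv_infty hU
  -- Along the curve, de composed with P solves the linear equation f' = f ∘ B, where B expresses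
  -- the bracket of X with the sections P h. As f 0 = 0, uniqueness forces f = 0.
  let f : ℝ → V →L[ℝ] ℝ := fun t => (fderiv ℝ e (c t)).comp (P (c t))
  let B : V → V →L[ℝ] V := fun p => fderiv ℝ P p (X p) - (fderiv ℝ X p).comp (P p)
  have hBc : ContinuousOn B U := by
    refine ContinuousOn.sub ?_ ?_
    · exact (hP.fderiv_infty hU).continuousOn.clm_apply hX.continuousOn
    · exact (hX.fderiv_infty hU).continuousOn.clm_comp hP.continuousOn
  have hf : ∀ᶠ t in 𝓝 (0 : ℝ), HasDerivAt f ((f t).comp (B (c t))) t := by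
    filter_upwards [hc] with t ⟨htU, ht⟩
    have h1 : HasDerivAt (fun s => fderiv ℝ e (c s)) (fderiv ℝ (fderiv ℝ e) (c t) (X (c t))) t :=
      (hde.hasFDerivAt_infty hU htU).comp_hasDerivAt t ht
    have h2 : HasDerivAt (fun s => P (c s)) (fderiv ℝ P (c t) (X (c t))) t :=
      (hP.hasFDerivAt_infty hU htU).comp_hasDerivAt t ht
    have h3 := h1.clm_comp h2
    convert h3 using 1
    ext h
    -- Differentiating de(X) = 0 trades the second derivative of e in f' for −de(DX ·).
    have h4 : HasFDerivAt (fun p => fderiv ℝ e p (X p)) (0 : V →L[ℝ] ℝ) (c t) := by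
      refine (hasFDerivAt_const (0 : ℝ) (c t)).congr_of_eventuallyEq ?_
      filter_upwards [hU.mem_nhds htU] with p hp using heX p hp
    have h5 := (hde.hasFDerivAt_infty hU htU).clm_apply (hX.hasFDerivAt_infty hU htU)
    have h6 := DFunLike.congr_fun (h4.unique h5) (P (c t) h)
    have h7 := symm_fderiv_fderiv (he.contDiffAt (hU.mem_nhds htU)) (X (c t)) (P (c t) h)
    -- Here the bracket hypothesis enters: B h lies in D, so P fixes it and de(B h) = f(B h), which
    -- closes the equation.
    have h8 := hPD _ htU _ (hbr _ htU h)
    simp only [zero_apply, add_apply, ContinuousLinearMap.comp_apply,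
      ContinuousLinearMap.flip_apply] at h6 ⊢
    change fderiv ℝ e (c t) (P (c t) (fderiv ℝ P (c t) (X (c t)) h - fderiv ℝ X (c t) (P (c t) h)))
      = _
    rw [h8, map_sub, h7]
    linarith
  have hcc : ContinuousAt c 0 := hcs.continuousAt
  -- A local bound on B is the Lipschitz constant needed for uniqueness.
  obtain ⟨C, hC⟩ : ∃ C : NNReal, ∀ᶠ t in 𝓝 (0 : ℝ), ‖B (c t)‖₊ ≤ C := by
    refine ⟨‖B p₀‖₊ + 1, ?_⟩
    have h9 : ContinuousAt (fun t => ‖B (c t)‖₊) 0 := by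
      have : ContinuousAt B (c 0) := by
        rw [hc0]; exact hBc.continuousAt (hU.mem_nhds hp₀)
      exact (this.comp hcc).nnnorm
    have h10 : ‖B (c 0)‖₊ < ‖B p₀‖₊ + 1 := by rw [hc0]; exact lt_add_one _
    exact (h9.eventually (gt_mem_nhds h10)).mono fun t ht => le_of_lt ht
  have huniq : f =ᶠ[𝓝 0] fun _ => 0 := by
    refine ODE_solution_unique_of_eventually (K := C) (s := fun _ => univ)
      (v := fun t g => g.comp (B (c t))) ?_ ?_ ?_ ?_
    · filter_upwards [hC] with t ht
      refine LipschitzOnWith.of_dist_le_mul fun g _ g' _ => ?_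
      rw [dist_eq_norm, dist_eq_norm, ← ContinuousLinearMap.sub_comp, mul_comm]
      refine ((g - g').opNorm_comp_le (B (c t))).trans ?_
      gcongr
      exact_mod_cast ht
    · exact hf.mono fun t ht => ⟨ht, mem_univ _⟩
    · refine Eventually.of_forall fun t => ⟨?_, mem_univ _⟩
      simpa using hasDerivAt_const t (0 : V →L[ℝ] ℝ)
    · ext h
      change fderiv ℝ e (c 0) (P (c 0) h) = 0
      rw [hc0]; exact h0 h
  refine ⟨c, hc0, hcs, by simpa [hc0] using hc.self_of_nhds.2, ?_⟩
  filter_upwards [hc, huniq] with t ht hft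
  refine ⟨ht.1, fun h hh => ?_⟩
  have := DFunLike.congr_fun hft h
  change fderiv ℝ e (c t) (P (c t) h) = 0 at this
  rwa [hPD _ ht.1 h hh] at this

end Flow

/-! ### Linear algebra of the Cartan forms in coordinates -/

section LocalLagrangian

variable {E : Type*} [NormedAddCommGroup E] [NormedSpace ℝ E] {k : ℕ}

variable (E k) in
/-- The model space of `T¹ₖQ`. -/
abbrev KVec : Type _ := E × (Fin k → E)

/-- The inclusion of the vertical subspace in the model. -/
abbrev vin : (Fin k → E) →L[ℝ] KVec E k := ContinuousLinearMap.inr ℝ E (Fin k → E)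

/-- The vertical endomorphisms in the model. -/
def jv (α : Fin k) : KVec E k →L[ℝ] KVec E k :=
  (vin.comp (ContinuousLinearMap.single ℝ (fun _ : Fin k => E) α)).comp
    (ContinuousLinearMap.fst ℝ E (Fin k → E))

theorem jv_apply (α : Fin k) (h : KVec E k) : jv α h = (0, Pi.single α h.1) := rfl

theorem jv_of_fst_eq_zero (α : Fin k) {h : KVec E k} (hh : h.1 = 0) : jv α h = 0 := by
  rw [jv_apply, hh, Pi.single_zero]; rfl

theorem vin_eq_sum (m : Fin k → E) : (vin m : KVec E k) = ∑ α, jv α ((m α, 0) : KVec E k) := by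
  simp only [jv_apply]
  ext1
  · simp [Prod.fst_sum]
  · simp [Prod.snd_sum, Finset.univ_sum_single]

theorem eq_vin_of_fst_eq_zero {h : KVec E k} (hh : h.1 = 0) : h = vin h.2 :=
  Prod.ext hh rfl

variable (l : KVec E k → ℝ)

/-- The second derivative. -/
abbrev D2 (p : KVec E k) : KVec E k →L[ℝ] KVec E k →L[ℝ] ℝ := fderiv ℝ (fderiv ℝ l) p

/-- The coordinate expression of the Cartan 2-forms. -/
def omL (α : Fin k) (p : KVec E k) : KVec E k →L[ℝ] KVec E k →L[ℝ] ℝ :=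
  (D2 l p).flip.comp (jv α) -
    ((ContinuousLinearMap.compL ℝ (KVec E k) (KVec E k) ℝ).flip (jv α)).comp (D2 l p)

theorem omL_apply (α : Fin k) (p u w : KVec E k) :
    omL l α p u w = D2 l p w (jv α u) - D2 l p u (jv α w) := rfl

/-- The coordinate expression of the energy. -/
def enL (p : KVec E k) : ℝ := fderiv ℝ l p (vin p.2) - l p

/-- The model of the map whose kernel is the tangent space to the fibres of the Legendre map. -/
def fibreHess (p : KVec E k) : KVec E k →L[ℝ] E × ((Fin k → E) →L[ℝ] ℝ) :=
  (ContinuousLinearMap.fst ℝ E (Fin k → E)).prod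
    (((ContinuousLinearMap.compL ℝ (Fin k → E) (KVec E k) ℝ).flip vin).comp (D2 l p))

/-- The vertical vectors in the kernel of the fibre Hessian. -/
def KL (p : KVec E k) : Submodule ℝ (KVec E k) := LinearMap.ker (fibreHess l p).toLinearMap

theorem mem_KL {p a : KVec E k} : a ∈ KL l p ↔ a.1 = 0 ∧ ∀ m, D2 l p a (vin m) = 0 := by
  rw [KL, LinearMap.mem_ker]
  refine Prod.ext_iff.trans (and_congr Iff.rfl ⟨fun h m => DFunLike.congr_fun h m, fun h => ?_⟩)
  ext1 m
  exact h m

/-- All contractions of a vector with the forms `omL`. -/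
def contractions (p : KVec E k) : KVec E k →L[ℝ] Fin k → (KVec E k →L[ℝ] ℝ) :=
  ContinuousLinearMap.pi fun α => (omL l α p).flip

/-- The common kernel of the forms `omL`. -/
def kerL (p : KVec E k) : Submodule ℝ (KVec E k) := LinearMap.ker (contractions l p).toLinearMap

theorem mem_kerL {p a : KVec E k} : a ∈ kerL l p ↔ ∀ α b, omL l α p b a = 0 := by
  rw [kerL, LinearMap.mem_ker]
  exact funext_iff.trans (forall_congr' fun α => ⟨fun h m => DFunLike.congr_fun h m,
    fun h => ContinuousLinearMap.ext h⟩)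

/-- All contractions of a vector with the forms `omL` on vertical vectors. -/
def vertContractions (p : KVec E k) : KVec E k →L[ℝ] Fin k → ((Fin k → E) →L[ℝ] ℝ) :=
  ContinuousLinearMap.pi fun α =>
    ((ContinuousLinearMap.compL ℝ (Fin k → E) (KVec E k) ℝ).flip vin).comp (omL l α p).flip

/-- The orthogonal of the vertical vectors with respect to the forms `omL`. -/
def ML (p : KVec E k) : Submodule ℝ (KVec E k) := LinearMap.ker (vertContractions l p).toLinearMap

theorem mem_ML {p a : KVec E k} : a ∈ ML l p ↔ ∀ α m, omL l α p (vin m) a = 0 := by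
  rw [ML, LinearMap.mem_ker]
  refine funext_iff.trans (forall_congr' fun α => ⟨fun h m => DFunLike.congr_fun h m, fun h => ?_⟩)
  ext1 m
  exact h m


section Algebra

variable {l} {p : KVec E k}

theorem kerL_le_ML {a : KVec E k} (ha : a ∈ kerL l p) : a ∈ ML l p :=
  (mem_ML l).2 fun α _ => (mem_kerL l).1 ha α _

/-- For vertical a the term with J^α a drops out, leaving ω^α(b, a) = D²l(a, J^α b), and the vectors
J^α b span the vertical space. -/
theorem mem_KL_iff {a : KVec E k} : a ∈ KL l p ↔ a.1 = 0 ∧ a ∈ kerL l p := by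
  rw [mem_KL]
  refine and_congr_right fun ha => ?_
  rw [mem_kerL]
  constructor
  · intro h α b
    rw [omL_apply, jv_of_fst_eq_zero α ha, map_zero, sub_zero]
    exact h (Pi.single α b.1)
  · intro h m
    rw [vin_eq_sum, map_sum]
    refine Finset.sum_eq_zero fun α _ => ?_
    have := h α (m α, 0)
    rwa [omL_apply, jv_of_fst_eq_zero α ha, map_zero, sub_zero] at this

/-- Each J^α kills vertical vectors, so the vertical space is isotropic for every ω^α. -/
theorem vert_le_ML {a : KVec E k} (ha : a.1 = 0) : a ∈ ML l p := by
  refine (mem_ML l).2 fun α m => ?_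
  rw [omL_apply, jv_of_fst_eq_zero α ha, jv_of_fst_eq_zero α (h := vin m) rfl]
  simp

variable (hsymm : ∀ a b, D2 l p a b = D2 l p b a)

include hsymm

/-- Against a vertical vector m only the term −D²l(m, J^α a) of ω^α(m, a) survives, so orthogonality
to the vertical space says that J^α a is in the kernel of the fibre Hessian. -/
theorem jv_mem_KL {a : KVec E k} (ha : a ∈ ML l p) (α : Fin k) : jv α a ∈ KL l p := by
  refine (mem_KL l).2 ⟨rfl, fun m => ?_⟩
  have := (mem_ML l).1 ha α m
  rw [omL_apply, jv_of_fst_eq_zero α (h := vin m) rfl, map_zero, zero_sub, neg_eq_zero] at this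
  rw [hsymm, this]

/-- A vector in the orthogonal of the vertical vectors which pairs to zero with the vertical vectors
in the kernel is the sum of a vertical vector and an element of the common kernel. -/
theorem exists_vert_add_kerL [FiniteDimensional ℝ E] {z : KVec E k} (hz : z ∈ ML l p)
    (h : ∀ v ∈ KL l p, ∑ α, omL l α p ((v.2 α, 0) : KVec E k) z = 0) :
    ∃ u ∈ kerL l p, (z - u).1 = 0 := by
  -- S is the fibre Hessian as a map to the dual. The sought vertical vector u must satisfy S u = F.
  let S : (Fin k → E) →ₗ[ℝ] Module.Dual ℝ (Fin k → E) := LinearMap.mk₂ ℝ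
    (fun m m' => D2 l p (vin m) (vin m')) (by intros; simp only [map_add, add_apply])
    (by intros; simp only [map_smul, smul_apply]) (by intros; simp only [map_add])
    (by intros; simp only [map_smul])
  let F : Module.Dual ℝ (Fin k → E) :=
    { toFun := fun m => ∑ α, omL l α p ((m α, 0) : KVec E k) z
      map_add' := fun m m' => by
        rw [← Finset.sum_add_distrib]
        refine Finset.sum_congr rfl fun α _ => ?_
        rw [← add_apply, ← map_add]
        simp
      map_smul' := fun r m => by
        rw [RingHom.id_apply, Finset.smul_sum]
        refine Finset.sum_congr rfl fun α _ => ?_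
        rw [← smul_apply, ← map_smul]
        simp }
  -- By symmetry the range of S is the annihilator of its kernel, and the kernel consists of the
  -- vertical parts of vectors of `KL`, where F vanishes by hypothesis.
  have hF : F ∈ LinearMap.range S := by
    have h1 : (LinearMap.range S).dualCoannihilator.dualAnnihilator = LinearMap.range S :=
      Subspace.dualCoannihilator_dualAnnihilator_eq
    rw [← h1, Submodule.mem_dualAnnihilator]
    intro m hm
    rw [Submodule.mem_dualCoannihilator] at hm
    refine h (vin m) ((mem_KL l).2 ⟨rfl, fun m' => ?_⟩)
    rw [hsymm]
    exact hm _ ⟨m', rfl⟩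
  obtain ⟨u, hu⟩ := hF
  have hu' : ∀ m, D2 l p (vin u) (vin m) = ∑ α, omL l α p ((m α, 0) : KVec E k) z :=
    fun m => LinearMap.congr_fun hu m
  refine ⟨z - vin u, (mem_kerL l).2 fun α w => ?_, by simp⟩
  -- Since z is orthogonal to vertical vectors, only the base component of w matters; it is
  -- recovered by evaluating F on a tuple supported at α.
  have h2 : omL l α p w z = omL l α p ((w.1, 0) : KVec E k) z := by
    have : w = ((w.1, 0) : KVec E k) + vin w.2 := by ext1 <;> simp
    conv_lhs => rw [this, map_add, add_apply, (mem_ML l).1 hz α w.2, add_zero]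
  have h3 : D2 l p (vin u) (jv α w) = omL l α p ((w.1, 0) : KVec E k) z := by
    refine (hu' (Pi.single α w.1)).trans ?_
    rw [Finset.sum_eq_single α]
    · simp
    · intro β _ hβ
      rw [Pi.single_eq_of_ne hβ]
      exact (DFunLike.congr_fun (map_zero (omL l β p)) z)
    · simp
  rw [map_sub, h2, omL_apply (w := vin u), jv_of_fst_eq_zero α (h := vin u) rfl, map_zero,
    sub_zero, h3, sub_self]

end Algebra

section Calculus

variable {l} {U : Set (KVec E k)} (hU : IsOpen U) (hl : ContDiffOn ℝ ∞ l U)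

include hU hl

theorem contDiffOn_D2 : ContDiffOn ℝ ∞ (D2 l) U := (hl.fderiv_infty hU).fderiv_infty hU

theorem symm_D2 {p : KVec E k} (hp : p ∈ U) (a b : KVec E k) : D2 l p a b = D2 l p b a :=
  symm_fderiv_fderiv (hl.contDiffAt (hU.mem_nhds hp)) a b

theorem contDiffOn_D2_apply (a b : KVec E k) : ContDiffOn ℝ ∞ (fun p => D2 l p a b) U :=
  ((contDiffOn_D2 hU hl).clm_apply contDiffOn_const).clm_apply contDiffOn_const

theorem contDiffOn_omL_apply (α : Fin k) (a b : KVec E k) :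
    ContDiffOn ℝ ∞ (fun p => omL l α p a b) U :=
  (contDiffOn_D2_apply hU hl _ _).sub (contDiffOn_D2_apply hU hl _ _)

theorem contDiffOn_enL : ContDiffOn ℝ ∞ (enL l) U :=
  ((hl.fderiv_infty hU).clm_apply ((vin (E := E) (k := k)).contDiff.comp contDiff_snd).contDiffOn).sub hl

variable [FiniteDimensional ℝ E]

theorem contDiffOn_omL (α : Fin k) : ContDiffOn ℝ ∞ (omL l α) U :=
  contDiffOn_clm_apply.2 fun a => contDiffOn_clm_apply.2 fun b =>
    contDiffOn_omL_apply hU hl α a b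

theorem contDiffOn_fibreHess : ContDiffOn ℝ ∞ (fibreHess l) U :=
  contDiffOn_clm_apply.2 fun a => contDiffOn_const.prodMk
    (contDiffOn_clm_apply.2 fun m => contDiffOn_D2_apply hU hl a (vin m))

theorem contDiffOn_contractions : ContDiffOn ℝ ∞ (contractions l) U :=
  contDiffOn_clm_apply.2 fun a => contDiffOn_pi.2 fun α =>
    contDiffOn_clm_apply.2 fun b => contDiffOn_omL_apply hU hl α b a

theorem contDiffOn_vertContractions : ContDiffOn ℝ ∞ (vertContractions l) U :=
  contDiffOn_clm_apply.2 fun a => contDiffOn_pi.2 fun α =>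
    contDiffOn_clm_apply.2 fun m => contDiffOn_omL_apply hU hl α (vin m) a

end Calculus

end LocalLagrangian

/-! ### Derivatives along the kernel of the fibre Hessian -/

section LocalDynamics

variable {E : Type*} [NormedAddCommGroup E] [NormedSpace ℝ E] {k : ℕ}
  {l : KVec E k → ℝ} {U : Set (KVec E k)} (hU : IsOpen U) (hl : ContDiffOn ℝ ∞ l U)

include hU hl

theorem hasFDerivAt_D2_apply {p : KVec E k} (hp : p ∈ U) {X : KVec E k → KVec E k}
    {X' : KVec E k →L[ℝ] KVec E k} (hX : HasFDerivAt X X' p) (b : KVec E k) :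
    HasFDerivAt (fun q => D2 l q (X q) b)
      (((fderiv ℝ (D2 l) p).flip (X p)).flip b + ((D2 l p).flip b).comp X') p := by
  have h1 := ((contDiffOn_D2 hU hl).hasFDerivAt_infty hU hp).clm_apply hX
  have h2 := h1.clm_apply (hasFDerivAt_const b p)
  refine h2.congr_fderiv (ContinuousLinearMap.ext fun v => ?_)
  simp [add_comm]

theorem fderiv_D2_symm {p : KVec E k} (hp : p ∈ U) (a b c : KVec E k) :
    fderiv ℝ (D2 l) p a b c = fderiv ℝ (D2 l) p b a c :=
  DFunLike.congr_fun (symm_fderiv_fderiv ((hl.fderiv_infty hU).contDiffAt (hU.mem_nhds hp)) a b) c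

/-- Extend v to a local section of `KL`. Its product with the constant vertical vector n under D²l
is identically zero, so its derivative along a vanishes. The derivative of the section is vertical,
hence D²l-orthogonal to n, and only the third-derivative term remains. -/
theorem fderiv_D2_eq_zero [FiniteDimensional ℝ E] {p : KVec E k} (hp : p ∈ U) (hK : HasLocProj (KL l) p) {v n : KVec E k}
    (hv : v ∈ KL l p) (hn : n ∈ KL l p) (a : KVec E k) : fderiv ℝ (D2 l) p a v n = 0 := by
  obtain ⟨W, hW, hpW, P, hP, hPK, hPi⟩ := hK
  have hX : HasFDerivAt (fun q => P q v) ((fderiv ℝ P p).flip v) p := by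
    simpa using (hP.hasFDerivAt_infty hW hpW).clm_apply (hasFDerivAt_const v p)
  have h1 := hasFDerivAt_D2_apply hU hl hp hX n
  have hn' := eq_vin_of_fst_eq_zero ((mem_KL l).1 hn).1
  have h2 : HasFDerivAt (fun q => D2 l q (P q v) n) (0 : KVec E k →L[ℝ] ℝ) p := by
    refine (hasFDerivAt_const (0 : ℝ) p).congr_of_eventuallyEq ?_
    filter_upwards [hW.mem_nhds hpW] with q hq
    rw [hn']
    exact ((mem_KL l).1 (hPK q hq v)).2 _
  have h3 : HasFDerivAt (fun q => (P q v).1)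
      ((ContinuousLinearMap.fst ℝ E (Fin k → E)).comp ((fderiv ℝ P p).flip v)) p :=
    (ContinuousLinearMap.fst ℝ E (Fin k → E)).hasFDerivAt.comp p hX
  have h4 : HasFDerivAt (fun q => (P q v).1) (0 : KVec E k →L[ℝ] E) p := by
    refine (hasFDerivAt_const (0 : E) p).congr_of_eventuallyEq ?_
    filter_upwards [hW.mem_nhds hpW] with q hq using ((mem_KL l).1 (hPK q hq v)).1
  have h5 : (fderiv ℝ P p a v).1 = 0 := DFunLike.congr_fun (h3.unique h4) a
  have h6 := DFunLike.congr_fun (h1.unique h2) a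
  change fderiv ℝ (D2 l) p a (P p v) n + D2 l p (fderiv ℝ P p a v) n = 0 at h6
  rw [hPi p hpW v hv, symm_D2 hU hl hp _ n, eq_vin_of_fst_eq_zero h5, ((mem_KL l).1 hn).2,
    add_zero] at h6
  exact h6

/-- Differentiating the fibre coordinate in the first term of the energy gives dl on the vertical
part of z, which cancels against −dl(z). -/
theorem fderiv_enL {p : KVec E k} (hp : p ∈ U) (z : KVec E k) :
    fderiv ℝ (enL l) p z = D2 l p z (vin p.2) - fderiv ℝ l p (z.1, 0) := by
  have h1 : HasFDerivAt (fun q : KVec E k => (vin q.2 : KVec E k))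
      ((vin (E := E) (k := k)).comp (ContinuousLinearMap.snd ℝ E (Fin k → E))) p :=
    ((vin (E := E) (k := k)).comp (ContinuousLinearMap.snd ℝ E (Fin k → E))).hasFDerivAt
  have h2 := (((hl.fderiv_infty hU).hasFDerivAt_infty hU hp).clm_apply h1).sub
    (hl.hasFDerivAt_infty hU hp)
  have h3 : HasFDerivAt (enL l) _ p := h2
  rw [h3.fderiv]
  have h4 : z = ((z.1, 0) : KVec E k) + vin z.2 := by ext1 <;> simp
  have h5 : fderiv ℝ l p z = fderiv ℝ l p (z.1, 0) + fderiv ℝ l p (vin z.2) := by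
    rw [← map_add, ← h4]
  change fderiv ℝ l p (vin z.2) + D2 l p z (vin p.2) - fderiv ℝ l p z = _
  rw [h5]; ring

/-- The zero set of the restriction of the differential of the energy to the common kernel is
preserved along curves tangent to the kernel of the fibre Hessian. -/
theorem exists_curve_KL [FiniteDimensional ℝ E] (hK : ∀ p ∈ U, HasLocProj (KL l) p) {p₀ : KVec E k} (hp₀ : p₀ ∈ U)
    (hker : HasLocProj (kerL l) p₀) (h0 : ∀ h ∈ kerL l p₀, fderiv ℝ (enL l) p₀ h = 0)
    {v : KVec E k} (hv : v ∈ KL l p₀) :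
    ∃ c : ℝ → KVec E k, c 0 = p₀ ∧ ContDiffAt ℝ ∞ c 0 ∧ HasDerivAt c v 0 ∧
      ∀ᶠ t in 𝓝 (0 : ℝ), c t ∈ U ∧ ∀ h ∈ kerL l (c t), fderiv ℝ (enL l) (c t) h = 0 := by
  obtain ⟨W₁, hW₁, hp₁, P, hP, hPK, hPi⟩ := hK p₀ hp₀
  obtain ⟨W₂, hW₂, hp₂, R, hR, hRK, hRi⟩ := hker
  set W := U ∩ (W₁ ∩ W₂)
  have hW : IsOpen W := hU.inter (hW₁.inter hW₂)
  have hPW : ContDiffOn ℝ ∞ P W := hP.mono fun p hp => hp.2.1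
  have hRW : ContDiffOn ℝ ∞ R W := hR.mono fun p hp => hp.2.2
  have hXW : ContDiffOn ℝ ∞ (fun p => P p v) W := hPW.clm_apply contDiffOn_const
  have H1 : ∀ p ∈ W, fderiv ℝ (enL l) p (P p v) = 0 := by
    intro p hp
    have h1 := (mem_KL l).1 (hPK p hp.2.1 v)
    rw [fderiv_enL hU hl hp.1, h1.2, zero_sub, neg_eq_zero, h1.1]
    exact map_zero _
  -- Bracket of a section X of `KL` with a section Z of `kerL`. Differentiate ω^α(u, Z) = 0 along X
  -- and D²l(X, J^α u) = 0 along Z and subtract. The terms D³l(X, Z, J^α u) cancel by symmetry, and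
  -- D³l(X, u, J^α Z) vanishes because X and J^α Z both lie in `KL`.
  have H2 : ∀ p ∈ W, ∀ h, fderiv ℝ R p (P p v) h - fderiv ℝ (fun q => P q v) p (R p h) ∈
      kerL l p := by
    intro p hp h
    have hpU : p ∈ U := hp.1
    have hX : HasFDerivAt (fun q => P q v) (fderiv ℝ (fun q => P q v) p) p :=
      hXW.hasFDerivAt_infty hW hp
    have hZ : HasFDerivAt (fun q => R q h) ((fderiv ℝ R p).flip h) p := by
      simpa using (hRW.hasFDerivAt_infty hW hp).clm_apply (hasFDerivAt_const h p)
    set X := P p v with hXdef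
    set Z := R p h with hZdef
    set DZ := fderiv ℝ R p X h with hDZ
    set DX := fderiv ℝ (fun q => P q v) p Z with hDX
    have hXK : X ∈ KL l p := hPK p hp.2.1 v
    have hZK : Z ∈ kerL l p := hRK p hp.2.2 h
    have hDX1 : DX.1 = 0 := by
      have h3 : HasFDerivAt (fun q => (P q v).1)
          ((ContinuousLinearMap.fst ℝ E (Fin k → E)).comp (fderiv ℝ (fun q => P q v) p)) p :=
        (ContinuousLinearMap.fst ℝ E (Fin k → E)).hasFDerivAt.comp p hX
      have h4 : HasFDerivAt (fun q => (P q v).1) (0 : KVec E k →L[ℝ] E) p := by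
        refine (hasFDerivAt_const (0 : E) p).congr_of_eventuallyEq ?_
        filter_upwards [hW.mem_nhds hp] with q hq using ((mem_KL l).1 (hPK q hq.2.1 v)).1
      exact DFunLike.congr_fun (h3.unique h4) Z
    refine (mem_kerL l).2 fun α u => ?_
    have h1 : fderiv ℝ (D2 l) p X Z (jv α u) + D2 l p DZ (jv α u) -
        (fderiv ℝ (D2 l) p X u (jv α Z) + D2 l p u (jv α DZ)) = 0 := by
      have h5 := hasFDerivAt_D2_apply hU hl hpU hZ (jv α u)
      have h6 := (((contDiffOn_D2 hU hl).hasFDerivAt_infty hU hpU).clm_apply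
        (hasFDerivAt_const u p)).clm_apply ((jv α).hasFDerivAt.comp p hZ)
      have h7 := h5.sub h6
      have h8 : HasFDerivAt (fun q => D2 l q (R q h) (jv α u) - D2 l q u (jv α (R q h)))
          (0 : KVec E k →L[ℝ] ℝ) p := by
        refine (hasFDerivAt_const (0 : ℝ) p).congr_of_eventuallyEq ?_
        filter_upwards [hW.mem_nhds hp] with q hq
          using (mem_kerL l).1 (hRK q hq.2.2 h) α u
      have h9 := DFunLike.congr_fun (h7.unique h8) X
      simp only [sub_apply, add_apply, ContinuousLinearMap.flip_apply,
        ContinuousLinearMap.comp_apply, zero_apply, map_zero, zero_add,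
        Function.comp_apply] at h9
      linarith
    have h2 : fderiv ℝ (D2 l) p Z X (jv α u) + D2 l p DX (jv α u) = 0 := by
      have h5 := hasFDerivAt_D2_apply hU hl hpU hX (jv α u)
      have h8 : HasFDerivAt (fun q => D2 l q (P q v) (jv α u)) (0 : KVec E k →L[ℝ] ℝ) p := by
        refine (hasFDerivAt_const (0 : ℝ) p).congr_of_eventuallyEq ?_
        filter_upwards [hW.mem_nhds hp] with q hq
          using ((mem_KL l).1 (hPK q hq.2.1 v)).2 (Pi.single α u.1)
      exact DFunLike.congr_fun (h5.unique h8) Z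
    have h3 : fderiv ℝ (D2 l) p X u (jv α Z) = 0 := by
      rw [fderiv_D2_symm hU hl hpU]
      exact fderiv_D2_eq_zero hU hl hpU (hK p hpU) hXK
        (jv_mem_KL (symm_D2 hU hl hpU) (kerL_le_ML hZK) α) u
    have h4 := fderiv_D2_symm hU hl hpU X Z (jv α u)
    change omL l α p u (DZ - DX) = 0
    rw [map_sub, omL_apply, omL_apply, jv_of_fst_eq_zero α hDX1, map_zero, sub_zero]
    linarith
  obtain ⟨c, hc0, hc, hcv, hcU⟩ := exists_curve_of_bracket hW (p₀ := p₀) ⟨hp₀, hp₁, hp₂⟩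
    ((contDiffOn_enL hU hl).mono inter_subset_left) hXW (D := kerL l) hRW
    (fun p hp h hh => hRi p hp.2.2 h hh) H1 H2 (fun h => h0 _ (hRK p₀ hp₂ h))
  refine ⟨c, hc0, hc, ?_, hcU.mono fun t ht => ⟨ht.1.1, ht.2⟩⟩
  rwa [hPi p₀ hp₁ v hv] at hcv

/-- The derivative, along the kernel of the fibre Hessian, of the Euler-Lagrange form of a second
order field. -/
theorem hasFDerivAt_eulerLagrange [FiniteDimensional ℝ E] {p : KVec E k} (hp : p ∈ U) (hK : HasLocProj (KL l) p)
    {G : Fin k → KVec E k → KVec E k} {G' : Fin k → KVec E k →L[ℝ] KVec E k}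
    (hG : ∀ α, HasFDerivAt (G α) (G' α) p) (hGS : ∀ α, ∀ᶠ q in 𝓝 p, (G α q).1 = q.2 α)
    {z : KVec E k} (hz : z ∈ ML l p) :
    ∃ φ' : KVec E k →L[ℝ] ℝ,
      HasFDerivAt (fun q => ∑ α, omL l α q (G α q) z - fderiv ℝ (enL l) q z) φ' p ∧
      ∀ v ∈ KL l p, φ' v = ∑ α, omL l α p ((v.2 α, 0) : KVec E k) z := by
  -- For a second-order field the vectors J^α G_α add up to the Liouville vector, so D²l(z, Δ)
  -- cancels between the two terms and the Euler-Lagrange expression remains.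
  have h1 : (fun q => ∑ α, omL l α q (G α q) z - fderiv ℝ (enL l) q z) =ᶠ[𝓝 p]
      fun q => fderiv ℝ l q (z.1, 0) - ∑ α, D2 l q (G α q) (jv α z) := by
    filter_upwards [hU.mem_nhds hp, eventually_all.2 hGS] with q hq hqS
    simp only [omL_apply]
    rw [Finset.sum_sub_distrib, ← map_sum, fderiv_enL hU hl hq, vin_eq_sum]
    simp only [jv_apply, hqS]
    ring
  have h2 : HasFDerivAt (fun q => fderiv ℝ l q (z.1, 0)) ((D2 l p).flip (z.1, 0)) p := by
    simpa using ((hl.fderiv_infty hU).hasFDerivAt_infty hU hp).clm_apply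
      (hasFDerivAt_const ((z.1, 0) : KVec E k) p)
  have h3 := h2.sub (HasFDerivAt.fun_sum (u := Finset.univ) fun α _ =>
    hasFDerivAt_D2_apply hU hl hp (hG α) (jv α z))
  refine ⟨_, h3.congr_of_eventuallyEq h1, fun v hv => ?_⟩
  have hvK := (mem_KL l).1 hv
  simp only [sub_apply, sum_apply, add_apply,
    ContinuousLinearMap.comp_apply, ContinuousLinearMap.flip_apply, omL_apply]
  rw [Finset.sum_sub_distrib, ← map_sum]
  have h4 : D2 l p v (z.1, 0) = D2 l p z (∑ α, jv α ((v.2 α, 0) : KVec E k)) := by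
    rw [← vin_eq_sum, ← eq_vin_of_fst_eq_zero hvK.1, symm_D2 hU hl hp z v]
    have : z = ((z.1, 0) : KVec E k) + vin z.2 := by ext1 <;> simp
    conv_rhs => rw [this, map_add, hvK.2, add_zero]
  rw [h4]
  congr 1
  refine Finset.sum_congr rfl fun α _ => ?_
  have hjz := jv_mem_KL (symm_D2 hU hl hp) hz α
  -- The base component of G' is fixed by the second-order condition; its vertical component is
  -- invisible because J^α z lies in `KL`. Hence the answer does not depend on the choice of G.
  have h5 : (G' α v).1 = v.2 α := by
    have h6 : HasFDerivAt (fun q => (G α q).1)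
        ((ContinuousLinearMap.fst ℝ E (Fin k → E)).comp (G' α)) p :=
      (ContinuousLinearMap.fst ℝ E (Fin k → E)).hasFDerivAt.comp p (hG α)
    have h7 : HasFDerivAt (fun q : KVec E k => q.2 α)
        ((ContinuousLinearMap.proj (R := ℝ) (φ := fun _ : Fin k => E) α).comp
          (ContinuousLinearMap.snd ℝ E (Fin k → E))) p :=
      ((ContinuousLinearMap.proj (R := ℝ) (φ := fun _ : Fin k => E) α).comp
          (ContinuousLinearMap.snd ℝ E (Fin k → E))).hasFDerivAt
    exact DFunLike.congr_fun (h6.unique (h7.congr_of_eventuallyEq (hGS α))) v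
  rw [fderiv_D2_symm hU hl hp, fderiv_D2_eq_zero hU hl hp hK hv hjz, zero_add]
  have h8 : G' α v = ((v.2 α, 0) : KVec E k) + vin (G' α v).2 := by
    rw [← h5]; ext1 <;> simp
  rw [h8, map_add, add_apply, symm_D2 hU hl hp (vin _), ((mem_KL l).1 hjz).2, add_zero]

end LocalDynamics

/-! ### Differentials, forms and vector fields in a preferred chart -/

section ChartCalculus

variable {H : Type*} [NormedAddCommGroup H] [NormedSpace ℝ H] {H' : Type*} [TopologicalSpace H']
  (I : ModelWithCorners ℝ H H') {M : Type*} [TopologicalSpace M] [ChartedSpace H' M]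

/-- The differential at `y` of the preferred chart at `x`. -/
def chartD (x y : M) : TangentSpace I y →L[ℝ] H := mfderiv I 𝓘(ℝ, H) (extChartAt I x) y

/-- The inverse of the differential at `y` of the preferred chart at `x`. -/
def chartDInv (x y : M) : H →L[ℝ] TangentSpace I y := (chartD I x y).inverse

variable [IsManifold I ∞ M]

theorem isManifold_one : IsManifold I 1 M := IsManifold.of_le (n := ∞) (by simp)

section

variable {I} {x y : M} (hy : y ∈ (extChartAt I x).source)

include hy

theorem isInvertible_chartD : (chartD I x y).IsInvertible := by
  have := isManifold_one I (M := M)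
  exact isInvertible_mfderiv_extChartAt hy

theorem chartD_chartDInv (h : H) : chartD I x y (chartDInv I x y h) = h :=
  (isInvertible_chartD hy).self_apply_inverse h

theorem chartDInv_chartD (u : TangentSpace I y) : chartDInv I x y (chartD I x y u) = u :=
  (isInvertible_chartD hy).inverse_apply_self u

theorem chartD_injective : Function.Injective (chartD I x y) :=
  (isInvertible_chartD hy).injective

/-- The differential of the chart as a linear equivalence. -/
def chartDEquiv : TangentSpace I y ≃ₗ[ℝ] H :=
  { (chartD I x y).toLinearMap with
    invFun := chartDInv I x y
    left_inv := chartDInv_chartD hy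
    right_inv := chartD_chartDInv hy }

theorem mdifferentiableAt_extChartAt_infty : MDifferentiableAt I 𝓘(ℝ, H) (extChartAt I x) y := by
  rw [extChartAt_source] at hy
  exact (contMDiffAt_extChartAt' (n := ∞) hy).mdifferentiableAt (by simp)

theorem chartD_mfderiv {G : Type*} [NormedAddCommGroup G] [NormedSpace ℝ G] {g : G → M} {t : G}
    (hg : MDifferentiableAt 𝓘(ℝ, G) I g t) (hgt : g t = y) (v : G) :
    chartD I x (g t) (mfderiv 𝓘(ℝ, G) I g t v) = fderiv ℝ (extChartAt I x ∘ g) t v := by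
  subst hgt
  rw [← mfderiv_eq_fderiv]
  exact (mfderiv_comp_apply t (mdifferentiableAt_extChartAt_infty hy) hg v).symm

end

theorem mfderiv_extChartAt_symm_eq [I.Boundaryless] {x : M} {z : H}
    (hz : z ∈ (extChartAt I x).target) (v : H) :
    chartD I x ((extChartAt I x).symm z) (mfderiv 𝓘(ℝ, H) I (extChartAt I x).symm z v) = v := by
  have h1 : MDifferentiableAt 𝓘(ℝ, H) I (extChartAt I x).symm z :=
    ((contMDiffOn_extChartAt_symm (n := ∞) x).contMDiffAt
      ((isOpen_extChartAt_target x).mem_nhds hz)).mdifferentiableAt (by simp)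
  rw [chartD_mfderiv ((extChartAt I x).map_target hz) h1 rfl]
  have h2 : (extChartAt I x ∘ (extChartAt I x).symm) =ᶠ[𝓝 z] id := by
    filter_upwards [(isOpen_extChartAt_target x).mem_nhds hz] with w hw
      using (extChartAt I x).right_inv hw
  rw [h2.fderiv_eq, fderiv_id]
  rfl

/-- The transition map between two preferred charts. -/
def chartTrans (x x' : M) (z : H) : H := extChartAt I x' ((extChartAt I x).symm z)

theorem contDiffAt_chartTrans [I.Boundaryless] {x x' : M} {z : H} (hz : z ∈ (extChartAt I x).target)
    (hz' : (extChartAt I x).symm z ∈ (extChartAt I x').source) :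
    ContDiffAt ℝ ∞ (chartTrans I x x') z := by
  rw [extChartAt_source] at hz'
  exact ((contMDiffAt_extChartAt' (n := ∞) hz').comp z
    ((contMDiffOn_extChartAt_symm (n := ∞) x).contMDiffAt
      ((isOpen_extChartAt_target x).mem_nhds hz))).contDiffAt

theorem mdifferentiableAt_extChartAt_symm_infty [I.Boundaryless] {x : M} {z : H}
    (hz : z ∈ (extChartAt I x).target) : MDifferentiableAt 𝓘(ℝ, H) I (extChartAt I x).symm z :=
  ((contMDiffOn_extChartAt_symm (n := ∞) x).contMDiffAt
      ((isOpen_extChartAt_target x).mem_nhds hz)).mdifferentiableAt (by simp)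

theorem fderiv_chartTrans [I.Boundaryless] {x x' : M} {z : H} (hz : z ∈ (extChartAt I x).target)
    (hz' : (extChartAt I x).symm z ∈ (extChartAt I x').source) (v : H) :
    fderiv ℝ (chartTrans I x x') z v =
      chartD I x' ((extChartAt I x).symm z) (mfderiv 𝓘(ℝ, H) I (extChartAt I x).symm z v) :=
  (chartD_mfderiv hz' (mdifferentiableAt_extChartAt_symm_infty I hz) rfl v).symm

theorem chartD_eq_fderiv_chartTrans [I.Boundaryless] {x x' y : M}
    (hy : y ∈ (extChartAt I x).source) (hy' : y ∈ (extChartAt I x').source)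
    (u : TangentSpace I y) :
    chartD I x' y u = fderiv ℝ (chartTrans I x x') (extChartAt I x y) (chartD I x y u) := by
  have hz : extChartAt I x y ∈ (extChartAt I x).target := (extChartAt I x).map_source hy
  have h1 : extChartAt I x' =ᶠ[𝓝 y] chartTrans I x x' ∘ extChartAt I x := by
    filter_upwards [(isOpen_extChartAt_source x).mem_nhds hy] with w hw
    simp only [Function.comp_apply, chartTrans, (extChartAt I x).left_inv hw]
  have h2 : ContDiffAt ℝ ∞ (chartTrans I x x') (extChartAt I x y) :=
    contDiffAt_chartTrans I hz (by rwa [(extChartAt I x).left_inv hy])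
  have h3 : MDifferentiableAt 𝓘(ℝ, H) 𝓘(ℝ, H) (chartTrans I x x') (extChartAt I x y) :=
    (h2.differentiableAt (by simp)).mdifferentiableAt
  change mfderiv I 𝓘(ℝ, H) (extChartAt I x') y u = _
  rw [← mfderiv_eq_fderiv]
  refine Eq.trans ?_ (mfderiv_comp_apply y h3 (mdifferentiableAt_extChartAt_infty hy) u)
  have := h1.mfderiv_eq (I := I) (I' := 𝓘(ℝ, H))
  exact DFunLike.congr_fun this u

/-- The coordinate expression of a 1-form, evaluated on the differential of the chart. -/
theorem localForm_chartD [I.Boundaryless] (θ : (x : M) → TangentSpace I x →L[ℝ] ℝ) {x y : M}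
    (hy : y ∈ (extChartAt I x).source) (u : TangentSpace I y) :
    localForm I θ x (extChartAt I x y) (chartD I x y u) = θ y u := by
  have hz : extChartAt I x y ∈ (extChartAt I x).target := (extChartAt I x).map_source hy
  -- The point obtained by applying the chart and its inverse equals y only propositionally.
  -- Generalizing over it lets `rfl` identify the two tangent spaces.
  have h1 : ∀ y' (hy' : y' = y) (v : TangentSpace I y'), chartD I x y' v = chartD I x y u →
      θ y' v = θ y u := by
    rintro y' rfl v hv
    rw [chartD_injective hy hv]
  exact h1 _ ((extChartAt I x).left_inv hy) _ (mfderiv_extChartAt_symm_eq I hz _)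

theorem localForm_eq [I.Boundaryless] (θ : (x : M) → TangentSpace I x →L[ℝ] ℝ) {x x' : M} {z : H}
    (hz : z ∈ (extChartAt I x).target)
    (hz' : (extChartAt I x).symm z ∈ (extChartAt I x').source) :
    localForm I θ x z =
      (localForm I θ x' (chartTrans I x x' z)).comp (fderiv ℝ (chartTrans I x x') z) := by
  ext v
  rw [ContinuousLinearMap.comp_apply, fderiv_chartTrans I hz hz' v]
  exact (localForm_chartD I θ hz' _).symm

/-- The exterior derivative can be computed in any preferred chart. -/
theorem extDerivOneForm_eq [I.Boundaryless] (θ : (x : M) → TangentSpace I x →L[ℝ] ℝ) {x y : M}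
    (hy : y ∈ (extChartAt I x).source)
    (hθ : DifferentiableAt ℝ (localForm I θ x) (extChartAt I x y)) (u w : TangentSpace I y) :
    extDerivOneForm I θ y u w =
      fderiv ℝ (localForm I θ x) (extChartAt I x y) (chartD I x y u) (chartD I x y w) -
        fderiv ℝ (localForm I θ x) (extChartAt I x y) (chartD I x y w) (chartD I x y u) := by
  set z := extChartAt I y y with hz
  have hzt : z ∈ (extChartAt I y).target := mem_extChartAt_target y
  have hzy : (extChartAt I y).symm z = y := extChartAt_to_inv y
  have hzs : (extChartAt I y).symm z ∈ (extChartAt I x).source := by rwa [hzy]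
  set τ := chartTrans I y x with hτ
  have hτz : τ z = extChartAt I x y := by rw [hτ, chartTrans, hzy]
  have hev : localForm I θ y =ᶠ[𝓝 z] fun z' => (localForm I θ x (τ z')).comp (fderiv ℝ τ z') := by
    have hc : ContinuousAt (extChartAt I y).symm z := continuousAt_extChartAt_symm y
    filter_upwards [(isOpen_extChartAt_target y).mem_nhds hzt,
      hc.preimage_mem_nhds ((isOpen_extChartAt_source x).mem_nhds hzs)] with z' h1 h2
    exact localForm_eq I θ h1 h2
  have hτs : ContDiffAt ℝ ∞ τ z := contDiffAt_chartTrans I hzt hzs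
  have hτd : HasFDerivAt τ (fderiv ℝ τ z) z := (hτs.differentiableAt (by simp)).hasFDerivAt
  have hτ2 : HasFDerivAt (fderiv ℝ τ) (fderiv ℝ (fderiv ℝ τ) z) z :=
    ((hτs.fderiv_right (m := ∞) (by simp)).differentiableAt (by simp)).hasFDerivAt
  rw [← hτz] at hθ
  have hd := (hθ.hasFDerivAt.comp z hτd).clm_comp hτ2
  -- The change of chart adds a term with the second derivative of the transition map τ. It is
  -- symmetric in a and b, so it disappears on antisymmetrization.
  have hD : ∀ a b, fderiv ℝ (localForm I θ y) z a b =
      localForm I θ x (τ z) (fderiv ℝ (fderiv ℝ τ) z a b) +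
        fderiv ℝ (localForm I θ x) (τ z) (fderiv ℝ τ z a) (fderiv ℝ τ z b) := by
    intro a b
    rw [hev.fderiv_eq]
    have := DFunLike.congr_fun (DFunLike.congr_fun hd.fderiv a) b
    exact this
  have h3 := symm_fderiv_fderiv hτs (chartD I y y u) (chartD I y y w)
  have h4 : ∀ v : TangentSpace I y, fderiv ℝ τ z (chartD I y y v) = chartD I x y v := fun v =>
    (chartD_eq_fderiv_chartTrans I (mem_extChartAt_source y) hy v).symm
  have h5 : extDerivOneForm I θ y u w =
      fderiv ℝ (localForm I θ y) z (chartD I y y u) (chartD I y y w) -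
        fderiv ℝ (localForm I θ y) z (chartD I y y w) (chartD I y y u) := rfl
  rw [h5, hD, hD, h4, h4, h3, hτz]
  ring

theorem dAt_eq {f : M → ℝ} {x y : M} (hy : y ∈ (extChartAt I x).source) [I.Boundaryless]
    (hf : MDifferentiableAt I 𝓘(ℝ, ℝ) f y) (u : TangentSpace I y) :
    dAt I f y u = fderiv ℝ (f ∘ (extChartAt I x).symm) (extChartAt I x y) (chartD I x y u) := by
  have hz : extChartAt I x y ∈ (extChartAt I x).target := (extChartAt I x).map_source hy
  have h1 : f =ᶠ[𝓝 y] (f ∘ (extChartAt I x).symm) ∘ extChartAt I x := by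
    filter_upwards [(isOpen_extChartAt_source x).mem_nhds hy] with w hw
    simp only [Function.comp_apply, (extChartAt I x).left_inv hw]
  have h3 : MDifferentiableAt 𝓘(ℝ, H) 𝓘(ℝ, ℝ) (f ∘ (extChartAt I x).symm) (extChartAt I x y) := by
    refine MDifferentiableAt.comp (I' := I) _ ?_ (mdifferentiableAt_extChartAt_symm_infty I hz)
    rwa [(extChartAt I x).left_inv hy]
  rw [← mfderiv_eq_fderiv]
  refine Eq.trans ?_ (mfderiv_comp_apply y h3 (mdifferentiableAt_extChartAt_infty hy) u)
  exact DFunLike.congr_fun (h1.mfderiv_eq (I := I) (I' := 𝓘(ℝ, ℝ))) u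

/-- A vector field is smooth on an open subset of a chart domain iff its expression in that chart
is. -/
theorem contMDiffOn_vf_iff [IsManifold I 1 M] {Z : (x : M) → TangentSpace I x} {x : M} {U : Set M}
    (hU : IsOpen U) (hUx : U ⊆ (extChartAt I x).source) :
    ContMDiffOn I I.tangent ∞ (fun y => (⟨y, Z y⟩ : TangentBundle I M)) U ↔
      ContMDiffOn I 𝓘(ℝ, H) ∞ (fun y => chartD I x y (Z y)) U := by
  have : IsManifold I (∞ + 1) M := inferInstanceAs (IsManifold I ∞ M)
  have := TangentBundle.contMDiffVectorBundle (I := I) (M := M) (n := ∞)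
  rw [extChartAt_source] at hUx
  have h := (trivializationAt H (TangentSpace I : M → Type _) x).contMDiffOn_section_iff
    (IB := I) (n := ∞) (s := Z) hU hUx
  refine h.trans (contMDiffOn_congr fun y hy => ?_)
  have h2 := TangentBundle.continuousLinearMapAt_trivializationAt (I := I) (x₀ := x) (hUx hy)
  have h3 := DFunLike.congr_fun h2 (Z y)
  refine Eq.trans ?_ h3
  rw [Trivialization.continuousLinearMapAt_apply, Trivialization.coe_linearMapAt_of_mem _ (hUx hy)]

end ChartCalculus

/-! ### Tangent vectors of embedded submanifolds -/

section Submanifolds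

variable {H : Type*} [NormedAddCommGroup H] [NormedSpace ℝ H] {H' : Type*} [TopologicalSpace H']
  {I : ModelWithCorners ℝ H H'} {M : Type*} [TopologicalSpace M] [ChartedSpace H' M]

/-- Tangent vectors of `S` annihilate the functions which vanish on `S`. -/
theorem IsTangentTo.dAt_eq_zero {S : Set M} {x : M} {u : TangentSpace I x}
    (hu : IsTangentTo I S x u) {f : M → ℝ} (hf : MDifferentiableAt I 𝓘(ℝ, ℝ) f x)
    (hS : ∀ y ∈ S, f y = 0) : dAt I f x u = 0 := by
  obtain ⟨γ, hγ, hγS, hγu⟩ := hu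
  have h1 : ∀ (p : TangentBundle I M), p = ⟨γ 0, mfderiv 𝓘(ℝ, ℝ) I γ 0 (1 : ℝ)⟩ →
      MDifferentiableAt I 𝓘(ℝ, ℝ) f p.1 → dAt I f p.1 p.2 = 0 := by
    rintro _ rfl hf
    have h2 : f ∘ γ =ᶠ[𝓝 0] fun _ => 0 := hγS.mono fun t ht => hS _ ht
    have h3 := mfderiv_comp_apply (0 : ℝ) hf (hγ.mdifferentiableAt (by simp)) (1 : ℝ)
    rw [mfderiv_eq_fderiv, h2.fderiv_eq] at h3
    rw [fderiv_const_apply] at h3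
    exact h3.symm
  exact h1 _ hγu.symm hf

/-- The chart φ has a smooth local inverse. It is an arbitrary member of the maximal atlas, as
adapted charts of a submanifold need not be preferred charts. -/
theorem mfderiv_extend_injective [I.Boundaryless] {φ : OpenPartialHomeomorph M H'}
    (hφ : φ ∈ IsManifold.maximalAtlas I ∞ M) {y : M} (hy : y ∈ φ.source) :
    Function.Injective (mfderiv I 𝓘(ℝ, H) (φ.extend I) y) := by
  have hd : MDifferentiableAt I 𝓘(ℝ, H) (φ.extend I) y :=
    (φ.contMDiffAt_extend hφ hy).mdifferentiableAt (by simp : (∞ : WithTop ℕ∞) ≠ 0)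
  have hs : MDifferentiableAt 𝓘(ℝ, H) I (φ.extend I).symm (φ.extend I y) := by
    have hzt : φ.extend I y ∈ (φ.extend I).target :=
      (φ.extend I).map_source (by rwa [φ.extend_source])
    have : ContMDiffAt 𝓘(ℝ, H) I ∞ (φ.extend I).symm (φ.extend I y) := by
      refine (contMDiffOn_extend_symm hφ).contMDiffAt ?_
      rw [← φ.extend_target']
      exact φ.isOpen_extend_target.mem_nhds hzt
    exact this.mdifferentiableAt (by simp)
  have h1 : (φ.extend I).symm ∘ φ.extend I =ᶠ[𝓝 y] id := by
    filter_upwards [φ.open_source.mem_nhds hy] with q hq using φ.extend_left_inv hq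
  have h2 : ∀ a : TangentSpace I y, mfderiv 𝓘(ℝ, H) I (φ.extend I).symm (φ.extend I y)
      (mfderiv I 𝓘(ℝ, H) (φ.extend I) y a) = a := by
    intro a
    refine (mfderiv_comp_apply y hs hd a).symm.trans ?_
    refine (DFunLike.congr_fun (h1.mfderiv_eq (I := I) (I' := I)) a).trans ?_
    rw [mfderiv_id]; rfl
  intro a b hab
  rw [← h2 a, ← h2 b, hab]

variable [FiniteDimensional ℝ H] [I.Boundaryless]

/-- A continuous projection onto W fixes f near 0, hence fixes its derivative. -/
theorem deriv_mem_of_eventually_mem {f : ℝ → H} {f' : H} (hf : HasDerivAt f f' 0)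
    {W : Submodule ℝ H} (hW : ∀ᶠ t in 𝓝 (0 : ℝ), f t ∈ W) : f' ∈ W := by
  obtain ⟨p, hp⟩ : W.ClosedComplemented := .of_finiteDimensional_quotient
    W.closed_of_finiteDimensional
  have h1 : HasDerivAt (fun t => (p (f t) : H)) (p f' : H) 0 :=
    ((W.subtypeL.comp p).hasFDerivAt.comp_hasDerivAt 0 hf)
  have h2 : f =ᶠ[𝓝 0] fun t => (p (f t) : H) := hW.mono fun t ht => by
    have := hp ⟨f t, ht⟩
    exact (congrArg Subtype.val this).symm
  rw [(hf.congr_of_eventuallyEq h2.symm).unique h1]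
  exact (p f').2

/-- The tangent space of an embedded submanifold in an adapted chart. -/
theorem isTangentTo_iff {S : Set M} {φ : OpenPartialHomeomorph M H'}
    (hφ : φ ∈ IsManifold.maximalAtlas I ∞ M) {W : Submodule ℝ H}
    (hW : ∀ y ∈ φ.source, y ∈ S ↔ φ.extend I y ∈ W) {x : M} (hx : x ∈ φ.source) (hxS : x ∈ S)
    (u : TangentSpace I x) :
    IsTangentTo I S x u ↔ mfderiv I 𝓘(ℝ, H) (φ.extend I) x u ∈ W := by
  have hext : ContMDiffAt I 𝓘(ℝ, H) ∞ (φ.extend I) x := φ.contMDiffAt_extend hφ hx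
  have hextd := hext.mdifferentiableAt (by simp : (∞ : WithTop ℕ∞) ≠ 0)
  constructor
  · rintro ⟨γ, hγ, hγS, hγu⟩
    have h1 : ∀ (p : TangentBundle I M), p = ⟨γ 0, mfderiv 𝓘(ℝ, ℝ) I γ 0 (1 : ℝ)⟩ →
        MDifferentiableAt I 𝓘(ℝ, H) (φ.extend I) p.1 → p.1 ∈ φ.source →
        mfderiv I 𝓘(ℝ, H) (φ.extend I) p.1 p.2 ∈ W := by
      rintro _ rfl hd hs
      have hγd := hγ.mdifferentiableAt (by simp : (∞ : WithTop ℕ∞) ≠ 0)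
      have h2 := mfderiv_comp_apply (0 : ℝ) hd hγd (1 : ℝ)
      have h3 : DifferentiableAt ℝ (φ.extend I ∘ γ) 0 :=
        (MDifferentiableAt.comp (I' := I) (0 : ℝ) hd hγd).differentiableAt
      rw [mfderiv_eq_fderiv] at h2
      have h4 := deriv_mem_of_eventually_mem h3.hasDerivAt (W := W) (by
        filter_upwards [hγS, hγ.continuousAt.preimage_mem_nhds (φ.open_source.mem_nhds hs)]
          with t ht ht' using (hW _ ht').1 ht)
      rw [← fderiv_apply_one_eq_deriv] at h4
      exact h2 ▸ h4
    exact h1 _ hγu.symm hextd hx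
  · intro hu
    -- The required curve is the straight line through z with direction w in the adapted chart; it
    -- stays in W, so its preimage stays in S.
    set z := φ.extend I x with hz
    set w : H := mfderiv I 𝓘(ℝ, H) (φ.extend I) x u with hw
    have hzt : z ∈ (φ.extend I).target := (φ.extend I).map_source (by rwa [φ.extend_source])
    have htn : (φ.extend I).target ∈ 𝓝 z := φ.isOpen_extend_target.mem_nhds hzt
    have hline : ContDiff ℝ ∞ fun t : ℝ => z + t • w :=
      contDiff_const.add (contDiff_id.smul contDiff_const)
    have hline0 : (fun t : ℝ => z + t • w) 0 = z := by simp
    have hsymm : ContMDiffAt 𝓘(ℝ, H) I ∞ (φ.extend I).symm z := by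
      refine (contMDiffOn_extend_symm hφ).contMDiffAt ?_
      rwa [← φ.extend_target']
    have hsx : (φ.extend I).symm z = x := φ.extend_left_inv hx
    have hg0 : (φ.extend I).symm (z + (0 : ℝ) • w) = x := by rw [zero_smul, add_zero, hsx]
    have hgam : ContMDiffAt 𝓘(ℝ, ℝ) I ∞ (fun t : ℝ => (φ.extend I).symm (z + t • w)) 0 :=
      ContMDiffAt.comp (I' := 𝓘(ℝ, H)) (0 : ℝ) (by simpa using hsymm) hline.contMDiff.contMDiffAt
    have hlt : ∀ᶠ t : ℝ in 𝓝 0, z + t • w ∈ (φ.extend I).target :=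
      hline.continuous.continuousAt.preimage_mem_nhds (by simpa using htn)
    refine ⟨fun t => (φ.extend I).symm (z + t • w), hgam, ?_, ?_⟩
    · filter_upwards [hlt] with t ht
      refine (hW _ (by rw [← φ.extend_source (I := I)]; exact (φ.extend I).map_target ht)).2 ?_
      rw [(φ.extend I).right_inv ht]
      exact W.add_mem ((hW x hx).1 hxS) (W.smul_mem _ hu)
    · have h5 : ∀ y (hy : y = x) (v : TangentSpace I y),
          mfderiv I 𝓘(ℝ, H) (φ.extend I) y v = w → (⟨y, v⟩ : TangentBundle I M) = ⟨x, u⟩ := by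
        rintro y rfl v hv
        rw [mfderiv_extend_injective hφ hx (hv.trans hw)]
      refine h5 _ hg0 _ ?_
      have hd2 : MDifferentiableAt I 𝓘(ℝ, H) (φ.extend I) ((φ.extend I).symm (z + (0 : ℝ) • w)) := by
        rwa [hg0]
      have h9 := mfderiv_comp_apply (0 : ℝ) hd2
        (hgam.mdifferentiableAt (by simp)) (1 : ℝ)
      refine h9.symm.trans ?_
      rw [mfderiv_eq_fderiv]
      have h10 : φ.extend I ∘ (fun t : ℝ => (φ.extend I).symm (z + t • w)) =ᶠ[𝓝 0]
          fun t => z + t • w := by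
        filter_upwards [hlt] with t ht using (φ.extend I).right_inv ht
      rw [h10.fderiv_eq]
      have h11 : HasDerivAt (fun t : ℝ => z + t • w) ((1 : ℝ) • w) 0 :=
        ((hasDerivAt_id (0 : ℝ)).smul_const w).const_add z
      exact (fderiv_apply_one_eq_deriv.trans h11.deriv).trans (one_smul ℝ w)

/-- Velocities of curves in a general set need not add; in an adapted chart tangency is membership
in a linear subspace. -/
theorem IsEmbeddedSubmanifold.isTangentTo_add {S : Set M} (hS : IsEmbeddedSubmanifold I S) {x : M}
    (hx : x ∈ S) {u v : TangentSpace I x} (hu : IsTangentTo I S x u) (hv : IsTangentTo I S x v) :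
    IsTangentTo I S x (u + v) := by
  obtain ⟨φ, hφ, hxφ, W, hW⟩ := hS x hx
  rw [isTangentTo_iff hφ hW hxφ hx] at hu hv ⊢
  rw [map_add]
  exact W.add_mem hu hv

end Submanifolds

/-! ### Bundle charts of the k-tangent bundle and its canonical objects -/

section KTangentCharts

variable {E : Type*} [NormedAddCommGroup E] [NormedSpace ℝ E] {k : ℕ}
variable {Q : Type*} [TopologicalSpace Q] [ChartedSpace E Q]

variable (E k) in
/-- The action of the differential at `q'` of the chart at `q` on `k`-tuples of tangent vectors. -/
def fibreD (q q' : Q) : (Fin k → E) →L[ℝ] (Fin k → E) :=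
  kMap (E := E) k (chartD 𝓘(ℝ, E) q q')

theorem fibreD_apply (q q' : Q) (v : Fin k → E) (α : Fin k) :
    fibreD E k q q' v α = chartD 𝓘(ℝ, E) q q' (v α) := rfl

theorem fibreD_single (q q' : Q) (α : Fin k) (v : E) :
    fibreD E k q q' (Pi.single α v) = Pi.single α (chartD 𝓘(ℝ, E) q q' v : E) := by
  funext β
  rw [fibreD_apply]
  by_cases h : β = α
  · subst h; rw [Pi.single_eq_same, Pi.single_eq_same]
  · rw [Pi.single_eq_of_ne h, Pi.single_eq_of_ne h]; exact map_zero _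

variable [IsManifold 𝓘(ℝ, E) ∞ Q]

theorem kTangent_extChartAt_source (x : KTangent E k Q) :
    (extChartAt (kModel E k) x).source = {y | y.1 ∈ (chartAt E x.1).source} := by
  ext y
  rw [FiberBundle.extChartAt]
  have hb : (trivializationAt (Fin k → E) (KTangentSpace E k : Q → Type _) x.1).baseSet =
    (chartAt E x.1).source := rfl
  have hf : ((trivializationAt (Fin k → E) (KTangentSpace E k : Q → Type _) x.1) y).1 = y.1 := rfl
  simp [PartialEquiv.trans_source, Trivialization.mem_source, hb, hf]

theorem mem_kTangent_source {x y : KTangent E k Q} :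
    y ∈ (extChartAt (kModel E k) x).source ↔ y.1 ∈ (extChartAt 𝓘(ℝ, E) x.1).source := by
  rw [kTangent_extChartAt_source, extChartAt_source]; rfl

/-- The trivialization applies the coordinate changes of the tangent bundle to each component, and
these are the differentials of the charts of Q. -/
theorem kTangent_trivializationAt_snd {q : Q} (y : KTangent E k Q) (hy : y.1 ∈ (chartAt E q).source) :
    (trivializationAt (Fin k → E) (KTangentSpace E k : Q → Type _) q y).2 =
      fibreD E k q y.1 y.2 := by
  have : IsManifold 𝓘(ℝ, E) 1 Q := isManifold_one _
  have h : mfderiv 𝓘(ℝ, E) 𝓘(ℝ, E) (extChartAt 𝓘(ℝ, E) q) y.1 =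
      tangentCoordChange 𝓘(ℝ, E) y.1 q y.1 := mfderiv_chartAt_eq_tangentCoordChange hy
  funext α
  exact (DFunLike.congr_fun h (y.2 α)).symm

theorem kTangent_extChartAt_apply {x y : KTangent E k Q}
    (hy : y ∈ (extChartAt (kModel E k) x).source) :
    extChartAt (kModel E k) x y =
      (extChartAt 𝓘(ℝ, E) x.1 y.1, fibreD E k x.1 y.1 y.2) := by
  rw [kTangent_extChartAt_source] at hy
  rw [← kTangent_trivializationAt_snd y hy, FiberBundle.extChartAt]
  rfl

theorem contMDiff_fibre (q : Q) :
    ContMDiff 𝓘(ℝ, Fin k → E) (kModel E k) ∞ (fun w : Fin k → E => (⟨q, w⟩ : KTangent E k Q)) := by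
  intro w
  rw [contMDiffAt_totalSpace]
  refine ⟨contMDiffAt_const, ?_⟩
  have h : (fun w : Fin k → E => (trivializationAt (Fin k → E) (KTangentSpace E k : Q → Type _) q
      (⟨q, w⟩ : KTangent E k Q)).2) = fun w => fibreD E k q q w :=
    funext fun w => kTangent_trivializationAt_snd ⟨q, w⟩ (mem_chart_source E q)
  change ContMDiffAt _ _ _ (fun w : Fin k → E =>
    (trivializationAt (Fin k → E) (KTangentSpace E k : Q → Type _) q (⟨q, w⟩ : KTangent E k Q)).2) w
  rw [h]
  exact (ContinuousLinearMap.contDiff (fibreD E k q q)).contMDiff.contMDiffAt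

variable {x y : KTangent E k Q} (hy : y ∈ (extChartAt (kModel E k) x).source)

include hy

theorem chartD_fst (u : TK y) :
    (chartD (kModel E k) x y u).1 = chartD 𝓘(ℝ, E) x.1 y.1 (dProj y u) := by
  have h1 : MDifferentiableAt (kModel E k) 𝓘(ℝ, E) (fun y : KTangent E k Q => y.1) y :=
    (contMDiffAt_proj (n := ∞) (IB := 𝓘(ℝ, E)) (E := (KTangentSpace E k : Q → Type _))
      (F := Fin k → E)).mdifferentiableAt (by simp)
  have h2 : MDifferentiableAt 𝓘(ℝ, E) 𝓘(ℝ, E) (extChartAt 𝓘(ℝ, E) x.1) y.1 :=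
    mdifferentiableAt_extChartAt_infty (mem_kTangent_source.1 hy)
  have h3 := mfderiv_comp_apply y h2 h1 u
  have h4 : MDifferentiableAt (kModel E k) 𝓘(ℝ, E × (Fin k → E)) (extChartAt (kModel E k) x) y :=
    mdifferentiableAt_extChartAt_infty hy
  have h5 : MDifferentiableAt 𝓘(ℝ, E × (Fin k → E)) 𝓘(ℝ, E)
      (ContinuousLinearMap.fst ℝ E (Fin k → E)) (extChartAt (kModel E k) x y) :=
    (ContinuousLinearMap.fst ℝ E (Fin k → E)).differentiableAt.mdifferentiableAt
  have h6 := mfderiv_comp_apply y h5 h4 u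
  rw [mfderiv_eq_fderiv, ContinuousLinearMap.fderiv] at h6
  have h7 : (ContinuousLinearMap.fst ℝ E (Fin k → E)) ∘ extChartAt (kModel E k) x =ᶠ[𝓝 y]
      extChartAt 𝓘(ℝ, E) x.1 ∘ fun y : KTangent E k Q => y.1 := by
    filter_upwards [(isOpen_extChartAt_source x).mem_nhds hy] with w hw
    simp only [Function.comp_apply, kTangent_extChartAt_apply hw]
    rfl
  have h8 := DFunLike.congr_fun
    (h7.mfderiv_eq (I := kModel E k) (I' := 𝓘(ℝ, E))) u
  exact h6.symm.trans (h8.trans h3)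

/-- In the bundle chart the inclusion of a fibre is constant in the base and linear in the fibre.
Consequently J^α has constant coefficients there. -/
theorem chartD_vertLift (w : KTangentSpace E k y.1) :
    chartD (kModel E k) x y (vertLift y w) = (0, fibreD E k x.1 y.1 w) := by
  have h1 : MDifferentiableAt 𝓘(ℝ, Fin k → E) (kModel E k)
      (fun w : Fin k → E => (⟨y.1, w⟩ : KTangent E k Q)) y.2 :=
    (contMDiff_fibre y.1).mdifferentiable (by simp) _
  have h2 := chartD_mfderiv (I := kModel E k) (G := Fin k → E) (t := y.2) hy h1 rfl w
  refine Eq.trans h2 ?_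
  have h3 : extChartAt (kModel E k) x ∘ (fun w : Fin k → E => (⟨y.1, w⟩ : KTangent E k Q)) =
      fun w : Fin k → E => (extChartAt 𝓘(ℝ, E) x.1 y.1, fibreD E k x.1 y.1 w) := by
    funext w
    have : (⟨y.1, w⟩ : KTangent E k Q) ∈ (extChartAt (kModel E k) x).source :=
      mem_kTangent_source.2 (mem_kTangent_source.1 hy)
    exact kTangent_extChartAt_apply this
  have h4 : HasFDerivAt (fun w : Fin k → E =>
      ((extChartAt 𝓘(ℝ, E) x.1 y.1, fibreD E k x.1 y.1 w) : E × (Fin k → E)))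
      ((0 : (Fin k → E) →L[ℝ] E).prod (fibreD E k x.1 y.1)) y.2 :=
    (hasFDerivAt_const _ _).prodMk (ContinuousLinearMap.hasFDerivAt _)
  rw [← h3] at h4
  exact DFunLike.congr_fun h4.fderiv w

theorem chartD_vertLiftAt (α : Fin k) (v : TangentSpace 𝓘(ℝ, E) y.1) :
    chartD (kModel E k) x y (vertLiftAt α y v) =
      jv (E := E) (k := k) α ((chartD 𝓘(ℝ, E) x.1 y.1 v : E), (0 : Fin k → E)) :=
  (chartD_vertLift hy _).trans (Prod.ext rfl (fibreD_single (E := E) x.1 y.1 α v))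

theorem mem_vert_iff (u : TK y) : u ∈ vert y ↔ (chartD (kModel E k) x y u).1 = 0 := by
  rw [chartD_fst hy]
  constructor
  · intro h
    have : dProj y u = 0 := h
    rw [this]; exact map_zero _
  · intro h
    have h1 : chartD 𝓘(ℝ, E) x.1 y.1 (dProj y u) = chartD 𝓘(ℝ, E) x.1 y.1 0 := h.trans (map_zero _).symm
    exact chartD_injective (mem_kTangent_source.1 hy) h1

theorem chartD_vertEndo (α : Fin k) (u : TK y) :
    chartD (kModel E k) x y (vertEndo α y u) = jv α (chartD (kModel E k) x y u) := by
  refine (chartD_vertLiftAt hy α _).trans ?_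
  rw [jv_apply, jv_apply, chartD_fst hy]
  rfl

theorem chartD_liouville :
    chartD (kModel E k) x y (liouville y) = vin (extChartAt (kModel E k) x y).2 := by
  rw [kTangent_extChartAt_apply hy, liouville, map_sum]
  simp only [chartD_vertLiftAt hy]
  exact (vin_eq_sum _).symm

theorem isSopdeAt_iff (Y : Fin k → TK y) : IsSopdeAt y Y ↔
    ∀ α, (chartD (kModel E k) x y (Y α)).1 = (extChartAt (kModel E k) x y).2 α := by
  refine forall_congr' fun α => ?_
  rw [chartD_fst hy, kTangent_extChartAt_apply hy]
  constructor
  · intro h; rw [h]; rfl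
  · intro h; exact chartD_injective (mem_kTangent_source.1 hy) h

end KTangentCharts

/-! ### Cartan forms, energy and distributions in a bundle chart -/

section ChartLagrangian

variable {E : Type*} [NormedAddCommGroup E] [NormedSpace ℝ E] {k : ℕ}
variable {Q : Type*} [TopologicalSpace Q] [ChartedSpace E Q] [IsManifold 𝓘(ℝ, E) ∞ Q]

/-- The coordinate expression of the Lagrangian. -/
def chartL (L : KTangent E k Q → ℝ) (x : KTangent E k Q) : KVec E k → ℝ :=
  L ∘ (extChartAt (kModel E k) x).symm

variable (E k) in
/-- The domain of the coordinate expressions in the chart at `x`. -/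
abbrev tgt (x : KTangent E k Q) : Set (KVec E k) := (extChartAt (kModel E k) x).target

theorem isOpen_tgt (x : KTangent E k Q) : IsOpen (tgt E k x) := isOpen_extChartAt_target x

theorem finrank_eq_of_mem_iff {x y : KTangent E k Q}
    (hy : y ∈ (extChartAt (kModel E k) x).source) {D : Submodule ℝ (TK y)} {D' : Submodule ℝ (KVec E k)}
    (h : ∀ u, u ∈ D ↔ chartD (kModel E k) x y u ∈ D') :
    Module.finrank ℝ D = Module.finrank ℝ D' := by
  have h1 : D = D'.comap (chartDEquiv hy).toLinearMap := Submodule.ext h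
  have h2 : D.map (chartDEquiv hy).toLinearMap = D' := by
    rw [h1]
    exact Submodule.map_comap_eq_of_surjective (chartDEquiv hy).surjective _
  rw [← h2]
  exact ((chartDEquiv hy).submoduleMap D).finrank_eq

variable {L : KTangent E k Q → ℝ} (hL : ContMDiff (kModel E k) 𝓘(ℝ, ℝ) ∞ L)

theorem contDiffOn_comp_chart_symm {f : KTangent E k Q → ℝ}
    (hf : ContMDiff (kModel E k) 𝓘(ℝ, ℝ) ∞ f) (x : KTangent E k Q) :
    ContDiffOn ℝ ∞ (f ∘ (extChartAt (kModel E k) x).symm) (tgt E k x) :=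
  (hf.comp_contMDiffOn (contMDiffOn_extChartAt_symm x)).contDiffOn

include hL

theorem contDiffOn_chartL (x : KTangent E k Q) : ContDiffOn ℝ ∞ (chartL L x) (tgt E k x) :=
  contDiffOn_comp_chart_symm hL x

theorem localForm_cartanOne (α : Fin k) {x : KTangent E k Q} {z : KVec E k} (hz : z ∈ tgt E k x) :
    localForm (kModel E k) (cartanOne L α) x z = (fderiv ℝ (chartL L x) z).comp (jv α) := by
  refine ContinuousLinearMap.ext fun h => ?_
  have hy := (extChartAt (kModel E k) x).map_target hz
  set y := (extChartAt (kModel E k) x).symm z with hyz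
  have hz' : extChartAt (kModel E k) x y = z := (extChartAt (kModel E k) x).right_inv hz
  have h1 := localForm_chartD (kModel E k) (cartanOne L α) hy (chartDInv (kModel E k) x y h)
  rw [chartD_chartDInv hy, hz'] at h1
  rw [h1]
  have h2 := dAt_eq (kModel E k) hy (hL.mdifferentiableAt (by simp))
    (vertEndo α y (chartDInv (kModel E k) x y h))
  rw [chartD_vertEndo hy, chartD_chartDInv hy, hz'] at h2
  exact h2

section

variable {x y : KTangent E k Q} (hy : y ∈ (extChartAt (kModel E k) x).source)

include hy

/-- The coordinate form of θ^α is dl ∘ J^α with J^α constant, so −dθ^α involves only second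
derivatives of l. -/
theorem cartanTwo_eq (α : Fin k) (u w : TK y) :
    cartanTwo L α y u w = omL (chartL L x) α (extChartAt (kModel E k) x y)
      (chartD (kModel E k) x y u) (chartD (kModel E k) x y w) := by
  set z := extChartAt (kModel E k) x y with hz
  have hzt : z ∈ tgt E k x := (extChartAt (kModel E k) x).map_source hy
  have h1 : localForm (kModel E k) (cartanOne L α) x =ᶠ[𝓝 z]
      fun z => (fderiv ℝ (chartL L x) z).comp (jv α) := by
    filter_upwards [(isOpen_tgt x).mem_nhds hzt] with z hz using localForm_cartanOne hL α hz
  have h2 := (((contDiffOn_chartL hL x).fderiv_infty (isOpen_tgt x)).hasFDerivAt_infty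
    (isOpen_tgt x) hzt).clm_comp (hasFDerivAt_const (jv (E := E) α) z)
  have h3 := h2.congr_of_eventuallyEq h1
  have h4 : ∀ a b, fderiv ℝ (localForm (kModel E k) (cartanOne L α) x) z a b =
      D2 (chartL L x) z a (jv α b) := by
    intro a b
    rw [h3.fderiv]
    simp
  have h5 := extDerivOneForm_eq (kModel E k) (cartanOne L α) hy h3.differentiableAt u w
  rw [cartanTwo, LinearMap.neg_apply, LinearMap.neg_apply, h5, h4, h4, omL_apply]
  ring

theorem energy_eq : energy L y = enL (chartL L x) (extChartAt (kModel E k) x y) := by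
  rw [energy, enL, dAt_eq (kModel E k) hy (hL.mdifferentiableAt (by simp)), chartD_liouville hy,
    chartL, Function.comp_apply, (extChartAt (kModel E k) x).left_inv hy]

end

theorem contMDiff_energy : ContMDiff (kModel E k) 𝓘(ℝ, ℝ) ∞ (energy L) := by
  intro x
  have h1 : ContMDiffOn (kModel E k) 𝓘(ℝ, ℝ) ∞
      (enL (chartL L x) ∘ extChartAt (kModel E k) x) (extChartAt (kModel E k) x).source := by
    refine (contDiffOn_enL (isOpen_tgt x) (contDiffOn_chartL hL x)).contMDiffOn.comp ?_
      (extChartAt (kModel E k) x).mapsTo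
    rw [extChartAt_source]
    exact contMDiffOn_extChartAt
  have h2 : ContMDiffOn (kModel E k) 𝓘(ℝ, ℝ) ∞ (energy L) (extChartAt (kModel E k) x).source :=
    h1.congr fun y hy => energy_eq hL hy
  exact h2.contMDiffAt (extChartAt_source_mem_nhds x)

variable {x y : KTangent E k Q} (hy : y ∈ (extChartAt (kModel E k) x).source)

include hy

theorem dAt_energy_eq (u : TK y) : dAt (kModel E k) (energy L) y u =
    fderiv ℝ (enL (chartL L x)) (extChartAt (kModel E k) x y) (chartD (kModel E k) x y u) := by
  rw [dAt_eq (kModel E k) hy ((contMDiff_energy hL).mdifferentiableAt (by simp))]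
  have hzt : extChartAt (kModel E k) x y ∈ tgt E k x := (extChartAt (kModel E k) x).map_source hy
  have h1 : energy L ∘ (extChartAt (kModel E k) x).symm =ᶠ[𝓝 (extChartAt (kModel E k) x y)]
      enL (chartL L x) := by
    filter_upwards [(isOpen_tgt x).mem_nhds hzt] with z hz
    rw [Function.comp_apply, energy_eq hL ((extChartAt (kModel E k) x).map_target hz),
      (extChartAt (kModel E k) x).right_inv hz]
  rw [h1.fderiv_eq]

theorem om_eq (Y : Fin k → TK y) (w : TK y) :
    Om L y Y w = ∑ α, omL (chartL L x) α (extChartAt (kModel E k) x y)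
      (chartD (kModel E k) x y (Y α)) (chartD (kModel E k) x y w) := by
  rw [Om, LinearMap.sum_apply]
  exact Finset.sum_congr rfl fun α _ => cartanTwo_eq hL hy α _ _

theorem mem_kerAll_iff (u : TK y) : u ∈ kerAll L y ↔
    chartD (kModel E k) x y u ∈ kerL (chartL L x) (extChartAt (kModel E k) x y) := by
  rw [mem_kerL, kerAll, Submodule.mem_iInf]
  refine forall_congr' fun α => ?_
  rw [LinearMap.mem_ker]
  constructor
  · intro h b
    have h1 := LinearMap.congr_fun h (chartDInv (kModel E k) x y b)
    rw [cartanTwo_eq hL hy, chartD_chartDInv hy, omL_apply] at h1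
    rw [omL_apply, ← neg_sub, h1]
    exact neg_zero
  · intro h
    ext w
    rw [cartanTwo_eq hL hy, omL_apply, ← neg_sub, ← omL_apply, h, neg_zero]
    rfl

theorem mem_MAt_iff (u : TK y) : u ∈ MAt L y ↔
    chartD (kModel E k) x y u ∈ ML (chartL L x) (extChartAt (kModel E k) x y) := by
  rw [mem_ML, MAt, Submodule.mem_iInf]
  refine forall_congr' fun α => ?_
  simp only [Submodule.mem_iInf, LinearMap.mem_ker]
  constructor
  · intro h m
    have h1 := h (chartDInv (kModel E k) x y (vin m))
      ((mem_vert_iff hy _).2 (by rw [chartD_chartDInv hy]; rfl))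
    rwa [cartanTwo_eq hL hy, chartD_chartDInv hy] at h1
  · intro h w hw
    rw [cartanTwo_eq hL hy, eq_vin_of_fst_eq_zero ((mem_vert_iff hy w).1 hw), h]

theorem mem_vert_inf_kerAll_iff (u : TK y) : u ∈ vert y ⊓ kerAll L y ↔
    chartD (kModel E k) x y u ∈ KL (chartL L x) (extChartAt (kModel E k) x y) := by
  rw [Submodule.mem_inf, mem_vert_iff hy, mem_kerAll_iff hL hy, mem_KL_iff]

end ChartLagrangian

/-! ### Topology of the total space, as needed for partitions of unity -/

section KTangentTopology

variable {E : Type*} [NormedAddCommGroup E] [NormedSpace ℝ E] {k : ℕ}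
variable {Q : Type*} [TopologicalSpace Q] [ChartedSpace E Q] [IsManifold 𝓘(ℝ, E) ∞ Q]

instance [T2Space Q] : T2Space (KTangent E k Q) := by
  refine ⟨fun x y hxy => ?_⟩
  by_cases hq : x.1 = y.1
  · let e := trivializationAt (Fin k → E) (KTangentSpace E k : Q → Type _) x.1
    have hx : x ∈ e.source := by
      rw [e.mem_source]; exact FiberBundle.mem_baseSet_trivializationAt' x.1
    have hy : y ∈ e.source := by
      rw [e.mem_source, ← hq]; exact FiberBundle.mem_baseSet_trivializationAt' x.1
    obtain ⟨u, v, hu, hv, hxu, hyv, huv⟩ := t2_separation (e.injOn.ne hx hy hxy)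
    refine ⟨e.source ∩ e ⁻¹' u, e.source ∩ e ⁻¹' v,
      e.continuousOn.isOpen_inter_preimage e.open_source hu,
      e.continuousOn.isOpen_inter_preimage e.open_source hv, ⟨hx, hxu⟩, ⟨hy, hyv⟩, ?_⟩
    exact (huv.preimage e).mono inter_subset_right inter_subset_right
  · obtain ⟨u, v, hu, hv, hxu, hyv, huv⟩ := t2_separation hq
    have hc : Continuous (TotalSpace.proj : KTangent E k Q → Q) :=
      FiberBundle.continuous_proj (Fin k → E) (KTangentSpace E k : Q → Type _)
    exact ⟨_, _, hu.preimage hc, hv.preimage hc, hxu, hyv, huv.preimage _⟩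

instance [FiniteDimensional ℝ E] [SecondCountableTopology Q] :
    SigmaCompactSpace (KTangent E k Q) := by
  have h2E : SecondCountableTopology E := have := FiniteDimensional.proper ℝ E; inferInstance
  have h2F : SecondCountableTopology (Fin k → E) := inferInstance
  have h2M : SecondCountableTopology (ModelProd E (Fin k → E)) :=
    inferInstanceAs (SecondCountableTopology (E × (Fin k → E)))
  have hlc : LocallyCompactSpace (ModelProd E (Fin k → E)) := by
    have := FiniteDimensional.proper ℝ E
    exact inferInstanceAs (LocallyCompactSpace (E × (Fin k → E)))
  obtain ⟨s, hs, hsu⟩ := TopologicalSpace.countable_cover_nhds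
    (fun q : Q => chart_source_mem_nhds E q)
  let ι : Q → KTangent E k Q := fun q => ⟨q, 0⟩
  -- A chart domain of the total space is the full preimage of a chart domain of Q, so the charts at
  -- countably many points of the zero section suffice.
  have h1 : ⋃ x ∈ ι '' s, (chartAt (ModelProd E (Fin k → E)) x).source = univ := by
    refine eq_univ_of_forall fun y => ?_
    have hy : y.1 ∈ ⋃ x ∈ s, (chartAt E x).source := hsu ▸ mem_univ _
    simp only [mem_iUnion, exists_prop] at hy
    obtain ⟨q, hq, hyq⟩ := hy
    refine mem_biUnion (mem_image_of_mem ι hq) ?_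
    have : y ∈ (extChartAt (kModel E k) (ι q)).source := by
      rw [kTangent_extChartAt_source]; exact hyq
    rwa [extChartAt_source] at this
  have h3 : SecondCountableTopology (KTangent E k Q) :=
    ChartedSpace.secondCountable_of_countable_cover (ModelProd E (Fin k → E)) h1 (hs.image ι)
  have h4 : LocallyCompactSpace (KTangent E k Q) :=
    ChartedSpace.locallyCompactSpace (ModelProd E (Fin k → E)) _
  exact sigmaCompactSpace_of_locallyCompact_secondCountable

end KTangentTopology

/-! ### Global projections and extensions by partitions of unity -/

section GlobalSections

variable {H : Type*} [NormedAddCommGroup H] [NormedSpace ℝ H] {H' : Type*} [TopologicalSpace H']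
  {I : ModelWithCorners ℝ H H'} {M : Type*} [TopologicalSpace M] [ChartedSpace H' M]

theorem continuousLinearMapAt_trivializationAt_eq_chartD [IsManifold I 1 M] {x y : M}
    (hy : y ∈ (extChartAt I x).source) :
    (trivializationAt H (TangentSpace I : M → Type _) x).continuousLinearMapAt ℝ y =
      chartD I x y := by
  rw [extChartAt_source] at hy
  exact TangentBundle.continuousLinearMapAt_trivializationAt hy

variable [IsManifold I ∞ M]

theorem inCoordinates_tangent_apply [IsManifold I 1 M] {x y : M}
    (hy : y ∈ (extChartAt I x).source) (φ : TangentSpace I y →L[ℝ] TangentSpace I y) (h : H) :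
    ContinuousLinearMap.inCoordinates H (TangentSpace I) H (TangentSpace I) x y x y φ h =
      chartD I x y (φ (chartDInv I x y h)) := by
  have h1 := continuousLinearMapAt_trivializationAt_eq_chartD hy
  have hyb : y ∈ (trivializationAt H (TangentSpace I : M → Type _) x).baseSet := by
    rwa [extChartAt_source] at hy
  have h2 : (trivializationAt H (TangentSpace I : M → Type _) x).symmL ℝ y h =
      chartDInv I x y h := by
    apply chartD_injective hy
    rw [chartD_chartDInv hy, ← h1]
    exact (trivializationAt H (TangentSpace I : M → Type _) x).continuousLinearMapAt_symmL hyb h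
  rw [← h1, ← h2]
  rfl

variable [FiniteDimensional ℝ H] [T2Space M] [SigmaCompactSpace M]

/-- A family of subspaces of the tangent spaces which has smooth local projections in charts has a
smooth global projection. -/
theorem exists_global_proj [IsManifold I 1 M] {D : (y : M) → Submodule ℝ (TangentSpace I y)}
    (h : ∀ x, ∃ D' : H → Submodule ℝ H, HasLocProj D' (extChartAt I x x) ∧
      ∀ y ∈ (extChartAt I x).source, ∀ u : TangentSpace I y,
        u ∈ D y ↔ chartD I x y u ∈ D' (extChartAt I x y)) :
    ∃ P : (y : M) → TangentSpace I y →L[ℝ] TangentSpace I y, (∀ y u, P y u ∈ D y) ∧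
      (∀ y, ∀ u ∈ D y, P y u = u) ∧
      ∀ Z : (y : M) → TangentSpace I y, IsSmoothVF I Z → IsSmoothVF I fun y => P y (Z y) := by
  have : IsManifold I (∞ + 1) M := inferInstanceAs (IsManifold I ∞ M)
  have hb := TangentBundle.contMDiffVectorBundle (I := I) (M := M) (n := ∞)
  -- Linear maps into D y that fix D y form a convex set, so local smooth projections can be
  -- averaged.
  have key := exists_contMDiffSection_forall_mem_convex_of_local (n := (⊤ : ℕ∞)) I
    (F_fiber := H →L[ℝ] H) (fun y : M => TangentSpace I y →L[ℝ] TangentSpace I y)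
    (fun y => {P | (∀ u, P u ∈ D y) ∧ ∀ u ∈ D y, P u = u})
  refine Exists.elim (key ?_ ?_) fun s hs => ?_
  rotate_left 2
  · refine ⟨fun y => s y, fun y => (hs y).1, fun y => (hs y).2, fun Z hZ => ?_⟩
    exact ContMDiff.clm_bundle_apply (b := id) s.contMDiff hZ
  · intro y P₁ h₁ P₂ h₂ a b _ _ hab
    refine ⟨fun u => ?_, fun u hu => ?_⟩
    · exact (D y).add_mem ((D y).smul_mem _ (h₁.1 u)) ((D y).smul_mem _ (h₂.1 u))
    · change a • P₁ u + b • P₂ u = u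
      rw [h₁.2 u hu, h₂.2 u hu, ← add_smul, hab, one_smul]
  · intro x
    obtain ⟨D', ⟨U, hU, hxU, P, hP, hPD, hPi⟩, hD⟩ := h x
    have hW : IsOpen ((extChartAt I x).source ∩ extChartAt I x ⁻¹' U) :=
      (continuousOn_extChartAt x).isOpen_inter_preimage (isOpen_extChartAt_source x) hU
    set W := (extChartAt I x).source ∩ extChartAt I x ⁻¹' U with hWdef
    refine ⟨W, hW.mem_nhds ⟨mem_extChartAt_source x, hxU⟩,
      fun y => (chartDInv I x y).comp ((P (extChartAt I x y)).comp (chartD I x y)), ?_, ?_⟩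
    · have hsub : W ⊆ (trivializationAt (H →L[ℝ] H)
          (fun y : M => TangentSpace I y →L[ℝ] TangentSpace I y) x).baseSet := by
        intro y hy
        have hy1 : y ∈ (chartAt H' x).source := by rw [← extChartAt_source I]; exact hy.1
        exact ⟨hy1, hy1⟩
      refine ((trivializationAt (H →L[ℝ] H)
        (fun y : M => TangentSpace I y →L[ℝ] TangentSpace I y) x).contMDiffOn_section_iff
        (IB := I) hW hsub).2 ?_
      have h1 : ContMDiffOn I 𝓘(ℝ, H →L[ℝ] H) ∞ (fun y => P (extChartAt I x y)) W := by
        refine hP.contMDiffOn.comp ?_ fun y hy => hy.2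
        refine contMDiffOn_extChartAt.mono fun y hy => ?_
        rw [← extChartAt_source I]; exact hy.1
      refine h1.congr fun y hy => ?_
      rw [hom_trivializationAt_apply]
      refine ContinuousLinearMap.ext fun h => ?_
      refine (inCoordinates_tangent_apply hy.1 _ h).trans ?_
      change chartD I x y (chartDInv I x y (P (extChartAt I x y)
        (chartD I x y (chartDInv I x y h)))) = _
      rw [chartD_chartDInv hy.1, chartD_chartDInv hy.1]
    · intro y hy
      refine ⟨fun u => ?_, fun u hu => ?_⟩
      · refine (hD y hy.1 _).2 ?_
        change chartD I x y (chartDInv I x y (P (extChartAt I x y) (chartD I x y u))) ∈ _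
        rw [chartD_chartDInv hy.1]
        exact hPD _ hy.2 _
      · change chartDInv I x y (P (extChartAt I x y) (chartD I x y u)) = u
        rw [hPi _ hy.2 _ ((hD y hy.1 u).1 hu), chartDInv_chartD hy.1]

/-- Every tangent vector extends to a smooth vector field. -/
theorem exists_isSmoothVF_extension [IsManifold I 1 M] (x : M) (u : TangentSpace I x) :
    ∃ Z : (y : M) → TangentSpace I y, IsSmoothVF I Z ∧ Z x = u := by
  have : IsManifold I (∞ + 1) M := inferInstanceAs (IsManifold I ∞ M)
  have hb := TangentBundle.contMDiffVectorBundle (I := I) (M := M) (n := ∞)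
  -- The constraint on the section is a single point over x and empty elsewhere. Near x a field with
  -- constant coordinates satisfies it, and away from x the zero field does.
  have key := exists_contMDiffSection_forall_mem_convex_of_local (n := (⊤ : ℕ∞)) I
    (F_fiber := H) (fun y : M => TangentSpace I y) (fun y => {v | ∀ h : y = x, v = h ▸ u})
  refine Exists.elim (key ?_ ?_) fun s hs => ?_
  rotate_left 2
  · exact ⟨fun y => s y, s.contMDiff, hs x rfl⟩
  · rintro y v₁ h₁ v₂ h₂ a b _ _ hab rfl
    rw [h₁ rfl, h₂ rfl]
    exact (add_smul a b u).symm.trans (by rw [hab, one_smul])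
  · intro y
    by_cases hy : y = x
    · subst hy
      refine ⟨(extChartAt I y).source, extChartAt_source_mem_nhds y,
        fun z => chartDInv I y z (chartD I y y u), ?_, ?_⟩
      · refine (contMDiffOn_vf_iff I (isOpen_extChartAt_source y) subset_rfl).2 ?_
        have h1 : ContMDiffOn I 𝓘(ℝ, H) ∞ (fun _ => chartD I y y u) (extChartAt I y).source :=
          contMDiffOn_const
        exact h1.congr fun z hz => chartD_chartDInv hz _
      · rintro z hz rfl
        exact chartDInv_chartD hz _
    · refine ⟨{x}ᶜ, isOpen_compl_singleton.mem_nhds hy, fun _ => 0, ?_, fun z hz h => absurd h hz⟩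
      exact (ContMDiff.contMDiffOn (contMDiff_zeroSection ℝ (TangentSpace I : M → Type _)))

end GlobalSections

/-! ### The Legendre transformation and the rank of its tangent map -/

section Legendre

variable {H : Type*} [NormedAddCommGroup H] [NormedSpace ℝ H] {H' : Type*} [TopologicalSpace H']
  {I : ModelWithCorners ℝ H H'} {M : Type*} [TopologicalSpace M] [ChartedSpace H' M]

theorem IsTangentTo.map {G : Type*} [NormedAddCommGroup G] [NormedSpace ℝ G] {G' : Type*}
    [TopologicalSpace G'] {J : ModelWithCorners ℝ G G'} {N : Type*} [TopologicalSpace N]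
    [ChartedSpace G' N] {f : M → N} (hf : ContMDiff I J ∞ f) {S : Set M} {T : Set N}
    (hST : MapsTo f S T) {x : M} {u : TangentSpace I x} (hu : IsTangentTo I S x u) :
    IsTangentTo J T (f x) (mfderiv I J f x u) := by
  obtain ⟨γ, hγ, hγS, hγu⟩ := hu
  refine ⟨f ∘ γ, hf.contMDiffAt.comp 0 hγ, hγS.mono fun t ht => hST ht, ?_⟩
  have h1 := mfderiv_comp_apply (0 : ℝ) (hf.mdifferentiableAt (by simp) (x := γ 0))
    (hγ.mdifferentiableAt (by simp)) (1 : ℝ)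
  rw [h1]
  exact congrArg (fun p : TangentBundle I M => (⟨f p.1, mfderiv I J f p.1 p.2⟩ : TangentBundle J N))
    hγu

theorem isTangentTo_univ [FiniteDimensional ℝ H] [I.Boundaryless] [IsManifold I ∞ M] (x : M)
    (u : TangentSpace I x) : IsTangentTo I univ x u :=
  (isTangentTo_iff (IsManifold.chart_mem_maximalAtlas x) (W := ⊤) (fun _ _ => by simp)
    (mem_chart_source H' x) (mem_univ x) u).2
      (Submodule.mem_top (R := ℝ) (M := H))

/-- A submersion onto an embedded submanifold has locally constant rank. -/
theorem finrank_ker_mfderiv_eventually [FiniteDimensional ℝ H] [I.Boundaryless] [IsManifold I ∞ M]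
    {G : Type*} [NormedAddCommGroup G] [NormedSpace ℝ G] [FiniteDimensional ℝ G] {G' : Type*}
    [TopologicalSpace G'] {J : ModelWithCorners ℝ G G'} [J.Boundaryless] {N : Type*}
    [TopologicalSpace N] [ChartedSpace G' N] {f : M → N} (hf : ContMDiff I J ∞ f)
    (hS : IsEmbeddedSubmanifold J (range f))
    (hsub : ∀ (x : M) (u : TangentSpace J (f x)), IsTangentTo J (range f) (f x) u →
      ∃ w : TangentSpace I x, mfderiv I J f x w = u) (x : M) :
    ∀ᶠ y in 𝓝 x, Module.finrank ℝ (LinearMap.ker (mfderiv I J f y).toLinearMap) =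
      Module.finrank ℝ (LinearMap.ker (mfderiv I J f x).toLinearMap) := by
  obtain ⟨φ, hφ, hxφ, W, hW⟩ := hS (f x) (mem_range_self x)
  -- In an adapted chart for the image, the range of the differential is exactly the model subspace
  -- W at all nearby points; rank-nullity then fixes the kernel dimension.
  suffices h : ∀ y, f y ∈ φ.source → Module.finrank ℝ W +
      Module.finrank ℝ (LinearMap.ker (mfderiv I J f y).toLinearMap) = Module.finrank ℝ H by
    filter_upwards [hf.continuous.continuousAt.preimage_mem_nhds (φ.open_source.mem_nhds hxφ)]
      with y hy
    have h1 := h y hy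
    have h2 := h x hxφ
    omega
  intro y hy
  have hinj := mfderiv_extend_injective hφ hy
  let A : TangentSpace I y →ₗ[ℝ] G :=
    (mfderiv J 𝓘(ℝ, G) (φ.extend J) (f y)).toLinearMap.comp (mfderiv I J f y).toLinearMap
  have hrange : LinearMap.range A = W := by
    apply le_antisymm
    · rintro _ ⟨w, rfl⟩
      exact (isTangentTo_iff hφ hW hy (mem_range_self y) _).1
        ((isTangentTo_univ y w).map hf fun z _ => mem_range_self z)
    · intro c hc
      have hsurj : Function.Surjective (mfderiv J 𝓘(ℝ, G) (φ.extend J) (f y)) :=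
        let B : G →ₗ[ℝ] G := (mfderiv J 𝓘(ℝ, G) (φ.extend J) (f y)).toLinearMap
        LinearMap.surjective_of_injective (f := B) hinj
      obtain ⟨u, hu⟩ := hsurj c
      obtain ⟨w, hw⟩ := hsub y u
        ((isTangentTo_iff hφ hW hy (mem_range_self y) u).2 (by rw [hu]; exact hc))
      refine ⟨w, ?_⟩
      rw [← hu, ← hw]
      rfl
  have hkerA : LinearMap.ker A = LinearMap.ker (mfderiv I J f y).toLinearMap := by
    refine Submodule.ext fun w => ⟨fun h => ?_, fun h => ?_⟩
    · exact hinj (Eq.trans h (map_zero _).symm)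
    · change mfderiv J 𝓘(ℝ, G) (φ.extend J) (f y) (mfderiv I J f y w) = 0
      have h' : mfderiv I J f y w = 0 := h
      rw [h']; exact map_zero _
  have : FiniteDimensional ℝ (TangentSpace I y) := inferInstanceAs (FiniteDimensional ℝ H)
  have h1 := LinearMap.finrank_range_add_finrank_ker A
  rw [hrange, hkerA] at h1
  exact h1

variable {E : Type*} [NormedAddCommGroup E] [NormedSpace ℝ E] {k : ℕ}
variable {Q : Type*} [TopologicalSpace Q] [ChartedSpace E Q] [IsManifold 𝓘(ℝ, E) ∞ Q]

variable {L : KTangent E k Q → ℝ} (hL : ContMDiff (kModel E k) 𝓘(ℝ, ℝ) ∞ L)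

include hL

theorem inCoordinates_legendre {x y : KTangent E k Q}
    (hy : y ∈ (extChartAt (kModel E k) x).source) :
    ContinuousLinearMap.inCoordinates (Fin k → E) (KTangentSpace E k : Q → Type _) ℝ
      (Bundle.Trivial Q ℝ) x.1 y.1 x.1 y.1 (legendre L y).2 =
      (fderiv ℝ (chartL L x) (extChartAt (kModel E k) x y)).comp vin := by
  refine ContinuousLinearMap.ext fun m => ?_
  have hyb : y.1 ∈ (trivializationAt (Fin k → E) (KTangentSpace E k : Q → Type _) x.1).baseSet := by
    rw [kTangent_extChartAt_source] at hy; exact hy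
  have hyc : y.1 ∈ (chartAt E x.1).source := hyb
  set e := trivializationAt (Fin k → E) (KTangentSpace E k : Q → Type _) x.1 with he
  have h1 : fibreD E k x.1 y.1 (e.symmL ℝ y.1 m) = m := by
    rw [← kTangent_trivializationAt_snd ⟨y.1, e.symmL ℝ y.1 m⟩ hyc]
    have := e.continuousLinearMapAt_symmL (R := ℝ) hyb m
    rwa [Trivialization.continuousLinearMapAt_apply,
      Trivialization.coe_linearMapAt_of_mem _ hyb] at this
  have h2 := dAt_eq (kModel E k) hy (hL.mdifferentiableAt (by simp))
    (vertLift y (e.symmL ℝ y.1 m))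
  rw [chartD_vertLift hy, h1] at h2
  rw [ContinuousLinearMap.comp_apply, ContinuousLinearMap.inr_apply]
  refine Eq.trans ?_ h2
  have h3 := Bundle.Trivial.continuousLinearMapAt_trivialization ℝ Q ℝ y.1
  exact DFunLike.congr_fun h3 ((legendre L y).2 (e.symmL ℝ y.1 m))

theorem contMDiff_legendre : ContMDiff (kModel E k) (kCoModel E k) ∞ (legendre L) := by
  intro x
  refine (contMDiffAt_hom_bundle _).2 ⟨contMDiffAt_proj _, ?_⟩
  have h1 : ContMDiffOn (kModel E k) 𝓘(ℝ, (Fin k → E) →L[ℝ] ℝ) ∞ (fun y =>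
      (fderiv ℝ (chartL L x) (extChartAt (kModel E k) x y)).comp vin)
      (extChartAt (kModel E k) x).source := by
    have h2 : ContDiffOn ℝ ∞ (fun z => (fderiv ℝ (chartL L x) z).comp (vin (E := E) (k := k)))
        (tgt E k x) :=
      ((contDiffOn_chartL hL x).fderiv_infty (isOpen_tgt x)).clm_comp contDiffOn_const
    refine h2.contMDiffOn.comp ?_ (extChartAt (kModel E k) x).mapsTo
    rw [extChartAt_source]
    exact contMDiffOn_extChartAt
  exact (h1.congr fun y hy => inCoordinates_legendre hL hy).contMDiffAt
    (extChartAt_source_mem_nhds x)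

theorem extChartAt_legendre {x y : KTangent E k Q}
    (hy : y ∈ (extChartAt (kModel E k) x).source) :
    legendre L y ∈ (extChartAt (kCoModel E k) (legendre L x)).source ∧
    extChartAt (kCoModel E k) (legendre L x) (legendre L y) =
      ((extChartAt (kModel E k) x y).1,
        (fderiv ℝ (chartL L x) (extChartAt (kModel E k) x y)).comp vin) := by
  have hyc : y.1 ∈ (chartAt E x.1).source := by
    rw [kTangent_extChartAt_source] at hy; exact hy
  constructor
  · rw [FiberBundle.extChartAt]
    have hb : (trivializationAt ((Fin k → E) →L[ℝ] ℝ) (KCotangentSpace E k Q) x.1).baseSet =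
      (chartAt E x.1).source ∩ univ := rfl
    simp [PartialEquiv.trans_source, hb, legendre, hyc]
    exact hyc
  · rw [← inCoordinates_legendre hL hy, kTangent_extChartAt_apply hy]
    have := hom_chart (HB := E) (legendre L x) (legendre L y)
    rw [extChartAt_coe, Function.comp_apply, this]
    rfl

/-- In coordinates the Legendre map is (q, v) ↦ (q, ∂l/∂v), with differential `fibreHess`. This
identifies the kernel of its tangent map with the vertical characteristic vectors. -/
theorem mfderiv_legendre_eq_zero_iff {x y : KTangent E k Q}
    (hy : y ∈ (extChartAt (kModel E k) x).source) (w : TK y) :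
    mfderiv (kModel E k) (kCoModel E k) (legendre L) y w = 0 ↔
      chartD (kModel E k) x y w ∈ KL (chartL L x) (extChartAt (kModel E k) x y) := by
  have hzt : extChartAt (kModel E k) x y ∈ tgt E k x := (extChartAt (kModel E k) x).map_source hy
  have hF := (contMDiff_legendre hL).mdifferentiableAt (x := y) (by simp)
  have hFy := (extChartAt_legendre hL hy).1
  let g : KVec E k → E × ((Fin k → E) →L[ℝ] ℝ) := fun z =>
    (z.1, (fderiv ℝ (chartL L x) z).comp vin)
  have hg : HasFDerivAt g (fibreHess (chartL L x) (extChartAt (kModel E k) x y))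
      (extChartAt (kModel E k) x y) := by
    have h1 := ((contDiffOn_chartL hL x).fderiv_infty (isOpen_tgt x)).hasFDerivAt_infty
      (isOpen_tgt x) hzt
    exact (ContinuousLinearMap.fst ℝ E (Fin k → E)).hasFDerivAt.prodMk
      (((ContinuousLinearMap.compL ℝ (Fin k → E) (KVec E k) ℝ).flip vin).hasFDerivAt.comp _ h1)
  have h2 : extChartAt (kCoModel E k) (legendre L x) ∘ legendre L =ᶠ[𝓝 y]
      g ∘ extChartAt (kModel E k) x := by
    filter_upwards [(isOpen_extChartAt_source x).mem_nhds hy] with w hw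
      using (extChartAt_legendre hL hw).2
  have h3 := mfderiv_comp_apply y (mdifferentiableAt_extChartAt_infty hFy) hF w
  have h4 := mfderiv_comp_apply y (hg.differentiableAt.mdifferentiableAt)
    (mdifferentiableAt_extChartAt_infty hy) w
  rw [mfderiv_eq_fderiv, hg.fderiv] at h4
  have h5 := DFunLike.congr_fun (h2.mfderiv_eq (I := kModel E k)
    (I' := 𝓘(ℝ, E × ((Fin k → E) →L[ℝ] ℝ)))) w
  have h6 : chartD (kCoModel E k) (legendre L x) (legendre L y)
      (mfderiv (kModel E k) (kCoModel E k) (legendre L) y w) =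
      fibreHess (chartL L x) (extChartAt (kModel E k) x y) (chartD (kModel E k) x y w) :=
    h3.symm.trans (h5.trans h4)
  rw [KL, LinearMap.mem_ker]
  refine ⟨fun h => ?_, fun h => ?_⟩
  · refine h6.symm.trans ?_
    rw [h]; exact ContinuousLinearMap.map_zero _
  · refine chartD_injective hFy (h6.trans (Eq.trans h (ContinuousLinearMap.map_zero _).symm))

/-- The fibres of the tangent map of an almost-regular Legendre transformation have locally
constant dimension. -/
theorem IsAlmostRegular.finrank_vert_inf_kerAll [FiniteDimensional ℝ E] (hreg : IsAlmostRegular L)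
    (x : KTangent E k Q) : ∀ᶠ y in 𝓝 x,
      Module.finrank ℝ ↥(vert y ⊓ kerAll L y) = Module.finrank ℝ ↥(vert x ⊓ kerAll L x) := by
  have h : ∀ y, vert y ⊓ kerAll L y =
      LinearMap.ker (mfderiv (kModel E k) (kCoModel E k) (legendre L) y).toLinearMap := by
    intro y
    have hys := mem_extChartAt_source (I := kModel E k) y
    refine Submodule.ext fun w => ?_
    rw [mem_vert_inf_kerAll_iff hL hys, ← mfderiv_legendre_eq_zero_iff hL hys]
    rfl
  filter_upwards [finrank_ker_mfderiv_eventually (contMDiff_legendre hL) hreg.image_closed.2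
    hreg.submersion x] with y hy
  rw [h y, h x]
  exact hy

end Legendre

/-! ### Local projections for the Lagrangian distributions -/

section ConstantRank

variable {E : Type*} [NormedAddCommGroup E] [NormedSpace ℝ E] {k : ℕ}
variable {Q : Type*} [TopologicalSpace Q] [ChartedSpace E Q] [IsManifold 𝓘(ℝ, E) ∞ Q]

variable (E k) in
/-- The vertical vectors in the model space. -/
def vertM : Submodule ℝ (KVec E k) := LinearMap.ker (LinearMap.fst ℝ E (Fin k → E))

theorem mem_vertM {h : KVec E k} : h ∈ vertM E k ↔ h.1 = 0 := LinearMap.mem_ker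

theorem finrank_eventually_of_mem_iff {D : (y : KTangent E k Q) → Submodule ℝ (TK y)}
    {D' : KVec E k → Submodule ℝ (KVec E k)} {x : KTangent E k Q}
    (h : ∀ y ∈ (extChartAt (kModel E k) x).source, ∀ u : TK y,
      u ∈ D y ↔ chartD (kModel E k) x y u ∈ D' (extChartAt (kModel E k) x y))
    (hD : ∀ y, ∀ᶠ y' in 𝓝 y, Module.finrank ℝ (D y') = Module.finrank ℝ (D y))
    {p : KVec E k} (hp : p ∈ tgt E k x) :
    ∀ᶠ q in 𝓝 p, Module.finrank ℝ (D' q) = Module.finrank ℝ (D' p) := by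
  have h1 : ∀ q ∈ tgt E k x, Module.finrank ℝ (D' q) =
      Module.finrank ℝ (D ((extChartAt (kModel E k) x).symm q)) := by
    intro q hq
    have hy := (extChartAt (kModel E k) x).map_target hq
    rw [finrank_eq_of_mem_iff hy (h _ hy), (extChartAt (kModel E k) x).right_inv hq]
  have h2 : ContinuousAt (extChartAt (kModel E k) x).symm p := continuousAt_extChartAt_symm'' hp
  filter_upwards [(isOpen_tgt x).mem_nhds hp, h2.eventually (hD _)] with q hq hq2
  rw [h1 q hq, h1 p hp, hq2]

theorem hasLocProj_vertM (p : KVec E k) : HasLocProj (fun _ => vertM E k) p :=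
  hasLocProj_const _ ((vin (E := E)).comp (ContinuousLinearMap.snd ℝ E (Fin k → E)))
    (fun _ => mem_vertM.2 rfl) (fun _ hh => (eq_vin_of_fst_eq_zero (mem_vertM.1 hh)).symm) p

variable {L : KTangent E k Q → ℝ} (hL : ContMDiff (kModel E k) 𝓘(ℝ, ℝ) ∞ L)

include hL

theorem mem_vert_sup_kerAll_iff {x y : KTangent E k Q}
    (hy : y ∈ (extChartAt (kModel E k) x).source) (u : TK y) : u ∈ vert y ⊔ kerAll L y ↔
      chartD (kModel E k) x y u ∈ vertM E k ⊔ kerL (chartL L x) (extChartAt (kModel E k) x y) := by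
  simp only [Submodule.mem_sup]
  constructor
  · rintro ⟨v, hv, w, hw, rfl⟩
    exact ⟨_, mem_vertM.2 ((mem_vert_iff hy v).1 hv), _, (mem_kerAll_iff hL hy w).1 hw,
      (map_add _ _ _).symm⟩
  · rintro ⟨v, hv, w, hw, hvw⟩
    refine ⟨chartDInv (kModel E k) x y v, (mem_vert_iff hy _).2 ?_,
      chartDInv (kModel E k) x y w, (mem_kerAll_iff hL hy _).2 ?_, chartD_injective hy ?_⟩
    · rw [chartD_chartDInv hy]; exact mem_vertM.1 hv
    · rwa [chartD_chartDInv hy]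
    · rw [map_add, chartD_chartDInv hy, chartD_chartDInv hy, hvw]

section

variable (hK : ∀ x, ∀ᶠ y in 𝓝 x,
  Module.finrank ℝ ↥(vert y ⊓ kerAll L y) = Module.finrank ℝ ↥(vert x ⊓ kerAll L x))

include hK

theorem finrank_KL_eventually {x : KTangent E k Q} {p : KVec E k} (hp : p ∈ tgt E k x) :
    ∀ᶠ q in 𝓝 p, Module.finrank ℝ (KL (chartL L x) q) = Module.finrank ℝ (KL (chartL L x) p) :=
  finrank_eventually_of_mem_iff (fun _ hy => mem_vert_inf_kerAll_iff hL hy) hK hp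

theorem hasLocProj_KL [FiniteDimensional ℝ E] {x : KTangent E k Q} {p : KVec E k} (hp : p ∈ tgt E k x) :
    HasLocProj (KL (chartL L x)) p :=
  hasLocProj_ker (isOpen_tgt x) hp (contDiffOn_fibreHess (isOpen_tgt x) (contDiffOn_chartL hL x))
    (finrank_KL_eventually hL hK hp)

end

theorem finrank_kerL_eventually
    (hker : IsLocallyConstant fun x => Module.finrank ℝ (kerAll L x))
    {x : KTangent E k Q} {p : KVec E k} (hp : p ∈ tgt E k x) :
    ∀ᶠ q in 𝓝 p, Module.finrank ℝ (kerL (chartL L x) q) = Module.finrank ℝ (kerL (chartL L x) p) :=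
  finrank_eventually_of_mem_iff (fun _ hy => mem_kerAll_iff hL hy)
    (fun y => hker.eventually_eq y) hp

theorem hasLocProj_kerL [FiniteDimensional ℝ E] (hker : IsLocallyConstant fun x => Module.finrank ℝ (kerAll L x))
    {x : KTangent E k Q} {p : KVec E k} (hp : p ∈ tgt E k x) :
    HasLocProj (kerL (chartL L x)) p :=
  hasLocProj_ker (isOpen_tgt x) hp
    (contDiffOn_contractions (isOpen_tgt x) (contDiffOn_chartL hL x))
    (finrank_kerL_eventually hL hker hp)

theorem hasLocProj_ML [FiniteDimensional ℝ E] (hM : IsLocallyConstant fun x => Module.finrank ℝ (MAt L x))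
    {x : KTangent E k Q} {p : KVec E k} (hp : p ∈ tgt E k x) :
    HasLocProj (ML (chartL L x)) p :=
  hasLocProj_ker (isOpen_tgt x) hp
    (contDiffOn_vertContractions (isOpen_tgt x) (contDiffOn_chartL hL x))
    (finrank_eventually_of_mem_iff (fun _ hy => mem_MAt_iff hL hy) (fun y => hM.eventually_eq y) hp)

theorem hasLocProj_sup [FiniteDimensional ℝ E] (hK : ∀ x, ∀ᶠ y in 𝓝 x,
      Module.finrank ℝ ↥(vert y ⊓ kerAll L y) = Module.finrank ℝ ↥(vert x ⊓ kerAll L x))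
    (hker : IsLocallyConstant fun x => Module.finrank ℝ (kerAll L x))
    {x : KTangent E k Q} {p : KVec E k} (hp : p ∈ tgt E k x) :
    HasLocProj (fun p => vertM E k ⊔ kerL (chartL L x) p) p := by
  refine (hasLocProj_vertM p).sup (hasLocProj_kerL hL hker hp) ?_
  -- The dimension formula for sums and intersections makes the rank of the sum locally constant,
  -- since the intersection is `KL`.
  have h1 : ∀ q, Module.finrank ℝ ↥(vertM E k ⊔ kerL (chartL L x) q) +
      Module.finrank ℝ (KL (chartL L x) q) = Module.finrank ℝ (vertM E k) +
      Module.finrank ℝ (kerL (chartL L x) q) := by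
    intro q
    have h2 : KL (chartL L x) q = vertM E k ⊓ kerL (chartL L x) q := Submodule.ext fun a => by
      rw [mem_KL_iff, Submodule.mem_inf, mem_vertM]
    rw [h2]
    exact Submodule.finrank_sup_add_finrank_inf_eq _ _
  filter_upwards [finrank_kerL_eventually hL hker hp, finrank_KL_eventually hL hK hp] with q h2 h3
  have h4 := h1 q
  have h5 := h1 p
  omega

end ConstantRank

/-! ### Solvability of the Lagrangian equation -/

section Solvability

variable {E : Type*} [NormedAddCommGroup E] [NormedSpace ℝ E] {k : ℕ}
variable {Q : Type*} [TopologicalSpace Q] [ChartedSpace E Q] [IsManifold 𝓘(ℝ, E) ∞ Q]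

variable {L : KTangent E k Q → ℝ}

theorem mem_MAt {x : KTangent E k Q} {u : TK x} :
    u ∈ MAt L x ↔ ∀ α, ∀ w ∈ vert x, cartanTwo L α x w u = 0 := by
  simp only [MAt, Submodule.mem_iInf, LinearMap.mem_ker]

theorem om_apply {x : KTangent E k Q} (Y : Fin k → TK x) (w : TK x) :
    Om L x Y w = ∑ α, cartanTwo L α x (Y α) w := by
  rw [Om, LinearMap.sum_apply]

theorem om_single {x : KTangent E k Q} (α : Fin k) (u w : TK x) :
    Om L x (Pi.single α u) w = cartanTwo L α x u w := by
  rw [om_apply, Finset.sum_eq_single α]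
  · rw [Pi.single_eq_same]
  · intro β _ hβ
    rw [Pi.single_eq_of_ne hβ, map_zero]; rfl
  · intro h; exact absurd (Finset.mem_univ α) h

variable (hL : ContMDiff (kModel E k) 𝓘(ℝ, ℝ) ∞ L)

include hL

theorem cartanTwo_antisymm (α : Fin k) {x : KTangent E k Q} (u w : TK x) :
    cartanTwo L α x u w = - cartanTwo L α x w u := by
  rw [cartanTwo_eq hL (mem_extChartAt_source x), cartanTwo_eq hL (mem_extChartAt_source x),
    omL_apply, omL_apply, neg_sub]

theorem mem_kerAll {x : KTangent E k Q} {u : TK x} :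
    u ∈ kerAll L x ↔ ∀ α w, cartanTwo L α x w u = 0 := by
  rw [kerAll, Submodule.mem_iInf]
  refine forall_congr' fun α => ⟨fun h w => ?_, fun h => ?_⟩
  · rw [cartanTwo_antisymm hL, LinearMap.mem_ker.1 h]; exact neg_zero
  · refine LinearMap.mem_ker.2 (LinearMap.ext fun w => ?_)
    rw [cartanTwo_antisymm hL, h]; exact neg_zero

/-- The Lagrangian equation is solvable at `x` iff the differential of the energy annihilates the
characteristic subspace. -/
theorem mem_P1_iff [FiniteDimensional ℝ E] {x : KTangent E k Q} :
    x ∈ P1 L ↔ ∀ u ∈ kerAll L x, dAt (kModel E k) (energy L) x u = 0 := by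
  constructor
  · rintro ⟨Y, hY⟩ u hu
    have h1 := LinearMap.congr_fun hY u
    rw [om_apply] at h1
    refine h1.symm.trans (Finset.sum_eq_zero fun α _ => (mem_kerAll hL).1 hu α _)
  · intro h
    have : FiniteDimensional ℝ (TK x) := inferInstanceAs (FiniteDimensional ℝ (E × (Fin k → E)))
    let Φ : (Fin k → TK x) →ₗ[ℝ] Module.Dual ℝ (TK x) :=
      ∑ α, (cartanTwo L α x).comp (LinearMap.proj α)
    have hΦ : ∀ Y, Φ Y = Om L x Y := by
      intro Y
      simp only [Φ, LinearMap.sum_apply, Om]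
      rfl
    -- The range of Ω is the annihilator of its coannihilator. Testing with k-vectors having a
    -- single nonzero entry shows that the coannihilator lies in the characteristic subspace.
    have h1 : (dAt (kModel E k) (energy L) x).toLinearMap ∈ LinearMap.range Φ := by
      rw [← Subspace.dualCoannihilator_dualAnnihilator_eq (W := LinearMap.range Φ),
        Submodule.mem_dualAnnihilator]
      intro u hu
      refine h u ((mem_kerAll hL).2 fun α w => ?_)
      rw [← om_single, ← hΦ]
      exact (Submodule.mem_dualCoannihilator u).1 hu _ (LinearMap.mem_range_self _ _)
    obtain ⟨Y, hY⟩ := h1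
    exact ⟨Y, (hΦ Y).symm.trans hY⟩

end Solvability

/-! ### Vertical characteristic vectors are tangent to P₁ -/

section Tangency

variable {H : Type*} [NormedAddCommGroup H] [NormedSpace ℝ H] {H' : Type*} [TopologicalSpace H']
  {I : ModelWithCorners ℝ H H'} [I.Boundaryless] {M : Type*} [TopologicalSpace M]
  [ChartedSpace H' M] [IsManifold I ∞ M]

/-- A smooth curve in a chart gives a tangent vector. -/
theorem isTangentTo_of_chart_curve {S : Set M} {x : M} {u : TangentSpace I x} {c : ℝ → H}
    (hc0 : c 0 = extChartAt I x x) (hc : ContDiffAt ℝ ∞ c 0)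
    (hcu : HasDerivAt c (chartD I x x u) 0)
    (hcS : ∀ᶠ t in 𝓝 (0 : ℝ), (extChartAt I x).symm (c t) ∈ S) : IsTangentTo I S x u := by
  have ht : c 0 ∈ (extChartAt I x).target := hc0 ▸ mem_extChartAt_target x
  have hs : ContMDiffAt 𝓘(ℝ, H) I ∞ (extChartAt I x).symm (c 0) :=
    (contMDiffOn_extChartAt_symm x).contMDiffAt ((isOpen_extChartAt_target x).mem_nhds ht)
  have hγ : ContMDiffAt 𝓘(ℝ, ℝ) I ∞ (fun t => (extChartAt I x).symm (c t)) 0 :=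
    hs.comp 0 hc.contMDiffAt
  refine ⟨fun t => (extChartAt I x).symm (c t), hγ, hcS, ?_⟩
  have h0 : (extChartAt I x).symm (c 0) = x := by rw [hc0, extChartAt_to_inv]
  have h1 : ∀ y (hy : y = x) (v : TangentSpace I y), chartD I x y v = chartD I x x u →
      (⟨y, v⟩ : TangentBundle I M) = ⟨x, u⟩ := by
    rintro y rfl v hv
    rw [chartD_injective (mem_extChartAt_source y) hv]
  refine h1 _ h0 _ ?_
  have h2 := chartD_mfderiv (I := I) (x := x) (y := (extChartAt I x).symm (c 0))
    ((extChartAt I x).map_target ht) (hγ.mdifferentiableAt (by simp)) rfl (1 : ℝ)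
  refine h2.trans ?_
  have h3 : extChartAt I x ∘ (fun t => (extChartAt I x).symm (c t)) =ᶠ[𝓝 0] c := by
    filter_upwards [hc.continuousAt.preimage_mem_nhds ((isOpen_extChartAt_target x).mem_nhds ht)]
      with t ht using (extChartAt I x).right_inv ht
  rw [h3.fderiv_eq]
  exact fderiv_apply_one_eq_deriv.trans hcu.deriv

variable {E : Type*} [NormedAddCommGroup E] [NormedSpace ℝ E] [FiniteDimensional ℝ E] {k : ℕ}
variable {Q : Type*} [TopologicalSpace Q] [ChartedSpace E Q] [IsManifold 𝓘(ℝ, E) ∞ Q]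

/-- The vertical characteristic vectors are tangent to `P₁`. -/
theorem isTangentTo_P1 {L : KTangent E k Q → ℝ} (hL : ContMDiff (kModel E k) 𝓘(ℝ, ℝ) ∞ L)
    (hK : ∀ x, ∀ᶠ y in 𝓝 x,
      Module.finrank ℝ ↥(vert y ⊓ kerAll L y) = Module.finrank ℝ ↥(vert x ⊓ kerAll L x))
    (hker : IsLocallyConstant fun x => Module.finrank ℝ (kerAll L x))
    {x : KTangent E k Q} (hx : x ∈ P1 L) {v : TK x} (hv : v ∈ vert x ⊓ kerAll L x) :
    IsTangentTo (kModel E k) (P1 L) x v := by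
  have hxs := mem_extChartAt_source (I := kModel E k) x
  have hxt : extChartAt (kModel E k) x x ∈ tgt E k x := (extChartAt (kModel E k) x).map_source hxs
  have h0 : ∀ h ∈ kerL (chartL L x) (extChartAt (kModel E k) x x),
      fderiv ℝ (enL (chartL L x)) (extChartAt (kModel E k) x x) h = 0 := by
    intro h hh
    have h1 := (mem_P1_iff hL).1 hx (chartDInv (kModel E k) x x h)
      ((mem_kerAll_iff hL hxs _).2 (by rwa [chartD_chartDInv hxs]))
    rwa [dAt_energy_eq hL hxs, chartD_chartDInv hxs] at h1
  obtain ⟨c, hc0, hc, hcv, hcS⟩ := exists_curve_KL (isOpen_tgt x) (contDiffOn_chartL hL x)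
    (fun p hp => hasLocProj_KL hL hK hp) hxt (hasLocProj_kerL hL hker hxt) h0
    ((mem_vert_inf_kerAll_iff hL hxs v).1 hv)
  refine isTangentTo_of_chart_curve hc0 hc hcv ?_
  filter_upwards [hcS] with t ht
  have hy := (extChartAt (kModel E k) x).map_target ht.1
  refine (mem_P1_iff hL).2 fun u hu => ?_
  rw [dAt_energy_eq hL hy, (extChartAt (kModel E k) x).right_inv ht.1]
  refine ht.2 _ ?_
  have := (mem_kerAll_iff hL hy u).1 hu
  rwa [(extChartAt (kModel E k) x).right_inv ht.1] at this

end Tangency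

/-! ### Smoothness of vector fields and of their pairings -/

section Smoothness

variable {H : Type*} [NormedAddCommGroup H] [NormedSpace ℝ H] {H' : Type*} [TopologicalSpace H']
  {I : ModelWithCorners ℝ H H'} {M : Type*} [TopologicalSpace M] [ChartedSpace H' M]

/-- The coordinate expression of a vector field. -/
def vfL (Z : (y : M) → TangentSpace I y) (x : M) (q : H) : H :=
  chartD I x ((extChartAt I x).symm q) (Z ((extChartAt I x).symm q))

theorem vfL_extChartAt (Z : (y : M) → TangentSpace I y) {x y : M}
    (hy : y ∈ (extChartAt I x).source) : vfL Z x (extChartAt I x y) = chartD I x y (Z y) := by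
  rw [vfL, (extChartAt I x).left_inv hy]

theorem IsSmoothVF.add [IsManifold I 1 M] {Z W : (y : M) → TangentSpace I y}
    (hZ : IsSmoothVF I Z) (hW : IsSmoothVF I W) : IsSmoothVF I (Z + W) :=
  ContMDiff.add_section hZ hW

theorem IsSmoothVF.sub [IsManifold I 1 M] {Z W : (y : M) → TangentSpace I y}
    (hZ : IsSmoothVF I Z) (hW : IsSmoothVF I W) : IsSmoothVF I (Z - W) :=
  ContMDiff.sub_section hZ hW

theorem IsSmoothVF.smul [IsManifold I 1 M] {Z : (y : M) → TangentSpace I y}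
    (hZ : IsSmoothVF I Z) (c : ℝ) : IsSmoothVF I (c • Z) :=
  ContMDiff.const_smul_section hZ

theorem isSmoothVF_zero [IsManifold I 1 M] : IsSmoothVF I (fun _ : M => 0) :=
  contMDiff_zeroSection ℝ (TangentSpace I : M → Type _)

variable [IsManifold I ∞ M]

theorem contDiffOn_vfL [IsManifold I 1 M] [I.Boundaryless] {Z : (y : M) → TangentSpace I y}
    (hZ : IsSmoothVF I Z) (x : M) : ContDiffOn ℝ ∞ (vfL Z x) (extChartAt I x).target := by
  have h1 := (contMDiffOn_vf_iff I (isOpen_extChartAt_source x) subset_rfl).1 hZ.contMDiffOn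
  exact (h1.comp (contMDiffOn_extChartAt_symm x) (extChartAt I x).mapsTo_symm).contDiffOn

theorem contMDiff_of_local_expr {f : M → ℝ} (h : ∀ x, ∃ g : H → ℝ,
    ContDiffOn ℝ ∞ g (extChartAt I x).target ∧
      ∀ y ∈ (extChartAt I x).source, f y = g (extChartAt I x y)) : ContMDiff I 𝓘(ℝ, ℝ) ∞ f := by
  intro x
  obtain ⟨g, hg, hfg⟩ := h x
  have h1 : ContMDiffOn I 𝓘(ℝ, ℝ) ∞ (g ∘ extChartAt I x) (extChartAt I x).source := by
    refine hg.contMDiffOn.comp ?_ (extChartAt I x).mapsTo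
    rw [extChartAt_source]
    exact contMDiffOn_extChartAt
  exact (h1.congr hfg).contMDiffAt (extChartAt_source_mem_nhds x)

theorem IsSmoothVF.contMDiff_dAt [IsManifold I 1 M] [I.Boundaryless]
    {Z : (y : M) → TangentSpace I y} (hZ : IsSmoothVF I Z) {f : M → ℝ}
    (hf : ContMDiff I 𝓘(ℝ, ℝ) ∞ f) : ContMDiff I 𝓘(ℝ, ℝ) ∞ fun y => dAt I f y (Z y) := by
  refine contMDiff_of_local_expr (I := I) fun x =>
    ⟨fun q => fderiv ℝ (f ∘ (extChartAt I x).symm) q (vfL Z x q), ?_, fun y hy => ?_⟩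
  · have h1 : ContDiffOn ℝ ∞ (f ∘ (extChartAt I x).symm) (extChartAt I x).target :=
      (hf.comp_contMDiffOn (contMDiffOn_extChartAt_symm x)).contDiffOn
    exact (h1.fderiv_infty (isOpen_extChartAt_target x)).clm_apply (contDiffOn_vfL hZ x)
  · beta_reduce
    rw [vfL_extChartAt Z hy]
    exact dAt_eq I hy (hf.mdifferentiableAt (by simp)) _

/-- A family of subspaces of the tangent spaces has a smooth projection. -/
def HasGlobalProj [IsManifold I 1 M] (D : (y : M) → Submodule ℝ (TangentSpace I y)) : Prop :=
  ∃ P : (y : M) → TangentSpace I y →L[ℝ] TangentSpace I y, (∀ y u, P y u ∈ D y) ∧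
      (∀ y, ∀ u ∈ D y, P y u = u) ∧
      ∀ Z : (y : M) → TangentSpace I y, IsSmoothVF I Z → IsSmoothVF I fun y => P y (Z y)

theorem HasGlobalProj.exists_section [IsManifold I 1 M] [FiniteDimensional ℝ H] [T2Space M]
    [SigmaCompactSpace M] {D : (y : M) → Submodule ℝ (TangentSpace I y)} (hD : HasGlobalProj D)
    {x : M} {u : TangentSpace I x} (hu : u ∈ D x) :
    ∃ Z : (y : M) → TangentSpace I y, IsSmoothVF I Z ∧ (∀ y, Z y ∈ D y) ∧ Z x = u := by
  obtain ⟨P, hP1, hP2, hP⟩ := hD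
  obtain ⟨Z, hZ, hZx⟩ := exists_isSmoothVF_extension x u
  refine ⟨_, hP Z hZ, fun y => hP1 y _, ?_⟩
  rw [hZx, hP2 x u hu]

end Smoothness

/-! ### Smoothness of the constraint functions -/

section SmoothnessLagrangian

variable {E : Type*} [NormedAddCommGroup E] [NormedSpace ℝ E] [FiniteDimensional ℝ E] {k : ℕ}
variable {Q : Type*} [TopologicalSpace Q] [ChartedSpace E Q] [IsManifold 𝓘(ℝ, E) ∞ Q]
variable {L : KTangent E k Q → ℝ} (hL : ContMDiff (kModel E k) 𝓘(ℝ, ℝ) ∞ L)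

include hL

theorem contMDiff_cartanTwo (α : Fin k) {V W : VF E k Q} (hV : IsSmoothVF (kModel E k) V)
    (hW : IsSmoothVF (kModel E k) W) :
    ContMDiff (kModel E k) 𝓘(ℝ, ℝ) ∞ fun y => cartanTwo L α y (V y) (W y) := by
  refine contMDiff_of_local_expr (I := kModel E k) fun x =>
    ⟨fun q => omL (chartL L x) α q (vfL V x q) (vfL W x q), ?_, fun y hy => ?_⟩
  · exact ((contDiffOn_omL (isOpen_tgt x) (contDiffOn_chartL hL x) α).clm_apply
      (contDiffOn_vfL hV x)).clm_apply (contDiffOn_vfL hW x)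
  · beta_reduce
    rw [vfL_extChartAt V hy, vfL_extChartAt W hy]
    exact cartanTwo_eq hL hy α _ _

theorem contMDiff_eta {Γ₀ X : KVF E k Q} (hΓ₀ : IsSmoothKVF Γ₀) (hX : IsSmoothKVF X)
    {Z : VF E k Q} (hZ : IsSmoothVF (kModel E k) Z) :
    ContMDiff (kModel E k) 𝓘(ℝ, ℝ) ∞ (eta L Γ₀ X Z) := by
  have h : eta L Γ₀ X Z = fun y => ∑ α, cartanTwo L α y ((Γ₀ α - X α) y) (Z y) :=
    funext fun y => om_apply _ _
  rw [h]
  exact contMDiff_finsetSum fun α _ => contMDiff_cartanTwo hL α ((hΓ₀ α).sub (hX α)) hZ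

end SmoothnessLagrangian

/-! ### Global projections onto the Lagrangian distributions -/

section GlobalProjections

variable {E : Type*} [NormedAddCommGroup E] [NormedSpace ℝ E] [FiniteDimensional ℝ E] {k : ℕ}
variable {Q : Type*} [TopologicalSpace Q] [ChartedSpace E Q] [IsManifold 𝓘(ℝ, E) ∞ Q]
variable [T2Space Q] [SecondCountableTopology Q]

theorem hasGlobalProj_vert : HasGlobalProj (I := kModel E k) (M := KTangent E k Q) vert :=
  exists_global_proj fun _ => ⟨fun _ => vertM E k, hasLocProj_vertM _, fun _ hy u =>
    (mem_vert_iff hy u).trans mem_vertM.symm⟩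

variable {L : KTangent E k Q → ℝ} (hL : ContMDiff (kModel E k) 𝓘(ℝ, ℝ) ∞ L)

include hL

theorem hasGlobalProj_kerAll (hker : IsLocallyConstant fun x => Module.finrank ℝ (kerAll L x)) :
    HasGlobalProj (I := kModel E k) (kerAll L) :=
  exists_global_proj fun x => ⟨_, hasLocProj_kerL hL hker (mem_extChartAt_target x),
    fun _ hy u => mem_kerAll_iff hL hy u⟩

theorem hasGlobalProj_MAt (hM : IsLocallyConstant fun x => Module.finrank ℝ (MAt L x)) :
    HasGlobalProj (I := kModel E k) (MAt L) :=
  exists_global_proj fun x => ⟨_, hasLocProj_ML hL hM (mem_extChartAt_target x),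
    fun _ hy u => mem_MAt_iff hL hy u⟩

variable (hK : ∀ x, ∀ᶠ y in 𝓝 x,
      Module.finrank ℝ ↥(vert y ⊓ kerAll L y) = Module.finrank ℝ ↥(vert x ⊓ kerAll L x))

include hK

theorem hasGlobalProj_inf :
    HasGlobalProj (I := kModel E k) fun x => vert x ⊓ kerAll L x :=
  exists_global_proj fun x => ⟨_, hasLocProj_KL hL hK (mem_extChartAt_target x),
    fun _ hy u => mem_vert_inf_kerAll_iff hL hy u⟩

theorem hasGlobalProj_sup (hker : IsLocallyConstant fun x => Module.finrank ℝ (kerAll L x)) :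
    HasGlobalProj (I := kModel E k) fun x => vert x ⊔ kerAll L x :=
  exists_global_proj fun x => ⟨_, hasLocProj_sup hL hK hker (mem_extChartAt_target x),
    fun _ hy u => mem_vert_sup_kerAll_iff hL hy u⟩

end GlobalProjections

/-! ### Annihilators of k-vector fields, pointwise -/

section Annihilators

variable {E : Type*} [NormedAddCommGroup E] [NormedSpace ℝ E] {k : ℕ}
variable {Q : Type*} [TopologicalSpace Q] [ChartedSpace E Q] [IsManifold 𝓘(ℝ, E) ∞ Q]

theorem isSmoothKVF_single {V : VF E k Q} (hV : IsSmoothVF (kModel E k) V) (α : Fin k) :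
    IsSmoothKVF (Pi.single α V : KVF E k Q) := by
  intro β
  by_cases h : β = α
  · subst h; rwa [Pi.single_eq_same]
  · rw [Pi.single_eq_of_ne h]; exact isSmoothVF_zero

theorem single_kvf_apply (V : VF E k Q) (α : Fin k) (x : KTangent E k Q) :
    (fun β => (Pi.single α V : KVF E k Q) β x) = Pi.single α (V x) := by
  funext β
  by_cases h : β = α
  · subst h; rw [Pi.single_eq_same, Pi.single_eq_same]
  · rw [Pi.single_eq_of_ne h, Pi.single_eq_of_ne h]; rfl

variable {L : KTangent E k Q → ℝ}

theorem mem_kerVertOm_of_mem {V : KVF E k Q} (hV : IsSmoothKVF V)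
    (h : ∀ α x, V α x ∈ vert x ⊓ kerAll L x) : V ∈ kerVertOm L := by
  refine ⟨⟨hV, fun α x => (h α x).1⟩, fun x => ?_⟩
  refine LinearMap.ext fun w => ?_
  rw [om_apply]
  refine Finset.sum_eq_zero fun α _ => ?_
  have h1 := (Submodule.mem_iInf _).1 (h α x).2 α
  rw [LinearMap.mem_ker.1 h1]; rfl

theorem kerAll_le_MAt (hL : ContMDiff (kModel E k) 𝓘(ℝ, ℝ) ∞ L) (x : KTangent E k Q) :
    kerAll L x ≤ MAt L x := fun _ hu => mem_MAt.2 fun α w _ => (mem_kerAll hL).1 hu α w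

theorem vert_le_MAt (hL : ContMDiff (kModel E k) 𝓘(ℝ, ℝ) ∞ L) (x : KTangent E k Q) :
    vert x ≤ MAt L x := fun u hu =>
  have hx := mem_extChartAt_source (I := kModel E k) x
  (mem_MAt_iff hL hx u).2 (vert_le_ML ((mem_vert_iff hx u).1 hu))

theorem sup_le_MAt (hL : ContMDiff (kModel E k) 𝓘(ℝ, ℝ) ∞ L) (x : KTangent E k Q) :
    vert x ⊔ kerAll L x ≤ MAt L x := sup_le (vert_le_MAt hL x) (kerAll_le_MAt hL x)

theorem add_mem_kerVertOm {V W : KVF E k Q} (hV : V ∈ kerVertOm L) (hW : W ∈ kerVertOm L) :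
    V + W ∈ kerVertOm L := by
  refine ⟨⟨fun α => (hV.1.1 α).add (hW.1.1 α), fun α x => add_mem (hV.1.2 α x) (hW.1.2 α x)⟩,
    fun x => LinearMap.ext fun w => ?_⟩
  have h1 := LinearMap.congr_fun (hV.2 x) w
  have h2 := LinearMap.congr_fun (hW.2 x) w
  rw [om_apply] at h1 h2 ⊢
  have h3 : ∀ α, cartanTwo L α x ((V + W) α x) w =
      cartanTwo L α x (V α x) w + cartanTwo L α x (W α x) w := fun α => by
    rw [Pi.add_apply, Pi.add_apply, map_add, LinearMap.add_apply]
  simp only [h3, Finset.sum_add_distrib, h1, h2]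
  exact add_zero _

variable [FiniteDimensional ℝ E] [T2Space Q] [SecondCountableTopology Q]

/-- Every vertical vector is the value of a global vertical field, and placing that field in a
single slot isolates one form ω^α. -/
theorem mem_MPerp_iff {Z : VF E k Q} :
    Z ∈ MPerp L ↔ IsSmoothVF (kModel E k) Z ∧ ∀ x, Z x ∈ MAt L x := by
  refine and_congr_right fun _ => ⟨fun h x => mem_MAt.2 fun α u hu => ?_, fun h Y hY x => ?_⟩
  · obtain ⟨V, hV, hVv, rfl⟩ := hasGlobalProj_vert.exists_section hu
    have h1 := h (Pi.single α V) ⟨isSmoothKVF_single hV α, fun β y => ?_⟩ x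
    · rwa [single_kvf_apply, om_single] at h1
    · have := congrFun (single_kvf_apply V α y) β
      rw [this]
      by_cases hβ : β = α
      · subst hβ; rw [Pi.single_eq_same]; exact hVv y
      · rw [Pi.single_eq_of_ne hβ]; exact zero_mem _
  · rw [om_apply]
    exact Finset.sum_eq_zero fun α _ => mem_MAt.1 (h x) α _ (hY.2 α x)

theorem mem_XPerp_iff (hL : ContMDiff (kModel E k) 𝓘(ℝ, ℝ) ∞ L) {Z : VF E k Q} :
    Z ∈ XPerp L ↔ IsSmoothVF (kModel E k) Z ∧ ∀ x, Z x ∈ kerAll L x := by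
  refine and_congr_right fun _ => ⟨fun h x => (mem_kerAll hL).2 fun α u => ?_, fun h Y hY x => ?_⟩
  · obtain ⟨V, hV, rfl⟩ := exists_isSmoothVF_extension x u
    have h1 := h (Pi.single α V) (isSmoothKVF_single hV α) x
    rwa [single_kvf_apply, om_single] at h1
  · rw [om_apply]
    exact Finset.sum_eq_zero fun α _ => (mem_kerAll hL).1 (h x) α _

theorem XPerp_subset_MPerp (hL : ContMDiff (kModel E k) 𝓘(ℝ, ℝ) ∞ L) : XPerp L ⊆ MPerp L :=
  fun _ hZ => mem_MPerp_iff.2 ⟨hZ.1, fun x => kerAll_le_MAt hL x (((mem_XPerp_iff hL).1 hZ).2 x)⟩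

end Annihilators

/-! ### Differentials of the SOPDE constraints -/

section ConstraintDerivative

variable {E : Type*} [NormedAddCommGroup E] [NormedSpace ℝ E] [FiniteDimensional ℝ E] {k : ℕ}
variable {Q : Type*} [TopologicalSpace Q] [ChartedSpace E Q] [IsManifold 𝓘(ℝ, E) ∞ Q]
variable {L : KTangent E k Q → ℝ} (hL : ContMDiff (kModel E k) 𝓘(ℝ, ℝ) ∞ L)
  (hK : ∀ x, ∀ᶠ y in 𝓝 x,
      Module.finrank ℝ ↥(vert y ⊓ kerAll L y) = Module.finrank ℝ ↥(vert x ⊓ kerAll L x))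
  (hker : IsLocallyConstant fun x => Module.finrank ℝ (kerAll L x))
  {X : KVF E k Q} (hX : IsSmoothKVF X) (hXL : ∀ x ∈ P1 L, IsLagrangianAt L x fun α => X α x)
  {Γ₀ : KVF E k Q} (hΓ₀ : IsSmoothKVF Γ₀) (hΓ₀S : ∀ x, IsSopdeAt x fun α => Γ₀ α x)

include hL hK hker hX hXL hΓ₀ hΓ₀S

/-- At a point where a second-order solution of the Lagrangian equation exists, the differentials
of the SOPDE constraints `η^(Z)` depend only on the value of `Z`; their restrictions to the vertical
characteristic vectors determine `Z` modulo vertical and characteristic vectors. -/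
theorem exists_dAt_eta {x : KTangent E k Q} (hxP : x ∈ P1 L) {Y : Fin k → TK x}
    (hY : IsLagrangianAt L x Y) (hYS : IsSopdeAt x Y) :
    ∃ b : TK x →ₗ[ℝ] TK x →ₗ[ℝ] ℝ,
      (∀ Z : VF E k Q, IsSmoothVF (kModel E k) Z → (∀ y, Z y ∈ MAt L y) →
        ∀ u, dAt (kModel E k) (eta L Γ₀ X Z) x u = b u (Z x)) ∧
      ∀ z ∈ MAt L x, (∀ v ∈ vert x ⊓ kerAll L x, b v z = 0) → z ∈ vert x ⊔ kerAll L x := by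
  have hxs := mem_extChartAt_source (I := kModel E k) x
  set p := extChartAt (kModel E k) x x with hp
  have hpt : p ∈ tgt E k x := mem_extChartAt_target x
  set l := chartL L x with hl
  have hlU := contDiffOn_chartL hL x
  have hU := isOpen_tgt x
  have hXs := fun α => contDiffOn_vfL (hX α) x
  have hΓs := fun α => contDiffOn_vfL (hΓ₀ α) x
  -- the coordinate expression of a second-order field with value `Y` at `x`
  let g : Fin k → (Fin k → E) := fun α =>
    (chartD (kModel E k) x x (Y α)).2 - (vfL (I := kModel E k) (Γ₀ α) x p).2
  let G : Fin k → KVec E k → KVec E k := fun α q =>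
    vfL (I := kModel E k) (Γ₀ α) x q + vin (g α)
  have hG : ∀ α, ContDiffOn ℝ ∞ (G α) (tgt E k x) := fun α => (hΓs α).add contDiffOn_const
  have hG1 : ∀ α, ∀ q ∈ tgt E k x, (G α q).1 = q.2 α := by
    intro α q hq
    have hy := (extChartAt (kModel E k) x).map_target hq
    have h1 := (isSopdeAt_iff hy _).1 (hΓ₀S _) α
    rw [(extChartAt (kModel E k) x).right_inv hq] at h1
    exact (add_zero _).trans h1
  have hGp : ∀ α, G α p = chartD (kModel E k) x x (Y α) := by
    intro α
    refine Prod.ext ?_ (add_sub_cancel _ _)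
    rw [hG1 α p hpt, (isSopdeAt_iff hxs Y).1 hYS α]
  -- β is Ω(G − X) in coordinates. G differs from Γ₀ by vertical vectors, so β and Ω(Γ₀ − X) agree
  -- on fields in 𝔐 and η^(Z) is β(Z).
  let β : KVec E k → KVec E k →L[ℝ] ℝ := fun q =>
    ∑ α, omL l α q (G α q - vfL (I := kModel E k) (X α) x q)
  have hβ : ContDiffOn ℝ ∞ β (tgt E k x) := ContDiffOn.sum fun α _ =>
    (contDiffOn_omL hU hlU α).clm_apply ((hG α).sub (hXs α))
  have hβ' := hβ.hasFDerivAt_infty hU hpt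
  have hXp : ∀ α, vfL (I := kModel E k) (X α) x p = chartD (kModel E k) x x (X α x) :=
    fun α => vfL_extChartAt (X α) hxs
  -- Both Y and X solve the Lagrangian equation at x. Because β vanishes there, differentiating β(Z)
  -- produces no derivative of Z.
  have hβp : β p = 0 := by
    refine ContinuousLinearMap.ext fun h => ?_
    have h1 := LinearMap.congr_fun (hY.trans (hXL x hxP).symm) (chartDInv (kModel E k) x x h)
    rw [om_eq hL hxs, om_eq hL hxs, chartD_chartDInv hxs] at h1
    simp only [β, sum_apply, hGp, hXp, map_sub, sub_apply, Finset.sum_sub_distrib]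
    exact sub_eq_zero.2 h1
  let D := fderiv ℝ β p
  let c : TK x →ₗ[ℝ] KVec E k := (chartD (kModel E k) x x).toLinearMap
  refine ⟨LinearMap.mk₂ ℝ (fun u w => D (c u) (c w))
    (fun u u' w => by simp only [map_add, add_apply])
    (fun r u w => by simp only [map_smul, smul_apply])
    (fun u w w' => by simp only [map_add]) (fun r u w => by simp only [map_smul]), ?_, ?_⟩
  · intro Z hZ hZM u
    have hZs := contDiffOn_vfL hZ x
    have h1 : eta L Γ₀ X Z ∘ (extChartAt (kModel E k) x).symm =ᶠ[𝓝 p]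
        fun q => β q (vfL (I := kModel E k) Z x q) := by
      filter_upwards [hU.mem_nhds hpt] with q hq
      have hy := (extChartAt (kModel E k) x).map_target hq
      have h2 := om_eq hL hy (fun α => Γ₀ α _ - X α _) (Z _)
      rw [(extChartAt (kModel E k) x).right_inv hq] at h2
      refine h2.trans ?_
      have h3 := (mem_MAt_iff hL hy _).1 (hZM _)
      rw [(extChartAt (kModel E k) x).right_inv hq, mem_ML] at h3
      simp only [β, sum_apply]
      refine Finset.sum_congr rfl fun α _ => ?_
      have h4 : G α q - vfL (I := kModel E k) (X α) x q =
          chartD (kModel E k) x _ (Γ₀ α ((extChartAt (kModel E k) x).symm q) -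
            X α ((extChartAt (kModel E k) x).symm q)) + vin (g α) := by
        rw [map_sub]
        exact add_sub_right_comm _ _ _
      rw [h4, map_add, add_apply, vfL, h3 α (g α), add_zero]
    have h2 := (hβ'.clm_apply (hZs.hasFDerivAt_infty hU hpt)).congr_of_eventuallyEq h1
    rw [dAt_eq (kModel E k) hxs ((contMDiff_eta hL hΓ₀ hX hZ).mdifferentiableAt (by simp)), h2.fderiv]
    simp only [hβp, add_apply, ContinuousLinearMap.comp_apply, ContinuousLinearMap.flip_apply,
      zero_apply, zero_add]
    rw [vfL_extChartAt Z hxs]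
    rfl
  · intro z hz hbz
    have hzL := (mem_MAt_iff hL hxs z).1 hz
    obtain ⟨φ', hφ', hφK⟩ := hasFDerivAt_eulerLagrange hU hlU hpt (hasLocProj_KL hL hK hpt)
      (fun α => (hG α).hasFDerivAt_infty hU hpt)
      (fun α => by filter_upwards [hU.mem_nhds hpt] with q hq using hG1 α q hq) hzL
    obtain ⟨w, hw, hzw⟩ := exists_vert_add_kerL (symm_D2 hU hlU hpt) hzL (by
      intro v hv
      rw [← hφK v hv]
      set v' := chartDInv (kModel E k) x x v with hv'
      have hvD : chartD (kModel E k) x x v' = v := chartD_chartDInv hxs v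
      have hvK : v' ∈ vert x ⊓ kerAll L x := (mem_vert_inf_kerAll_iff hL hxs v').2 (by rwa [hvD])
      -- the defect of `X` in the Lagrangian equation
      let f : KTangent E k Q → ℝ := fun y => Om L y (fun α => X α y)
        (chartDInv (kModel E k) x y (c z)) -
          dAt (kModel E k) (energy L) y (chartDInv (kModel E k) x y (c z))
      let fL : KVec E k → ℝ := fun q =>
        (∑ α, omL l α q (vfL (I := kModel E k) (X α) x q)) (c z) - fderiv ℝ (enL l) q (c z)
      have hfL : ContDiffOn ℝ ∞ fL (tgt E k x) :=
        ((ContDiffOn.sum fun α _ => (contDiffOn_omL hU hlU α).clm_apply (hXs α)).clm_apply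
          contDiffOn_const).sub (((contDiffOn_enL hU hlU).fderiv_infty hU).clm_apply contDiffOn_const)
      have hfeq : ∀ q ∈ tgt E k x, f ((extChartAt (kModel E k) x).symm q) = fL q := by
        intro q hq
        have hy := (extChartAt (kModel E k) x).map_target hq
        simp only [f, fL]
        rw [om_eq hL hy, dAt_energy_eq hL hy, chartD_chartDInv hy,
          (extChartAt (kModel E k) x).right_inv hq, sum_apply]
        rfl
      have hfm : MDifferentiableAt (kModel E k) 𝓘(ℝ, ℝ) f x := by
        have h1 : ContMDiffOn (kModel E k) 𝓘(ℝ, ℝ) ∞ (fL ∘ extChartAt (kModel E k) x)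
            (extChartAt (kModel E k) x).source := by
          refine hfL.contMDiffOn.comp ?_ (extChartAt (kModel E k) x).mapsTo
          rw [extChartAt_source]
          exact contMDiffOn_extChartAt
        have h2 : ContMDiffOn (kModel E k) 𝓘(ℝ, ℝ) ∞ f (extChartAt (kModel E k) x).source := by
          refine h1.congr fun y hy => ?_
          rw [Function.comp_apply, ← hfeq _ ((extChartAt (kModel E k) x).map_source hy),
            (extChartAt (kModel E k) x).left_inv hy]
        exact (h2.contMDiffAt (extChartAt_source_mem_nhds x)).mdifferentiableAt (by simp)
      -- The defect of X, evaluated on the extension of z by constant coordinates, vanishes on P₁,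
      -- and v' is tangent to P₁.
      have hf0 : dAt (kModel E k) f x v' = 0 :=
        (isTangentTo_P1 hL hK hker hxP hvK).dAt_eq_zero hfm fun y hy => by
          have := LinearMap.congr_fun (hXL y hy) (chartDInv (kModel E k) x y (c z))
          simp only [f]
          rw [this]
          exact sub_self _
      have hfev : f ∘ (extChartAt (kModel E k) x).symm =ᶠ[𝓝 p] fL := by
        filter_upwards [hU.mem_nhds hpt] with q hq using hfeq q hq
      rw [dAt_eq (kModel E k) hxs hfm, hvD, hfev.fderiv_eq] at hf0
      have h3 := (hβ'.clm_apply (hasFDerivAt_const (c z) p)).add (hfL.hasFDerivAt_infty hU hpt)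
      -- The Euler-Lagrange form of G is β plus the defect of X. Along v the defect has derivative
      -- zero and that of β is zero by `hbz`, so the form has derivative zero too.
      have h4 : (fun q => ∑ α, omL l α q (G α q) (c z) - fderiv ℝ (enL l) q (c z)) =
          fun q => β q (c z) + fL q := by
        funext q
        simp only [β, fL, sum_apply, map_sub, sub_apply, Finset.sum_sub_distrib]
        ring
      have h5 := hφ'.unique (h3.congr_of_eventuallyEq (Eq.eventuallyEq h4))
      rw [h5]
      have h6 := hbz v' hvK
      change D (chartD (kModel E k) x x v') (c z) = 0 at h6
      rw [hvD] at h6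
      simp only [add_apply, ContinuousLinearMap.comp_apply, ContinuousLinearMap.flip_apply,
        zero_apply, map_zero, zero_add]
      rw [hf0, add_zero]
      exact h6)
    refine (mem_vert_sup_kerAll_iff hL hxs z).2 (Submodule.mem_sup.2 ⟨_, mem_vertM.2 hzw, w, hw, ?_⟩)
    exact sub_add_cancel _ _

end ConstraintDerivative

/-! ### Bases modulo a subspace and pairings -/

section LinearAlgebra

variable {V : Type*} [AddCommGroup V] [Module ℝ V] [FiniteDimensional ℝ V]

theorem finrank_span_sup_of_independent {B : Submodule ℝ V} {r : ℕ} {z : Fin r → V}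
    (hind : ∀ a : Fin r → ℝ, ∑ i, a i • z i ∈ B → a = 0) :
    Module.finrank ℝ ↥(Submodule.span ℝ (range z) ⊔ B) = r + Module.finrank ℝ B := by
  have h1 : LinearIndependent ℝ z := Fintype.linearIndependent_iff.2 fun a ha =>
    congrFun (hind a (ha ▸ B.zero_mem))
  have h2 : Submodule.span ℝ (range z) ⊓ B = ⊥ := by
    rw [eq_bot_iff]
    rintro s ⟨hs, hsB⟩
    obtain ⟨a, rfl⟩ := (Submodule.mem_span_range_iff_exists_fun ℝ).1 hs
    rw [hind a hsB]
    simp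
  have h3 := Submodule.finrank_sup_add_finrank_inf_eq (Submodule.span ℝ (range z)) B
  rw [h2, finrank_bot, add_zero, finrank_span_eq_card h1, Fintype.card_fin] at h3
  exact h3

/-- A family which is independent modulo `B` and of the right cardinality spans `M` modulo `B`. -/
theorem exists_sub_sum_mem_of_finrank_eq {B M : Submodule ℝ V} (hBM : B ≤ M) {r : ℕ}
    {z : Fin r → V} (hz : ∀ i, z i ∈ M) (hind : ∀ a : Fin r → ℝ, ∑ i, a i • z i ∈ B → a = 0)
    (hr : r + Module.finrank ℝ B = Module.finrank ℝ M) {m : V} (hm : m ∈ M) :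
    ∃ a : Fin r → ℝ, m - ∑ i, a i • z i ∈ B := by
  have h1 : Submodule.span ℝ (range z) ⊔ B = M := by
    refine Submodule.eq_of_le_of_finrank_eq (sup_le (Submodule.span_le.2 ?_) hBM)
      ((finrank_span_sup_of_independent hind).trans hr)
    rintro _ ⟨i, rfl⟩
    exact hz i
  rw [← h1, Submodule.mem_sup] at hm
  obtain ⟨s, hs, b, hb, rfl⟩ := hm
  obtain ⟨a, rfl⟩ := (Submodule.mem_span_range_iff_exists_fun ℝ).1 hs
  exact ⟨a, by rwa [add_sub_cancel_left]⟩

/-- A subspace `N` which spans `M` modulo `B` contains a basis of `M` modulo `B`. -/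
theorem exists_basis_mod {B M N : Submodule ℝ V} (hBM : B ≤ M) (hNM : N ≤ M) (hM : M ≤ N ⊔ B) :
    ∃ (r : ℕ) (z : Fin r → V), (∀ i, z i ∈ N) ∧
      (∀ a : Fin r → ℝ, ∑ i, a i • z i ∈ B → a = 0) ∧
      r + Module.finrank ℝ B = Module.finrank ℝ M := by
  let e := Module.finBasis ℝ (N.map B.mkQ)
  have h1 : ∀ i, ∃ z ∈ N, B.mkQ z = e i := fun i => Submodule.mem_map.1 (e i).2
  choose z hzN hz using h1
  have hind : ∀ a : Fin _ → ℝ, ∑ i, a i • z i ∈ B → a = 0 := by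
    intro a ha
    have h2 : ((∑ i, a i • e i : N.map B.mkQ) : V ⧸ B) = 0 := by
      rw [← (Submodule.Quotient.mk_eq_zero B).2 ha, ← Submodule.mkQ_apply, map_sum]
      simp only [map_smul, hz]
      simp
    have h3 : ∑ i, a i • e i = 0 := Subtype.ext h2
    exact funext (Fintype.linearIndependent_iff.1 e.linearIndependent a h3)
  refine ⟨_, z, hzN, hind, ?_⟩
  rw [← finrank_span_sup_of_independent hind]
  suffices h : Submodule.span ℝ (range z) ⊔ B = M by rw [h]
  apply le_antisymm
  · refine sup_le (Submodule.span_le.2 ?_) hBM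
    rintro _ ⟨i, rfl⟩
    exact hNM (hzN i)
  · refine hM.trans (sup_le (fun n hn => ?_) le_sup_right)
    let n' : N.map B.mkQ := ⟨B.mkQ n, Submodule.mem_map_of_mem hn⟩
    have h4 : B.mkQ (n - ∑ i, e.repr n' i • z i) = 0 := by
      rw [map_sub, map_sum]
      simp only [map_smul, hz]
      have h5 := congrArg (N.map B.mkQ).subtype (e.sum_repr n')
      rw [map_sum] at h5
      simp only [map_smul] at h5
      exact sub_eq_zero.2 h5.symm
    have h6 : n - ∑ i, e.repr n' i • z i ∈ B := by
      rwa [Submodule.mkQ_apply, Submodule.Quotient.mk_eq_zero] at h4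
    have h7 : ∑ i, e.repr n' i • z i ∈ Submodule.span ℝ (range z) :=
      (Submodule.mem_span_range_iff_exists_fun ℝ).2 ⟨_, rfl⟩
    have h8 := Submodule.add_mem_sup h7 h6
    rwa [add_sub_cancel] at h8

/-- A functional on `M` which vanishes on the vectors orthogonal to `K` is represented by an
element of `K`. -/
theorem exists_mem_of_pairing {K M : Submodule ℝ V} (b : V →ₗ[ℝ] V →ₗ[ℝ] ℝ) (f : V →ₗ[ℝ] ℝ)
    (h : ∀ z ∈ M, (∀ v ∈ K, b v z = 0) → f z = 0) : ∃ v ∈ K, ∀ z ∈ M, b v z = f z := by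
  let T : K →ₗ[ℝ] Module.Dual ℝ M := (LinearMap.lcomp ℝ ℝ M.subtype).comp (b.comp K.subtype)
  -- The range of T is the annihilator of the vectors of M orthogonal to K, and f vanishes on these.
  have h1 : f.comp M.subtype ∈ LinearMap.range T := by
    rw [← Subspace.dualCoannihilator_dualAnnihilator_eq (W := LinearMap.range T),
      Submodule.mem_dualAnnihilator]
    intro z hz
    exact h z z.2 fun v hv =>
      (Submodule.mem_dualCoannihilator z).1 hz _ (LinearMap.mem_range_self T ⟨v, hv⟩)
  obtain ⟨v, hv⟩ := h1
  exact ⟨v, v.2, fun z hz => LinearMap.congr_fun hv ⟨z, hz⟩⟩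

end LinearAlgebra

/-! ### Labels whose constraint functions vanish -/

section KeyLemma

variable {E : Type*} [NormedAddCommGroup E] [NormedSpace ℝ E] {k : ℕ}
variable {Q : Type*} [TopologicalSpace Q] [ChartedSpace E Q] [IsManifold 𝓘(ℝ, E) ∞ Q]
variable {L : KTangent E k Q → ℝ} (hL : ContMDiff (kModel E k) 𝓘(ℝ, ℝ) ∞ L)

include hL

/-- Second-order `k`-vectors satisfy the fibre components of the Lagrangian equation. -/
theorem om_eq_dAt_energy_of_isSopdeAt {x : KTangent E k Q} {Y : Fin k → TK x} (hY : IsSopdeAt x Y)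
    {u : TK x} (hu : u ∈ vert x) : Om L x Y u = dAt (kModel E k) (energy L) x u := by
  have hxs := mem_extChartAt_source (I := kModel E k) x
  have hxt := mem_extChartAt_target (I := kModel E k) x
  have hu0 := (mem_vert_iff hxs u).1 hu
  rw [om_eq hL hxs, dAt_energy_eq hL hxs,
    fderiv_enL (isOpen_tgt x) (contDiffOn_chartL hL x) hxt, hu0]
  -- For vertical u only D²l(u, J^α Y_α) survives; the second-order condition makes these J^α Y_α
  -- sum to Δ, which gives dℰ(u).
  simp only [omL_apply, jv_of_fst_eq_zero _ hu0, map_zero, sub_zero]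
  rw [vin_eq_sum, map_sum, show ((0 : E), (0 : Fin k → E)) = 0 from rfl, map_zero, sub_zero]
  refine Finset.sum_congr rfl fun α _ => ?_
  rw [jv_apply, jv_apply, (isSopdeAt_iff hxs Y).1 hY α]

theorem eta_eq_zero_of_mem_kerAll {Γ₀ X : KVF E k Q} {Z : VF E k Q} {x : KTangent E k Q}
    (hZ : Z x ∈ kerAll L x) : eta L Γ₀ X Z x = 0 := by
  rw [eta, om_apply]
  exact Finset.sum_eq_zero fun α _ => (mem_kerAll hL).1 hZ α _

/-- Γ₀ satisfies the fibre components of the Lagrangian equation automatically, so the assumption on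
X makes the two terms of η equal. -/
theorem eta_eq_zero_of_mem_vert {Γ₀ X : KVF E k Q} {Z : VF E k Q} {x : KTangent E k Q}
    (hΓ₀S : IsSopdeAt x fun α => Γ₀ α x) (hZ : Z x ∈ vert x)
    (hX : Om L x (fun α => X α x) (Z x) = dAt (kModel E k) (energy L) x (Z x)) :
    eta L Γ₀ X Z x = 0 := by
  have h1 : eta L Γ₀ X Z x = Om L x (fun α => Γ₀ α x) (Z x) - Om L x (fun α => X α x) (Z x) := by
    rw [eta, om_apply, om_apply, om_apply, ← Finset.sum_sub_distrib]
    refine Finset.sum_congr rfl fun α _ => ?_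
    rw [map_sub]; rfl
  rw [h1, hX, om_eq_dAt_energy_of_isSopdeAt hL hΓ₀S hZ, sub_self]

end KeyLemma

/-! ### The pairing with M modulo B, and existence of complete independent systems -/

section Constraints

variable {E : Type*} [NormedAddCommGroup E] [NormedSpace ℝ E] {k : ℕ}
variable {Q : Type*} [TopologicalSpace Q] [ChartedSpace E Q] [IsManifold 𝓘(ℝ, E) ∞ Q]

/-- The regularity assumptions: constant ranks of the vertical characteristic, the characteristic
and the fibre-orthogonal subspaces, a solution `X` of the Lagrangian equation on `P₁` and a
second-order field `Γ₀`. -/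
structure IsRegularSetting (L : KTangent E k Q → ℝ) (Γ₀ X : KVF E k Q) : Prop where
  smooth : ContMDiff (kModel E k) 𝓘(ℝ, ℝ) ∞ L
  rank_inf : ∀ x, ∀ᶠ y in 𝓝 x,
    Module.finrank ℝ ↥(vert y ⊓ kerAll L y) = Module.finrank ℝ ↥(vert x ⊓ kerAll L x)
  rank_kerAll : IsLocallyConstant fun x => Module.finrank ℝ (kerAll L x)
  rank_MAt : IsLocallyConstant fun x => Module.finrank ℝ (MAt L x)
  smooth_X : IsSmoothKVF X
  lagrangian_X : ∀ x ∈ P1 L, IsLagrangianAt L x fun α => X α x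
  smooth_Γ₀ : IsSmoothKVF Γ₀
  sopde_Γ₀ : ∀ x, IsSopdeAt x fun α => Γ₀ α x

/-- There is a second-order solution of the Lagrangian equation at `x`. -/
def HasSopdeSolution (L : KTangent E k Q → ℝ) (x : KTangent E k Q) : Prop :=
  ∃ Y : Fin k → TK x, IsLagrangianAt L x Y ∧ IsSopdeAt x Y

variable {L : KTangent E k Q → ℝ} {Γ₀ X : KVF E k Q}

theorem HasSopdeSolution.mem_P1 {x : KTangent E k Q} (hx : HasSopdeSolution L x) : x ∈ P1 L :=
  ⟨_, hx.choose_spec.1⟩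

variable [FiniteDimensional ℝ E]

theorem finrank_sup_eventually (hS : IsRegularSetting L Γ₀ X) (x : KTangent E k Q) : ∀ᶠ y in 𝓝 x,
    Module.finrank ℝ ↥(vert y ⊔ kerAll L y) = Module.finrank ℝ ↥(vert x ⊔ kerAll L x) := by
  have h1 : ∀ y : KTangent E k Q, Module.finrank ℝ ↥(vert y ⊔ kerAll L y) +
      Module.finrank ℝ ↥(vert y ⊓ kerAll L y) = Module.finrank ℝ (vertM E k) +
      Module.finrank ℝ (kerAll L y) := by
    intro y
    have : FiniteDimensional ℝ (TK y) := inferInstanceAs (FiniteDimensional ℝ (E × (Fin k → E)))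
    have hy := mem_extChartAt_source (I := kModel E k) y
    rw [← finrank_eq_of_mem_iff hy fun u => (mem_vert_iff hy u).trans mem_vertM.symm]
    exact Submodule.finrank_sup_add_finrank_inf_eq _ _
  filter_upwards [hS.rank_inf x, hS.rank_kerAll.eventually_eq x] with y h2 h3
  have h4 := h1 y
  have h5 := h1 x
  omega

theorem IsRegularSetting.isTangentTo (hS : IsRegularSetting L Γ₀ X) {x : KTangent E k Q}
    (hx : HasSopdeSolution L x) {v : TK x} (hv : v ∈ vert x ⊓ kerAll L x) :
    IsTangentTo (kModel E k) (P1 L) x v :=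
  isTangentTo_P1 hS.smooth hS.rank_inf hS.rank_kerAll hx.mem_P1 hv

variable [T2Space Q] [SecondCountableTopology Q]

variable (L) in
/-- The fields in `𝔐` as a submodule of the space of vector fields. -/
def MPerpSubmodule : Submodule ℝ (VF E k Q) where
  carrier := MPerp L
  zero_mem' := mem_MPerp_iff.2 ⟨isSmoothVF_zero, fun _ => zero_mem _⟩
  add_mem' {Z W} hZ hW := by
    rw [mem_MPerp_iff] at hZ hW ⊢
    exact ⟨hZ.1.add hW.1, fun x => add_mem (hZ.2 x) (hW.2 x)⟩
  smul_mem' c Z hZ := by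
    rw [mem_MPerp_iff] at hZ ⊢
    exact ⟨hZ.1.smul c, fun x => Submodule.smul_mem _ c (hZ.2 x)⟩

theorem span_subset_MPerp {𝒵 : Set (VF E k Q)} (h : 𝒵 ⊆ MPerp L) {Z : VF E k Q}
    (hZ : Z ∈ Submodule.span ℝ 𝒵) : Z ∈ MPerp L :=
  (Submodule.span_le (p := MPerpSubmodule L)).2 h hZ

theorem IsRegularSetting.exists_MPerp (hS : IsRegularSetting L Γ₀ X) {x : KTangent E k Q}
    {z : TK x} (hz : z ∈ MAt L x) : ∃ Z ∈ MPerp L, Z x = z := by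
  obtain ⟨Z, hZ, hZM, hZx⟩ := (hasGlobalProj_MAt hS.smooth hS.rank_MAt).exists_section hz
  exact ⟨Z, mem_MPerp_iff.2 ⟨hZ, hZM⟩, hZx⟩

theorem IsRegularSetting.exists_XPerp (hS : IsRegularSetting L Γ₀ X) {x : KTangent E k Q}
    {z : TK x} (hz : z ∈ kerAll L x) : ∃ Z ∈ XPerp L, Z x = z := by
  obtain ⟨Z, hZ, hZM, hZx⟩ := (hasGlobalProj_kerAll hS.smooth hS.rank_kerAll).exists_section hz
  exact ⟨Z, (mem_XPerp_iff hS.smooth).2 ⟨hZ, hZM⟩, hZx⟩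

/-- The differentials of the SOPDE constraints at a point with a second-order solution. -/
theorem IsRegularSetting.exists_pairing (hS : IsRegularSetting L Γ₀ X) {x : KTangent E k Q}
    (hx : HasSopdeSolution L x) : ∃ b : TK x →ₗ[ℝ] TK x →ₗ[ℝ] ℝ,
      (∀ Z ∈ MPerp L, ∀ u, dAt (kModel E k) (eta L Γ₀ X Z) x u = b u (Z x)) ∧
      (∀ z ∈ MAt L x, (∀ v ∈ vert x ⊓ kerAll L x, b v z = 0) → z ∈ vert x ⊔ kerAll L x) ∧
      ∀ z ∈ vert x ⊔ kerAll L x, ∀ u, IsTangentTo (kModel E k) (P1 L) x u → b u z = 0 := by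
  have hL := hS.smooth
  obtain ⟨Y, hY, hYS⟩ := hx
  obtain ⟨b, hb, hbK⟩ := exists_dAt_eta hL hS.rank_inf hS.rank_kerAll hS.smooth_X hS.lagrangian_X
    hS.smooth_Γ₀ hS.sopde_Γ₀ ⟨Y, hY⟩ hY hYS
  refine ⟨b, fun Z hZ => hb Z hZ.1 (mem_MPerp_iff.1 hZ).2, hbK, fun z hz u hu => ?_⟩
  obtain ⟨v, hv, w, hw, rfl⟩ := Submodule.mem_sup.1 hz
  -- The vertical and the characteristic part are extended separately to global fields, whose
  -- functions η vanish on all of P₁ and are therefore killed by tangent vectors.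
  obtain ⟨V, hV, hVv, rfl⟩ := hasGlobalProj_vert.exists_section hv
  obtain ⟨W, hW, hWk, rfl⟩ :=
    (hasGlobalProj_kerAll hL hS.rank_kerAll).exists_section hw
  have hdiff : ∀ Z, IsSmoothVF (kModel E k) Z →
      MDifferentiableAt (kModel E k) 𝓘(ℝ, ℝ) (eta L Γ₀ X Z) x := fun Z hZ =>
    (contMDiff_eta hL hS.smooth_Γ₀ hS.smooth_X hZ).mdifferentiableAt (by simp)
  rw [map_add, ← hb V hV (fun y => vert_le_MAt hL y (hVv y)),
    ← hb W hW (fun y => kerAll_le_MAt hL y (hWk y)),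
    hu.dAt_eq_zero (hdiff V hV) fun y hy => eta_eq_zero_of_mem_vert hL (hS.sopde_Γ₀ y) (hVv y)
      (LinearMap.congr_fun (hS.lagrangian_X y hy) _),
    hu.dAt_eq_zero (hdiff W hW) fun y _ => eta_eq_zero_of_mem_kerAll hL (hWk y), add_zero]

/-- A constraint whose differential vanishes on the tangent vectors of `P₁` has a label in the
span of the vertical and the characteristic vectors. -/
theorem IsRegularSetting.mem_sup_of_dAt_eq_zero (hS : IsRegularSetting L Γ₀ X) {x : KTangent E k Q}
    (hx : HasSopdeSolution L x) {Z : VF E k Q} (hZ : Z ∈ MPerp L)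
    (h : ∀ u, IsTangentTo (kModel E k) (P1 L) x u → dAt (kModel E k) (eta L Γ₀ X Z) x u = 0) :
    Z x ∈ vert x ⊔ kerAll L x := by
  obtain ⟨b, hb, hbK, -⟩ := hS.exists_pairing hx
  exact hbK _ ((mem_MPerp_iff.1 hZ).2 x) fun v hv =>
    (hb Z hZ v).symm.trans (h v (hS.isTangentTo hx hv))

/-- Complete independent systems of SOPDE constraints exist: take the fields in a complement of the
span of the vertical and the characteristic vectors. -/
theorem IsRegularSetting.exists_isConstraintSystem (hS : IsRegularSetting L Γ₀ X)
    (hsol : ∀ x ∈ S1 L X, HasSopdeSolution L x) : ∃ 𝒵, IsConstraintSystem L Γ₀ X 𝒵 := by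
  have hL := hS.smooth
  obtain ⟨P, hP1, hP2, hP⟩ := hasGlobalProj_sup hL hS.rank_inf hS.rank_kerAll
  refine ⟨{Z | Z ∈ MPerp L \ XPerp L ∧ ∀ x, P x (Z x) = 0}, fun Z hZ => hZ.1, ?_, ?_⟩
  · intro x hx Z hZ
    have hZ' := mem_MPerp_iff.1 hZ
    let W : VF E k Q := Z - fun y => P y (Z y)
    have hW : W ∈ MPerp L := mem_MPerp_iff.2 ⟨hZ'.1.sub (hP Z hZ'.1), fun y =>
      sub_mem (hZ'.2 y) (sup_le_MAt hL y (hP1 y _))⟩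
    have hPW : ∀ y, P y (W y) = 0 := fun y => by
      change P y (Z y - P y (Z y)) = 0
      rw [map_sub, hP2 y _ (hP1 y _), sub_self]
    have hZW : Z x = W x + P x (Z x) := (sub_add_cancel _ _).symm
    obtain ⟨u, hu, w, hw, huw⟩ := Submodule.mem_sup.1 (hP1 x (Z x))
    -- The labels must lie outside [𝔛ᵏ]^⊥; if W falls inside, it is absorbed into the characteristic
    -- part.
    by_cases hWX : W ∈ XPerp L
    · obtain ⟨Z₀, hZ₀, hZ₀x⟩ := hS.exists_XPerp (add_mem (((mem_XPerp_iff hL).1 hWX).2 x) hw)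
      refine ⟨0, zero_mem _, u, hu, Z₀, hZ₀, ?_⟩
      rw [hZ₀x, hZW, ← huw, Pi.zero_apply]
      abel
    · obtain ⟨Z₀, hZ₀, hZ₀x⟩ := hS.exists_XPerp hw
      refine ⟨W, Submodule.subset_span ⟨⟨hW, hWX⟩, hPW⟩, u, hu, Z₀, hZ₀, ?_⟩
      rw [hZ₀x, hZW, ← huw, add_assoc]
  · intro x hx Z hZ h
    have hZM := span_subset_MPerp (fun Z hZ => hZ.1.1) hZ
    have hPZ : P x (Z x) = 0 := by
      clear h hZM
      induction hZ using Submodule.span_induction with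
      | mem Z hZ => exact hZ.2 x
      | zero => exact map_zero _
      | add Z W _ _ h1 h2 => rw [Pi.add_apply, map_add, h1, h2, add_zero]
      | smul c Z _ h1 => rw [Pi.smul_apply, map_smul, h1, smul_zero]
    -- Z x lies both in the subspace onto which P projects and in the kernel of P. The differential
    -- of η depends only on Z x, so it vanishes.
    have hZ0 : Z x = 0 := (hP2 x _ (hS.mem_sup_of_dAt_eq_zero (hsol x hx) hZM h)).symm.trans hPZ
    obtain ⟨b, hb, -, -⟩ := hS.exists_pairing (hsol x hx)
    refine ContinuousLinearMap.ext fun u => ?_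
    rw [hb Z hZM, hZ0, map_zero]
    rfl

/-- If `X` satisfies the fibre components of the Lagrangian equation everywhere, all SOPDE
constraints form a complete independent system. -/
theorem IsRegularSetting.isConstraintSystem_diff (hS : IsRegularSetting L Γ₀ X)
    (hsol : ∀ x ∈ S1 L X, HasSopdeSolution L x)
    (hX : ∀ x, ∀ u ∈ vert x, Om L x (fun α => X α x) u = dAt (kModel E k) (energy L) x u) :
    IsConstraintSystem L Γ₀ X (MPerp L \ XPerp L) := by
  have hL := hS.smooth
  have h0 : (0 : VF E k Q) ∈ XPerp L :=
    (mem_XPerp_iff hL).2 ⟨isSmoothVF_zero, fun _ => zero_mem _⟩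
  refine ⟨subset_rfl, fun x hx Z hZ => ?_, fun x hx Z hZ h => ?_⟩
  · by_cases hZX : Z ∈ XPerp L
    · refine ⟨0, zero_mem _, 0, zero_mem _, Z, hZX, ?_⟩
      rw [Pi.zero_apply, zero_add, zero_add]
    · refine ⟨Z, Submodule.subset_span ⟨hZ, hZX⟩, 0, zero_mem _, 0, h0, ?_⟩
      rw [Pi.zero_apply, add_zero, add_zero]
  · have hZM := span_subset_MPerp sdiff_subset hZ
    obtain ⟨v, hv, w, hw, hvw⟩ :=
      Submodule.mem_sup.1 (hS.mem_sup_of_dAt_eq_zero (hsol x hx) hZM h)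
    obtain ⟨b, hb, -, -⟩ := hS.exists_pairing (hsol x hx)
    obtain ⟨V, hV, hVv, rfl⟩ := hasGlobalProj_vert.exists_section hv
    obtain ⟨W, hW, rfl⟩ := hS.exists_XPerp hw
    have hVM : V ∈ MPerp L := mem_MPerp_iff.2 ⟨hV, fun y => vert_le_MAt hL y (hVv y)⟩
    -- The global assumption on X makes η vanish identically for vertical labels, not merely on P₁,
    -- so its full differential is zero.
    have hV0 : eta L Γ₀ X V = fun _ => 0 := funext fun y =>
      eta_eq_zero_of_mem_vert hL (hS.sopde_Γ₀ y) (hVv y) (hX y _ (hVv y))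
    have hW0 : eta L Γ₀ X W = fun _ => 0 := funext fun y =>
      eta_eq_zero_of_mem_kerAll hL (((mem_XPerp_iff hL).1 hW).2 y)
    have hd0 : dAt (kModel E k) (fun _ : KTangent E k Q => (0 : ℝ)) x = 0 := mfderiv_const
    refine ContinuousLinearMap.ext fun u => ?_
    rw [hb Z hZM, ← hvw, map_add, ← hb V hVM, ← hb W (XPerp_subset_MPerp hL hW), hV0, hW0, hd0]
    exact add_zero _

end Constraints

/-! ### Solving the tangency equations for the SOPDE constraints -/

section Solutions

variable {E : Type*} [NormedAddCommGroup E] [NormedSpace ℝ E] [FiniteDimensional ℝ E] {k : ℕ}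
variable {Q : Type*} [TopologicalSpace Q] [ChartedSpace E Q] [IsManifold 𝓘(ℝ, E) ∞ Q]
variable [T2Space Q] [SecondCountableTopology Q]
variable {L : KTangent E k Q → ℝ} {Γ₀ X : KVF E k Q}

/-- The linear map with matrix `A`, as a continuous linear map. -/
def matrixCLM {r : ℕ} (A : Fin r → Fin r → ℝ) : (Fin r → ℝ) →L[ℝ] (Fin r → ℝ) :=
  ∑ i, ∑ j, A i j • (ContinuousLinearMap.proj (R := ℝ) (φ := fun _ : Fin r => ℝ) j).smulRight
    (Pi.single i 1 : Fin r → ℝ)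

theorem matrixCLM_apply {r : ℕ} (A : Fin r → Fin r → ℝ) (c : Fin r → ℝ) (i : Fin r) :
    matrixCLM A c i = ∑ j, A i j * c j := by
  simp only [matrixCLM, sum_apply, smul_apply, ContinuousLinearMap.smulRight_apply,
    Finset.sum_apply, Pi.smul_apply, ContinuousLinearMap.proj_apply, smul_eq_mul]
  rw [Finset.sum_eq_single i]
  · simp
  · intro i' _ h
    simp [Pi.single_eq_of_ne (Ne.symm h)]
  · intro h; exact absurd (Finset.mem_univ i) h

/-- Around a point `x`, the constraints of a complete independent system are governed by finitely
many of them, for which there are dual vertical characteristic vectors at `x`. -/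
theorem IsConstraintSystem.exists_basis (hS : IsRegularSetting L Γ₀ X) {𝒵 : Set (VF E k Q)}
    (h𝒵 : IsConstraintSystem L Γ₀ X 𝒵) {x : KTangent E k Q} (hx : x ∈ S1 L X)
    (hsol : HasSopdeSolution L x) :
    ∃ (r : ℕ) (Z : Fin r → VF E k Q) (V : Fin r → VF E k Q),
      (∀ i, Z i ∈ Submodule.span ℝ 𝒵) ∧
      (∀ j, IsSmoothVF (kModel E k) (V j) ∧ ∀ y, V j y ∈ vert y ⊓ kerAll L y) ∧
      (∀ i j, dAt (kModel E k) (eta L Γ₀ X (Z i)) x (V j x) = if i = j then 1 else 0) ∧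
      r + Module.finrank ℝ ↥(vert x ⊔ kerAll L x) = Module.finrank ℝ (MAt L x) := by
  have hL := hS.smooth
  have : FiniteDimensional ℝ (TK x) := inferInstanceAs (FiniteDimensional ℝ (E × (Fin k → E)))
  have h𝒵M : 𝒵 ⊆ MPerp L := fun Z hZ => (h𝒵.subset hZ).1
  obtain ⟨b, hb, hbK, -⟩ := hS.exists_pairing hsol
  obtain ⟨r, z, hzN, hind, hr⟩ := exists_basis_mod (B := vert x ⊔ kerAll L x) (M := MAt L x)
    (N := (Submodule.span ℝ 𝒵).map (LinearMap.proj x)) (sup_le_MAt hL x)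
    (by
      rintro _ ⟨Z, hZ, rfl⟩
      exact (mem_MPerp_iff.1 (span_subset_MPerp h𝒵M hZ)).2 x)
    (by
      intro m hm
      obtain ⟨Z, hZ, rfl⟩ := hS.exists_MPerp hm
      obtain ⟨Z', hZ', u, hu, Z₀, hZ₀, h⟩ := h𝒵.complete x hx Z hZ
      rw [h, add_assoc]
      exact Submodule.add_mem_sup ⟨Z', hZ', rfl⟩
        (Submodule.add_mem_sup hu (((mem_XPerp_iff hL).1 hZ₀).2 x)))
  choose Z hZ hZx using fun i => Submodule.mem_map.1 (hzN i)
  have hzM : ∀ i, z i ∈ MAt L x := fun i => by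
    rw [← hZx i]
    exact (mem_MPerp_iff.1 (span_subset_MPerp h𝒵M (hZ i))).2 x
  let T : ↥(vert x ⊓ kerAll L x) →ₗ[ℝ] Fin r → ℝ :=
    LinearMap.pi fun i => (b.flip (z i)).comp (Submodule.subtype _)
  -- A functional f killing the range gives a combination of the z i that pairs to zero with all of
  -- K. It then lies in `vert ⊔ kerAll`, so independence modulo that subspace forces f = 0.
  have hT : LinearMap.range T = ⊤ := by
    by_contra hne
    obtain ⟨f, hf, hTf⟩ := Submodule.exists_le_ker_of_lt_top _ (lt_top_iff_ne_top.2 hne)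
    refine hf (LinearMap.ext fun c => ?_)
    have h1 : (fun i => f (Pi.single i 1)) = 0 := by
      refine hind _ (hbK _ (sum_mem fun i _ => Submodule.smul_mem _ _ (hzM i)) fun v hv => ?_)
      have h2 : f (T ⟨v, hv⟩) = 0 := hTf (LinearMap.mem_range_self T _)
      rw [LinearMap.pi_apply_eq_sum_univ] at h2
      rw [map_sum, ← h2]
      refine Finset.sum_congr rfl fun i _ => ?_
      rw [map_smul, smul_eq_mul, smul_eq_mul, mul_comm]
      congr 2
      funext j
      simp [Pi.single_apply, eq_comm]
    rw [LinearMap.pi_apply_eq_sum_univ]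
    refine Finset.sum_eq_zero fun i _ => ?_
    have h3 := congrFun h1 i
    have h4 : (fun j => if i = j then (1 : ℝ) else 0) = Pi.single i 1 := by
      funext j
      simp [Pi.single_apply, eq_comm]
    rw [h4]
    exact (congrArg (c i • ·) h3).trans (smul_zero _)
  choose v hv using fun j => LinearMap.range_eq_top.1 hT (Pi.single j 1)
  choose V hV hVK hVx using fun j => (hasGlobalProj_inf hL hS.rank_inf).exists_section (v j).2
  refine ⟨r, Z, V, hZ, fun j => ⟨hV j, hVK j⟩, fun i j => ?_, hr⟩
  rw [hb _ (span_subset_MPerp h𝒵M (hZ i)), hVx]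
  have h5 := congrFun (hv j) i
  rw [Pi.single_apply] at h5
  rw [← h5, show Z i x = z i from hZx i]
  rfl

theorem IsConstraintSystem.exists_local_solution (hS : IsRegularSetting L Γ₀ X)
    {𝒵 : Set (VF E k Q)} (h𝒵 : IsConstraintSystem L Γ₀ X 𝒵)
    (hsol : ∀ x ∈ S1 L X, HasSopdeSolution L x) {x : KTangent E k Q} (hx : x ∈ S1 L X)
    {G : VF E k Q} (hG : IsSmoothVF (kModel E k) G) :
    ∃ U ∈ 𝓝 x, ∃ V : VF E k Q,
      ContMDiffOn (kModel E k) (kModel E k).tangent ∞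
        (fun y => (⟨y, V y⟩ : TangentBundle (kModel E k) (KTangent E k Q))) U ∧
      ∀ y ∈ U, V y ∈ vert y ⊓ kerAll L y ∧ (y ∈ S1 L X → ∀ Z ∈ 𝒵,
        dAt (kModel E k) (eta L Γ₀ X Z) y (V y) = - dAt (kModel E k) (eta L Γ₀ X Z) y (G y)) := by
  have hL := hS.smooth
  have h𝒵M : 𝒵 ⊆ MPerp L := fun Z hZ => (h𝒵.subset hZ).1
  obtain ⟨r, Z, V, hZ, hV, hZV, hr⟩ := h𝒵.exists_basis hS hx (hsol x hx)
  have hZM := fun i => span_subset_MPerp h𝒵M (hZ i)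
  have hη : ∀ i, ContMDiff (kModel E k) 𝓘(ℝ, ℝ) ∞ (eta L Γ₀ X (Z i)) := fun i =>
    contMDiff_eta hL hS.smooth_Γ₀ hS.smooth_X (hZM i).1
  let A : KTangent E k Q → Fin r → Fin r → ℝ := fun y i j =>
    dAt (kModel E k) (eta L Γ₀ X (Z i)) y (V j y)
  let Φ : KTangent E k Q → (Fin r → ℝ) →L[ℝ] (Fin r → ℝ) := fun y => matrixCLM (A y)
  have hΦ : ContMDiff (kModel E k) 𝓘(ℝ, (Fin r → ℝ) →L[ℝ] (Fin r → ℝ)) ∞ Φ :=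
    contMDiff_finsetSum fun i _ => contMDiff_finsetSum fun j _ =>
      ((hV j).1.contMDiff_dAt (hη i)).smul contMDiff_const
  -- The dual choice of the fields V j makes the coefficient matrix the identity at x, so it stays
  -- invertible nearby and the system is solved smoothly by its inverse.
  have hΦx : Φ x = 1 := by
    refine ContinuousLinearMap.ext fun c => funext fun i => ?_
    rw [matrixCLM_apply]
    simp [A, hZV]
  let O : Set (KTangent E k Q) := Φ ⁻¹' {a | IsUnit a}
  have hO : IsOpen O := Units.isOpen.preimage hΦ.continuous
  have hxO : x ∈ O := by
    change IsUnit (Φ x)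
    rw [hΦx]; exact isUnit_one
  let ρ : KTangent E k Q → Fin r → ℝ := fun y i =>
    - dAt (kModel E k) (eta L Γ₀ X (Z i)) y (G y)
  have hρ : ContMDiff (kModel E k) 𝓘(ℝ, Fin r → ℝ) ∞ ρ :=
    contMDiff_pi_space.2 fun i => (hG.contMDiff_dAt (hη i)).neg
  let c : KTangent E k Q → Fin r → ℝ := fun y => Ring.inverse (Φ y) (ρ y)
  have hc : ContMDiffOn (kModel E k) 𝓘(ℝ, Fin r → ℝ) ∞ c O := by
    rintro y ⟨a, ha⟩
    have h1 : ContMDiffAt (kModel E k) 𝓘(ℝ, (Fin r → ℝ) →L[ℝ] (Fin r → ℝ)) ∞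
        (fun y => Ring.inverse (Φ y)) y := by
      have h2 : ContDiffAt ℝ ∞ (Ring.inverse : ((Fin r → ℝ) →L[ℝ] (Fin r → ℝ)) → _) (Φ y) := by
        rw [← ha]
        exact contDiffAt_ringInverse ℝ a
      exact h2.contMDiffAt.comp y hΦ.contMDiffAt
    exact (h1.clm_apply hρ.contMDiffAt).contMDiffWithinAt
  have hΦc : ∀ y ∈ O, Φ y (c y) = ρ y := fun y hy =>
    DFunLike.congr_fun (Ring.mul_inverse_cancel _ hy) (ρ y)
  have hrank : ∀ᶠ y in 𝓝 x,
      r + Module.finrank ℝ ↥(vert y ⊔ kerAll L y) = Module.finrank ℝ (MAt L y) := by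
    filter_upwards [finrank_sup_eventually hS x, hS.rank_MAt.eventually_eq x] with y h1 h2
    omega
  refine ⟨_, inter_mem (hO.mem_nhds hxO) hrank, fun y => ∑ j, c y j • V j y, ?_, ?_⟩
  · refine ContMDiffOn.mono ?_ inter_subset_left
    exact ContMDiffOn.sum_section fun j _ =>
      (contMDiffOn_pi_space.1 hc j).smul_section (hV j).1.contMDiffOn
  · rintro y ⟨hyO, hyr⟩
    refine ⟨sum_mem fun j _ => Submodule.smul_mem _ _ ((hV j).2 y), fun hy W hW => ?_⟩
    have : FiniteDimensional ℝ (TK y) := inferInstanceAs (FiniteDimensional ℝ (E × (Fin k → E)))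
    obtain ⟨b, hb, hbK, hbB⟩ := hS.exists_pairing (hsol y hy)
    have hWM := h𝒵M hW
    have hsolved : ∀ i, b (∑ j, c y j • V j y) (Z i y) = - b (G y) (Z i y) := by
      intro i
      have h1 := congrFun (hΦc y hyO) i
      rw [matrixCLM_apply] at h1
      rw [← hb _ (hZM i), ← hb _ (hZM i)]
      refine Eq.trans ?_ h1
      rw [map_sum]
      refine Finset.sum_congr rfl fun j _ => ?_
      rw [map_smul, smul_eq_mul, mul_comm]
    -- A combination in `vert ⊔ kerAll` pairs to zero with the V j, which are tangent to P₁, so a is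
    -- killed by the invertible matrix. With the rank count `hyr`, the Z i y form a basis of `MAt`
    -- modulo that subspace.
    have hind : ∀ a : Fin r → ℝ, ∑ i, a i • Z i y ∈ vert y ⊔ kerAll L y → a = 0 := by
      intro a ha
      have h1 : ∀ j, ∑ i, a i * A y i j = 0 := by
        intro j
        have h2 := hbB _ ha (V j y) (hS.isTangentTo (hsol y hy) ((hV j).2 y))
        rw [map_sum] at h2
        rw [← h2]
        refine Finset.sum_congr rfl fun i _ => ?_
        rw [map_smul, smul_eq_mul, ← hb _ (hZM i)]
      funext i
      have h3 : Φ y (Ring.inverse (Φ y) (Pi.single i 1)) = Pi.single i 1 :=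
        DFunLike.congr_fun (Ring.mul_inverse_cancel _ hyO) _
      have h4 : ∑ i', a i' * Φ y (Ring.inverse (Φ y) (Pi.single i 1)) i' = 0 := by
        simp only [Φ, matrixCLM_apply, Finset.mul_sum]
        rw [Finset.sum_comm]
        refine Finset.sum_eq_zero fun j _ => ?_
        simp only [← mul_assoc]
        rw [← Finset.sum_mul, h1 j, zero_mul]
      rw [h3] at h4
      simpa [Pi.single_apply] using h4
    obtain ⟨a, ha⟩ := exists_sub_sum_mem_of_finrank_eq (sup_le_MAt hL y)
      (fun i => (mem_MPerp_iff.1 (hZM i)).2 y) hind hyr ((mem_MPerp_iff.1 hWM).2 y)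
    have hW' : W - ∑ i, a i • Z i ∈ Submodule.span ℝ 𝒵 :=
      sub_mem (Submodule.subset_span hW) (sum_mem fun i _ => Submodule.smul_mem _ _ (hZ i))
    have hW'y : (W - ∑ i, a i • Z i) y = W y - ∑ i, a i • Z i y := by
      rw [Pi.sub_apply, Finset.sum_apply]
      rfl
    -- W minus its expansion in the Z i has value in `vert ⊔ kerAll`, so its differential is zero on
    -- the tangent vectors of P₁. Independence makes it zero on all vectors, including G y, which
    -- need not be tangent to P₁.
    have h0 := h𝒵.independent y hy _ hW' fun u hu => by
      rw [hb _ (span_subset_MPerp h𝒵M hW'), hW'y]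
      exact hbB _ ha u hu
    have hbW : ∀ u, b u (W y) = ∑ i, a i * b u (Z i y) := by
      intro u
      have h1 := DFunLike.congr_fun h0 u
      rw [hb _ (span_subset_MPerp h𝒵M hW'), hW'y, map_sub, map_sum] at h1
      simp only [map_smul, smul_eq_mul] at h1
      exact sub_eq_zero.1 h1
    rw [hb W hWM, hb W hWM, hbW, hbW, ← Finset.sum_neg_distrib]
    refine Finset.sum_congr rfl fun i _ => ?_
    rw [hsolved, mul_neg]

/-- The tangency equations for a complete independent system of SOPDE constraints have a global
solution by vertical characteristic fields. -/
theorem IsConstraintSystem.exists_solution (hS : IsRegularSetting L Γ₀ X)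
    {𝒵 : Set (VF E k Q)} (h𝒵 : IsConstraintSystem L Γ₀ X 𝒵) (hclosed : IsClosed (S1 L X))
    (hsol : ∀ x ∈ S1 L X, HasSopdeSolution L x)
    {G : VF E k Q} (hG : IsSmoothVF (kModel E k) G) :
    ∃ V : VF E k Q, IsSmoothVF (kModel E k) V ∧ (∀ y, V y ∈ vert y ⊓ kerAll L y) ∧
      ∀ y ∈ S1 L X, ∀ Z ∈ 𝒵, dAt (kModel E k) (eta L Γ₀ X Z) y (V y) =
        - dAt (kModel E k) (eta L Γ₀ X Z) y (G y) := by
  have : IsManifold (kModel E k) (∞ + 1) (KTangent E k Q) :=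
    inferInstanceAs (IsManifold (kModel E k) ∞ (KTangent E k Q))
  have hb := TangentBundle.contMDiffVectorBundle (I := kModel E k) (M := KTangent E k Q) (n := ∞)
  -- The solutions at each point form an affine subset of K, so local solutions can be averaged. Off
  -- the closed set S₁ there is no equation, and zero serves.
  have key := exists_contMDiffSection_forall_mem_convex_of_local (n := (⊤ : ℕ∞)) (kModel E k)
    (F_fiber := E × (Fin k → E)) (fun y : KTangent E k Q => TK y)
    (fun y => {v | v ∈ vert y ⊓ kerAll L y ∧ (y ∈ S1 L X → ∀ Z ∈ 𝒵,
      dAt (kModel E k) (eta L Γ₀ X Z) y v = - dAt (kModel E k) (eta L Γ₀ X Z) y (G y))})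
  refine Exists.elim (key ?_ ?_) fun s hs => ?_
  rotate_left 2
  · exact ⟨fun y => s y, s.contMDiff, fun y => (hs y).1, fun y hy => (hs y).2 hy⟩
  · intro y v hv w hw p q _ _ hpq
    refine ⟨add_mem (Submodule.smul_mem _ _ hv.1) (Submodule.smul_mem _ _ hw.1), fun hy Z hZ => ?_⟩
    rw [map_add, map_smul, map_smul, hv.2 hy Z hZ, hw.2 hy Z hZ, ← add_smul, hpq, one_smul]
  · intro x
    by_cases hx : x ∈ S1 L X
    · exact h𝒵.exists_local_solution hS hsol hx hG
    · exact ⟨(S1 L X)ᶜ, hclosed.isOpen_compl.mem_nhds hx, fun _ => 0,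
        (isSmoothVF_zero (I := kModel E k)).contMDiffOn,
        fun y hy => ⟨zero_mem _, fun h => absurd h hy⟩⟩

end Solutions

/-! ### The five assertions -/

theorem mainTheorem8 {E : Type*} [NormedAddCommGroup E] [NormedSpace ℝ E] [FiniteDimensional ℝ E]
    {Q : Type*} [TopologicalSpace Q] [ChartedSpace E Q] [IsManifold 𝓘(ℝ, E) ∞ Q]
    [T2Space Q] [SecondCountableTopology Q] (k : ℕ)
    (L : KTangent E k Q → ℝ) (hL : ContMDiff (kModel E k) 𝓘(ℝ, ℝ) ∞ L)
    (hreg : IsAlmostRegular L)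
    (hker : IsLocallyConstant fun x => Module.finrank ℝ (kerAll L x))
    (hM : IsLocallyConstant fun x => Module.finrank ℝ (MAt L x))
    (hP1 : IsClosedSubmanifold (kModel E k) (P1 L))
    (X : KVF E k Q) (hX : IsSmoothKVF X) (hXL : ∀ x ∈ P1 L, IsLagrangianAt L x fun α => X α x)
    (hS1 : IsClosedSubmanifold (kModel E k) (S1 L X))
    (Γ₀ : KVF E k Q) (hΓ₀ : IsSmoothKVF Γ₀) (hΓ₀S : ∀ x, IsSopdeAt x fun α => Γ₀ α x)
    (Γ : KVF E k Q) (hΓ : IsSmoothKVF Γ)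
    (hΓL : ∀ x ∈ S1 L X, IsLagrangianAt L x fun α => Γ α x)
    (hΓS : ∀ x ∈ S1 L X, IsSopdeAt x fun α => Γ α x) :
    -- complete independent systems of SOPDE constraints exist
    (∃ 𝒵, IsConstraintSystem L Γ₀ X 𝒵) ∧
    -- all SOPDE constraints form such a system if `X` satisfies the fibre components of the
    -- Lagrangian equation everywhere
    ((∀ x, ∀ u ∈ vert x, Om L x (fun α => X α x) u = dAt (kModel E k) (energy L) x u) →
      IsConstraintSystem L Γ₀ X (MPerp L \ XPerp L)) ∧
    -- the tangency equations for the SOPDE constraints have a global solution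
    (∀ 𝒵, IsConstraintSystem L Γ₀ X 𝒵 →
      ∃ V ∈ verticalKVF E k Q, (∀ α x, cartanTwo L α x (V α x) = 0) ∧
        ∀ Z ∈ 𝒵, ∀ α, ∀ x ∈ S1 L X,
          dAt (kModel E k) (eta L Γ₀ X Z) x (Γ α x) =
            - dAt (kModel E k) (eta L Γ₀ X Z) x (V α x)) ∧
    -- only the dynamical constraints contribute to `S₂`
    (∀ 𝒵, IsConstraintSystem L Γ₀ X 𝒵 →
      {x | x ∈ S1 L X ∧ ∃ V ∈ kerVertOm L,
        (∀ Z ∈ XPerp L, ∀ α, dAt (kModel E k) (zeta L Z) x (Γ α x + V α x) = 0) ∧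
        (∀ Z ∈ 𝒵, ∀ α, dAt (kModel E k) (eta L Γ₀ X Z) x (Γ α x + V α x) = 0)} =
      {x | x ∈ S1 L X ∧ ∃ V ∈ kerVertOm L,
        ∀ Z ∈ XPerp L, ∀ α, dAt (kModel E k) (zeta L Z) x (Γ α x + V α x) = 0}) ∧
    -- the same for all SOPDE constraints and arbitrary `X`, with tangency to `P₁`
    ({x | x ∈ S1 L X ∧ ∃ V ∈ kerVertOm L,
        (∀ α, IsTangentTo (kModel E k) (P1 L) x (Γ α x + V α x)) ∧
        (∀ Z ∈ MPerp L \ XPerp L, ∀ α,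
          dAt (kModel E k) (eta L Γ₀ X Z) x (Γ α x + V α x) = 0)} =
      {x | x ∈ S1 L X ∧ ∃ V ∈ kerVertOm L,
        ∀ α, IsTangentTo (kModel E k) (P1 L) x (Γ α x + V α x)}) := by
  have hS : IsRegularSetting L Γ₀ X := ⟨hL, hreg.finrank_vert_inf_kerAll hL, hker, hM, hX, hXL,
    hΓ₀, hΓ₀S⟩
  have hsol : ∀ x ∈ S1 L X, HasSopdeSolution L x := fun x hx => ⟨_, hΓL x hx, hΓS x hx⟩
  refine ⟨hS.exists_isConstraintSystem hsol, hS.isConstraintSystem_diff hsol, ?_, ?_, ?_⟩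
  · intro 𝒵 h𝒵
    choose V hV hVK hVs using fun α => h𝒵.exists_solution hS hS1.1 hsol (hΓ α)
    have hVk := mem_kerVertOm_of_mem hV fun α x => hVK α x
    refine ⟨V, hVk.1, fun α x => ?_, fun Z hZ α x hx => ?_⟩
    · exact LinearMap.mem_ker.1 ((Submodule.mem_iInf _).1 (hVK α x).2 α)
    · rw [hVs α x hx Z hZ, neg_neg]
  · intro 𝒵 h𝒵
    refine Subset.antisymm (fun x ⟨hx, V, hV, h1, _⟩ => ⟨hx, V, hV, h1⟩) ?_
    rintro x ⟨hx, V, hV, h1⟩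
    -- The SOPDE equations are solved for Γ + V rather than Γ. The correction W is tangent to P₁,
    -- where the functions ζ vanish, so the dynamical equations persist.
    choose W hW hWK hWs using fun α =>
      h𝒵.exists_solution hS hS1.1 hsol ((hΓ α).add (hV.1.1 α))
    refine ⟨hx, V + W, add_mem_kerVertOm hV (mem_kerVertOm_of_mem hW hWK),
      fun Z hZ α => ?_, fun Z hZ α => ?_⟩
    · have hζ : ContMDiff (kModel E k) 𝓘(ℝ, ℝ) ∞ (zeta L Z) := hZ.1.contMDiff_dAt (contMDiff_energy hL)
      have h2 := (hS.isTangentTo (hsol x hx) (hWK α x)).dAt_eq_zero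
        (hζ.mdifferentiableAt (by simp)) fun y hy =>
          (mem_P1_iff hL).1 hy _ (((mem_XPerp_iff hL).1 hZ).2 y)
      rw [Pi.add_apply, Pi.add_apply, ← add_assoc, map_add, h1 Z hZ α, h2, add_zero]
    · have h2 := hWs α x hx Z hZ
      rw [Pi.add_apply] at h2
      rw [Pi.add_apply, Pi.add_apply, ← add_assoc, map_add, h2, add_neg_cancel]
  · refine Subset.antisymm (fun x ⟨hx, V, hV, h1, _⟩ => ⟨hx, V, hV, h1⟩) ?_
    rintro x ⟨hx, V, hV, h1⟩
    have : FiniteDimensional ℝ (TK x) := inferInstanceAs (FiniteDimensional ℝ (E × (Fin k → E)))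
    obtain ⟨b, hb, hbK, hbB⟩ := hS.exists_pairing (hsol x hx)
    -- A vector of `MAt` orthogonal to K lies in `vert ⊔ kerAll`, where b(Γ_α + V_α, ·) vanishes by
    -- tangency to P₁. So a single vector of K cancels this functional for all labels at once, with
    -- no independence needed.
    choose w hw hwb using fun α => exists_mem_of_pairing (K := vert x ⊓ kerAll L x) (M := MAt L x) b
      (-(b (Γ α x + V α x))) fun z hz hzK => by
        rw [LinearMap.neg_apply, hbB z (hbK z hz hzK) _ (h1 α), neg_zero]
    choose W hW hWK hWx using fun α => (hasGlobalProj_inf hL hS.rank_inf).exists_section (hw α)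
    refine ⟨hx, V + W, add_mem_kerVertOm hV (mem_kerVertOm_of_mem hW hWK),
      fun α => ?_, fun Z hZ α => ?_⟩
    · rw [Pi.add_apply, Pi.add_apply, ← add_assoc]
      exact hP1.2.isTangentTo_add hx.1 (h1 α) (hS.isTangentTo (hsol x hx) (hWK α x))
    · rw [Pi.add_apply, Pi.add_apply, ← add_assoc, hb Z hZ.1, map_add, LinearMap.add_apply, hWx,
        hwb α _ ((mem_MPerp_iff.1 hZ.1).2 x), LinearMap.neg_apply, add_neg_cancel]

end
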